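/- Let $d\ge 1$, $p_1,q_1,p_2,q_2,p,q\in[1,\infty]$ (with $1/\infty=0$), and $v_s(z)=(1+|z|^2)^{s/2}$ for $z\in\mathbb R^{2d}$, $s\in\mathbb R$. For a tempered distribution $f$ on $\mathbb R^n$ and a nonzero window $g\in\mathcal S(\mathbb R^n)$ let $V_gf(x,\xi)=\int f(t)\overline{g(t-x)}e^{-2\pi i\xi t}\,dt$ (in the sense of distributions), and write $$\|f\|_{M^{p,q}_m}=\Big(\int\Big(\int|V_gf(x,\xi)|^p m(x,\xi)^p\,dx\Big)^{q/p}d\xi\Big)^{1/q},\qquad \|f\|_{W(\mathcal FL^p,L^q_w)}=\Big(\int\Big(\int|V_gf(x,\xi)|^p\,d\xi\Big)^{q/p}w(x)^q\,dx\Big)^{1/q}$$ (suprema if $p=\infty$ or $q=\infty$); the spaces $M^{p,q}_m(\mathbb R^n)$ and $W(\mathcal FL^p,L^q_w)(\mathbb R^n)$ consist of the tempered distributions for which these norms are finite, and $M^{p,q}$, $W(\mathcal FL^p,L^q)$ denote the spaces with weight $1$. All norms are computed with arbitrary fixed nonzero Schwartz windows. For $f_1,f_2\in\mathcal S'(\mathbb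 R^d)$ let $V_{f_1}f_2$ and $A(f_1,f_2)$ denote the tempered distributions on $\mathbb R^{2d}$ which extend $$V_{f_1}f_2(x,\xi)=\int f_2(t)\overline{f_1(t-x)}e^{-2\pi i\xi t}\,dt,\qquad A(f_1,f_2)(x,\xi)=\int e^{-2\pi i\xi t}f_1(t+\tfrac x2)\overline{f_2(t-\tfrac x2)}\,dt .$$ Consider the index conditions $$p_1,q_1,p_2,q_2\le q,\qquad \frac1{p_1}+\frac1{p_2}\ge\frac1p+\frac1q,\qquad \frac1{q_1}+\frac1{q_2}\ge\frac1p+\frac1q. \tag{$*$}$$ (i) If $(*)$ holds and $s\in\mathbb R$, there is a constant $C>0$, independent of $f_1,f_2$, such that for all $f_1\in M^{p_1,q_1}_{v_{|s|}}(\mathbb R^d)$ and $f_2\in M^{p_2,q_2}_{v_s}(\mathbb R^d)$ we have $V_{f_1}f_2\in W(\mathcal FL^p,L^q_{v_s})(\mathbb R^{2d})$ and $$\|V_{f_1}f_2\|_{W(\mathcal FL^p,L^q_{v_s})(\mathbb R^{2d})}\le C\,\|f_1\|_{M^{p_1,q_1}_{v_{|s|}}(\mathbb R^d)}\,\|f_2\|_{M^{p_2,q_2}_{v_s}(\mathbb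 R^d)},$$ and the same holds with $A(f_1,f_2)$ in place of $V_{f_1}f_2$. (ii) Conversely, if there is a constant $C>0$ such that $$\|V_{f_1}f_2\|_{W(\mathcal FL^p,L^q)(\mathbb R^{2d})}\le C\,\|f_1\|_{M^{p_1,q_1}(\mathbb R^d)}\,\|f_2\|_{M^{p_2,q_2}(\mathbb R^d)}\qquad\text{for all } f_1,f_2\in\mathcal S(\mathbb R^d),$$ then $(*)$ holds; the same is true with $A(f_1,f_2)$ in place of $V_{f_1}f_2$. -/

import Mathlib

open MeasureTheory
open scoped SchwartzMap ENNReal NNReal FourierTransform ContDiff LineDeriv InnerProductSpace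

namespace TimeFreq

set_option linter.unusedSectionVars false

section Aux

/-- `B` is dominated by finitely many Schwartz seminorms, uniformly in the parameter. -/
def SBound {X Y : Type*} [NormedAddCommGroup X] [NormedSpace ℝ X]
    (B : 𝓢(X, ℂ) → Y → ℝ) : Prop :=
  ∃ (s : Finset (ℕ × ℕ)) (C : ℝ), 0 ≤ C ∧
    ∀ (f : 𝓢(X, ℂ)) (y : Y), B f y ≤ C * s.sup (schwartzSeminormFamily ℂ X ℂ) f

variable {X X' Y : Type*} [NormedAddCommGroup X] [NormedSpace ℝ X]
  [NormedAddCommGroup X'] [NormedSpace ℝ X']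

theorem SBound.mono {B B' : 𝓢(X, ℂ) → Y → ℝ} (h : SBound B) (hB : ∀ f y, B' f y ≤ B f y) :
    SBound B' := by
  obtain ⟨s, C, hC, h⟩ := h
  exact ⟨s, C, hC, fun f y => (hB f y).trans (h f y)⟩

theorem SBound.add {B B' : 𝓢(X, ℂ) → Y → ℝ} (h : SBound B) (h' : SBound B') :
    SBound (fun f y => B f y + B' f y) := by
  obtain ⟨s, C, hC, h1⟩ := h
  obtain ⟨s', C', hC', h2⟩ := h'
  refine ⟨s ∪ s', C + C', by positivity, fun f y => ?_⟩
  beta_reduce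
  rw [add_mul]
  have e1 : s.sup (schwartzSeminormFamily ℂ X ℂ) f
      ≤ (s ∪ s').sup (schwartzSeminormFamily ℂ X ℂ) f :=
    (Finset.sup_mono Finset.subset_union_left :
      s.sup (schwartzSeminormFamily ℂ X ℂ) ≤ _) f
  have e2 : s'.sup (schwartzSeminormFamily ℂ X ℂ) f
      ≤ (s ∪ s').sup (schwartzSeminormFamily ℂ X ℂ) f :=
    (Finset.sup_mono Finset.subset_union_right :
      s'.sup (schwartzSeminormFamily ℂ X ℂ) ≤ _) f
  exact add_le_add ((h1 f y).trans (by gcongr)) ((h2 f y).trans (by gcongr))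

theorem SBound.sum {ι : Type*} (t : Finset ι) {B : ι → 𝓢(X, ℂ) → Y → ℝ}
    (h : ∀ i ∈ t, SBound (B i)) : SBound (fun f y => ∑ i ∈ t, B i f y) := by
  classical
  induction t using Finset.induction_on with
  | empty => exact ⟨∅, 0, le_rfl, fun f y => by simp⟩
  | insert a t ha ih =>
    simp_rw [Finset.sum_insert ha]
    exact (h a (Finset.mem_insert_self a t)).add
      (ih fun i hi => h i (Finset.mem_insert_of_mem hi))

theorem SBound.comp_right {Y' : Type*} {B : 𝓢(X, ℂ) → Y → ℝ} (h : SBound B) (r : Y' → Y) :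
    SBound (fun f y => B f (r y)) := by
  obtain ⟨s, C, hC, h⟩ := h
  exact ⟨s, C, hC, fun f y => h f (r y)⟩

theorem SBound.const_mul {B : 𝓢(X, ℂ) → Y → ℝ} (h : SBound B) {c : ℝ} (hc : 0 ≤ c) :
    SBound (fun f y => c * B f y) := by
  obtain ⟨s, C, hC, h⟩ := h
  refine ⟨s, c * C, by positivity, fun f y => ?_⟩
  rw [mul_assoc]
  exact mul_le_mul_of_nonneg_left (h f y) hc

theorem exists_seminorm_bound (q : Seminorm ℂ 𝓢(X, ℂ)) (hq : Continuous q) :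
    ∃ (s : Finset (ℕ × ℕ)) (C : ℝ), 0 ≤ C ∧
      ∀ f : 𝓢(X, ℂ), q f ≤ C * s.sup (schwartzSeminormFamily ℂ X ℂ) f := by
  obtain ⟨s, C, -, h⟩ := Seminorm.bound_of_continuous (schwartz_withSeminorms ℂ X ℂ) q hq
  exact ⟨s, C, C.2, fun f => h f⟩

theorem continuous_seminorm_comp (L : 𝓢(X, ℂ) →L[ℂ] 𝓢(X', ℂ)) (i : ℕ × ℕ) :
    Continuous ((schwartzSeminormFamily ℂ X' ℂ i).comp (L : 𝓢(X, ℂ) →ₗ[ℂ] 𝓢(X', ℂ))) :=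
  ((schwartz_withSeminorms ℂ X' ℂ).continuous_seminorm i).comp L.continuous

theorem sup_le_sum (s : Finset (ℕ × ℕ)) (f : 𝓢(X, ℂ)) :
    s.sup (schwartzSeminormFamily ℂ X ℂ) f ≤ ∑ i ∈ s, schwartzSeminormFamily ℂ X ℂ i f := by
  have := (Seminorm.finset_sup_le_sum (schwartzSeminormFamily ℂ X ℂ) s) f
  rwa [show (∑ i ∈ s, schwartzSeminormFamily ℂ X ℂ i) f
    = ∑ i ∈ s, schwartzSeminormFamily ℂ X ℂ i f from by
      rw [← FunLike.coeAddMonoidHom_apply, map_sum, Finset.sum_apply]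
      rfl] at this

theorem SBound.comp {B : 𝓢(X', ℂ) → Y → ℝ} (h : SBound B) (L : 𝓢(X, ℂ) →L[ℂ] 𝓢(X', ℂ)) :
    SBound (fun f y => B (L f) y) := by
  obtain ⟨s, C, hC, h⟩ := h
  have h2 : SBound (fun (f : 𝓢(X, ℂ)) (_ : Y) =>
      C * ∑ i ∈ s, schwartzSeminormFamily ℂ X' ℂ i (L f)) := by
    refine SBound.const_mul (SBound.sum s fun i _ => ?_) hC
    obtain ⟨s', C', hC', h'⟩ := exists_seminorm_bound _ (continuous_seminorm_comp L i)
    exact ⟨s', C', hC', fun f _ => h' f⟩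
  exact h2.mono fun f y => (h _ y).trans (mul_le_mul_of_nonneg_left (sup_le_sum s _) hC)

variable {Z : Type*} [NormedAddCommGroup Z] [NormedSpace ℝ Z]

/-- A family of functions stable under differentiation and rapidly decreasing uniformly in terms of
Schwartz seminorms consists of smooth functions with the same property of their derivatives. -/
theorem smooth_and_bound {ι : Type*} [Fintype ι] (A : 𝓢(X, ℂ) → Z → ℂ)
    (L : ι → 𝓢(X, ℂ) →L[ℂ] 𝓢(X, ℂ)) (N : ι → ℂ →L[ℝ] (Z →L[ℝ] ℂ))
    (hder : ∀ f z, HasFDerivAt (A f) (∑ i, N i (A (L i f) z)) z)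
    (h0 : ∀ k : ℕ, SBound (fun f z => ‖z‖ ^ k * ‖A f z‖)) (n : ℕ) :
    (∀ f, ContDiff ℝ n (A f)) ∧
      ∀ k : ℕ, SBound (fun f z => ‖z‖ ^ k * ‖iteratedFDeriv ℝ n (A f) z‖) := by
  induction n with
  | zero =>
    refine ⟨fun f => ?_, fun k => ?_⟩
    · exact contDiff_zero.2 (continuous_iff_continuousAt.2 fun z => (hder f z).continuousAt)
    · simpa using h0 k
  | succ n ih =>
    obtain ⟨ih1, ih2⟩ := ih
    have hf : ∀ f, fderiv ℝ (A f) = fun z => ∑ i, ((N i) ∘ (A (L i f))) z := fun f => by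
      ext1 z
      rw [(hder f z).fderiv]
      simp
    have hc : ∀ f i, ContDiff ℝ n ((N i) ∘ (A (L i f))) := fun f i =>
      (N i).contDiff.comp (ih1 _)
    refine ⟨fun f => ?_, fun k => ?_⟩
    · push_cast
      rw [contDiff_succ_iff_fderiv]
      refine ⟨fun z => (hder f z).differentiableAt, by simp, ?_⟩
      rw [hf]
      exact ContDiff.sum fun i _ => hc f i
    · have : SBound (fun f z => ∑ i, ‖N i‖ * (‖z‖ ^ k * ‖iteratedFDeriv ℝ n (A (L i f)) z‖)) :=
        SBound.sum _ fun i _ => ((ih2 k).comp (L i)).const_mul (norm_nonneg (N i))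
      refine this.mono fun f z => ?_
      rw [← norm_iteratedFDeriv_fderiv, hf, iteratedFDeriv_sum fun i _ => hc f i]
      simp only [Finset.sum_apply]
      calc _ ≤ ‖z‖ ^ k * ∑ i, ‖iteratedFDeriv ℝ n ((N i) ∘ (A (L i f))) z‖ := by
            gcongr; exact norm_sum_le _ _
        _ ≤ ‖z‖ ^ k * ∑ i, ‖N i‖ * ‖iteratedFDeriv ℝ n (A (L i f)) z‖ := by
            gcongr with i
            exact (N i).norm_iteratedFDeriv_comp_left (ih1 _).contDiffAt le_rfl
        _ = _ := by
            rw [Finset.mul_sum]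
            exact Finset.sum_congr rfl fun i _ => by ring

/-- The continuous linear map on Schwartz functions built from such a family. -/
noncomputable def mkOp {ι : Type*} [Fintype ι] (A : 𝓢(X, ℂ) → Z → ℂ)
    (hadd : ∀ f g z, A (f + g) z = A f z + A g z)
    (hsmul : ∀ (c : ℂ) f z, A (c • f) z = c • A f z)
    (L : ι → 𝓢(X, ℂ) →L[ℂ] 𝓢(X, ℂ)) (N : ι → ℂ →L[ℝ] (Z →L[ℝ] ℂ))
    (hder : ∀ f z, HasFDerivAt (A f) (∑ i, N i (A (L i f) z)) z)
    (h0 : ∀ k : ℕ, SBound (fun f z => ‖z‖ ^ k * ‖A f z‖)) : 𝓢(X, ℂ) →L[ℂ] 𝓢(Z, ℂ) :=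
  SchwartzMap.mkCLM A hadd hsmul
    (fun f => contDiff_infty.2 fun n => (smooth_and_bound A L N hder h0 n).1 f)
    (fun n => (smooth_and_bound A L N hder h0 n.2).2 n.1)

/-- First-order Taylor remainder of a Schwartz function. -/
noncomputable def remainder {X W : Type*} [NormedAddCommGroup X] [NormedSpace ℝ X]
    [NormedAddCommGroup W] [NormedSpace ℝ W] (f : 𝓢(X, W)) (v : X) : 𝓢(X, W) :=
  SchwartzMap.compSubConstCLM ℝ (-v) f - f - ∂_{v} f

theorem remainder_apply {X W : Type*} [NormedAddCommGroup X] [NormedSpace ℝ X]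
    [NormedAddCommGroup W] [NormedSpace ℝ W] (f : 𝓢(X, W)) (v z : X) :
    remainder f v z = f (z + v) - f z - fderiv ℝ f z v := by
  simp [remainder, SchwartzMap.lineDerivOp_apply_eq_fderiv]

theorem fderiv_remainder {X W : Type*} [NormedAddCommGroup X] [NormedSpace ℝ X]
    [NormedAddCommGroup W] [NormedSpace ℝ W] (f : 𝓢(X, W)) (v : X) :
    fderiv ℝ (remainder f v) = remainder (SchwartzMap.fderivCLM ℝ X W f) v := by
  have hf' : Differentiable ℝ (fderiv ℝ f) := (SchwartzMap.fderivCLM ℝ X W f).differentiable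
  ext z w
  have e : ((remainder f v : 𝓢(X, W)) : X → W)
      = fun z => f (z + v) - f z - fderiv ℝ f z v := funext (remainder_apply f v)
  have h1 : HasFDerivAt (fun z => f (z + v)) (fderiv ℝ f (z + v)) z :=
    (hasFDerivAt_comp_add_right v).2 (f.hasFDerivAt (z + v))
  have h3 : HasFDerivAt (fun z => fderiv ℝ f z v)
      ((fderiv ℝ (fderiv ℝ f) z).flip v) z := by
    have := (hf' z).hasFDerivAt.clm_apply (hasFDerivAt_const v z)
    simpa using this
  have h := (h1.sub (f.hasFDerivAt z)).sub h3
  have hs : IsSymmSndFDerivAt ℝ f z :=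
    (f.smooth 2).contDiffAt.isSymmSndFDerivAt (by simp)
  rw [e]
  erw [h.fderiv]
  rw [remainder_apply]
  simp only [SchwartzMap.fderivCLM_apply, sub_apply,
    ContinuousLinearMap.flip_apply]
  rw [hs w v]
  rfl

theorem remainder_bound {X : Type} [NormedAddCommGroup X] [NormedSpace ℝ X] (n : ℕ) :
    ∀ {W : Type} [NormedAddCommGroup W] [NormedSpace ℝ W] (f : 𝓢(X, W)) (k : ℕ),
      ∃ C : ℝ, 0 ≤ C ∧ ∀ v : X, ‖v‖ ≤ 1 → ∀ z : X,
        ‖z‖ ^ k * ‖iteratedFDeriv ℝ n (remainder f v) z‖ ≤ C * ‖v‖ ^ 2 := by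
  induction n with
  | zero =>
    intro W _ _ f k
    set f' := SchwartzMap.fderivCLM ℝ X W f with hf'
    set f'' := SchwartzMap.fderivCLM ℝ X (X →L[ℝ] W) f' with hf''
    obtain ⟨M, hM0, hM⟩ : ∃ M : ℝ, 0 ≤ M ∧ ∀ z, (1 + ‖z‖) ^ k * ‖f'' z‖ ≤ M := by
      refine ⟨2 ^ k * ((Finset.Iic (k, 0)).sup fun m => SchwartzMap.seminorm ℝ m.1 m.2) f'',
        by positivity, fun z => ?_⟩
      simpa using SchwartzMap.one_add_le_sup_seminorm_apply (𝕜 := ℝ) (m := (k, 0))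
        (k := k) (n := 0) le_rfl le_rfl f'' z
    refine ⟨2 ^ k * M, by positivity, fun v hv z => ?_⟩
    rw [norm_iteratedFDeriv_zero, remainder_apply]
    set K := 2 ^ k * M / (1 + ‖z‖) ^ k with hK
    have hK0 : 0 ≤ K := by positivity
    have hsec : ∀ w ∈ Metric.closedBall z ‖v‖, ‖fderiv ℝ f' w‖ ≤ K := by
      intro w hw
      have hw' : ‖w - z‖ ≤ 1 := (mem_closedBall_iff_norm.1 hw).trans hv
      have h1 : 1 + ‖z‖ ≤ 2 * (1 + ‖w‖) := by
        have : ‖z‖ ≤ ‖w‖ + ‖w - z‖ := by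
          have := norm_sub_norm_le z w
          rw [norm_sub_rev] at this; linarith
        nlinarith [norm_nonneg w]
      have h2 := hM w
      rw [hK, le_div_iff₀ (by positivity)]
      calc ‖fderiv ℝ f' w‖ * (1 + ‖z‖) ^ k ≤ ‖fderiv ℝ f' w‖ * (2 * (1 + ‖w‖)) ^ k := by gcongr
        _ = 2 ^ k * ((1 + ‖w‖) ^ k * ‖f'' w‖) := by
            rw [mul_pow, hf'', SchwartzMap.fderivCLM_apply]; ring
        _ ≤ 2 ^ k * M := by gcongr
    have hconv := convex_closedBall z ‖v‖
    have hz : z ∈ Metric.closedBall z ‖v‖ := Metric.mem_closedBall_self (norm_nonneg _)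
    have hzv : z + v ∈ Metric.closedBall z ‖v‖ := by simp
    have hfirst : ∀ w ∈ Metric.closedBall z ‖v‖, ‖fderiv ℝ f w - fderiv ℝ f z‖ ≤ K * ‖v‖ := by
      intro w hw
      have := hconv.norm_image_sub_le_of_norm_fderiv_le
        (fun x _ => f'.differentiableAt) hsec hz hw
      refine this.trans ?_
      gcongr
      exact mem_closedBall_iff_norm.1 hw
    have := hconv.norm_image_sub_le_of_norm_fderiv_le'
      (fun x _ => f.differentiableAt) hfirst hz hzv
    simp only [add_sub_cancel_left] at this
    calc ‖z‖ ^ k * ‖f (z + v) - f z - fderiv ℝ f z v‖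
        ≤ (1 + ‖z‖) ^ k * (K * ‖v‖ * ‖v‖) := by
          gcongr
          linarith
      _ = 2 ^ k * M * ‖v‖ ^ 2 := by
          rw [hK]; field_simp
  | succ n ih =>
    intro W _ _ f k
    obtain ⟨C, hC, h⟩ := ih (SchwartzMap.fderivCLM ℝ X W f) k
    refine ⟨C, hC, fun v hv z => ?_⟩
    rw [← norm_iteratedFDeriv_fderiv, fderiv_remainder]
    exact h v hv z

theorem clm_remainder_bound {X : Type} [NormedAddCommGroup X] [NormedSpace ℝ X]
    (G : 𝓢(X, ℂ) →L[ℂ] ℂ) (f : 𝓢(X, ℂ)) :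
    ∃ C : ℝ, 0 ≤ C ∧ ∀ v : X, ‖v‖ ≤ 1 → ‖G (remainder f v)‖ ≤ C * ‖v‖ ^ 2 := by
  obtain ⟨s, C, hC, hG⟩ := exists_seminorm_bound
    ((normSeminorm ℂ ℂ).comp (G : 𝓢(X, ℂ) →ₗ[ℂ] ℂ)) (continuous_norm.comp G.continuous)
  choose K hK0 hK using fun i : ℕ × ℕ => remainder_bound i.2 f i.1
  refine ⟨C * ∑ i ∈ s, K i, mul_nonneg hC (Finset.sum_nonneg fun i _ => hK0 i), fun v hv => ?_⟩
  calc ‖G (remainder f v)‖ ≤ C * s.sup (schwartzSeminormFamily ℂ X ℂ) (remainder f v) := hG _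
    _ ≤ C * ∑ i ∈ s, schwartzSeminormFamily ℂ X ℂ i (remainder f v) := by
        gcongr; exact sup_le_sum s _
    _ ≤ C * ∑ i ∈ s, K i * ‖v‖ ^ 2 := by
        gcongr with i
        exact SchwartzMap.seminorm_le_bound ℂ i.1 i.2 _
          (mul_nonneg (hK0 i) (by positivity)) (hK i v hv)
    _ = _ := by rw [← Finset.sum_mul, mul_assoc]

end Aux

section Slice

variable {E F : Type} [NormedAddCommGroup E] [InnerProductSpace ℝ E] [FiniteDimensional ℝ E]
  [NormedAddCommGroup F] [InnerProductSpace ℝ F] [FiniteDimensional ℝ F]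

/-- The restriction `y ↦ Φ (x, y)` of a Schwartz function on `E × F`. -/
noncomputable def slice (x : E) : 𝓢(E × F, ℂ) →L[ℂ] 𝓢(F, ℂ) :=
  SchwartzMap.compCLMOfAntilipschitz (K := 1) ℂ (g := fun y : F => ((x, y) : E × F))
    (by
      have : (fun y : F => ((x, y) : E × F))
          = fun y => ContinuousLinearMap.inr ℝ E F y + (x, 0) := by
        ext y <;> simp
      rw [this]
      fun_prop)
    (fun y y' => by simp [Prod.edist_eq])

@[simp] theorem slice_apply (x : E) (f : 𝓢(E × F, ℂ)) (y : F) : slice x f y = f (x, y) := rfl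

theorem slice_seminorm_bound (k : ℕ) (i : ℕ × ℕ) :
    SBound (fun (f : 𝓢(E × F, ℂ)) (x : E) =>
      ‖x‖ ^ k * schwartzSeminormFamily ℂ F ℂ i (slice x f)) := by
  refine ⟨{(k + i.1, i.2)}, 1, zero_le_one, fun f x => ?_⟩
  rw [one_mul, Finset.sup_singleton]
  have e : ‖x‖ ^ k * schwartzSeminormFamily ℂ F ℂ i (slice x f)
      = schwartzSeminormFamily ℂ F ℂ i (((‖x‖ ^ k : ℝ) : ℂ) • slice x f) := by
    rw [map_smul_eq_mul]; simp
  refine e.trans_le ?_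
  refine SchwartzMap.seminorm_le_bound ℂ i.1 i.2 _ (apply_nonneg _ _) fun y => ?_
  have hcomp : (slice x f : F → ℂ)
      = (fun z => f (z + (x, 0))) ∘ (ContinuousLinearMap.inr ℝ E F) := by
    ext y; simp
  have hsm : ContDiff ℝ ∞ (fun z => f (z + ((x, 0) : E × F))) :=
    (f.smooth ⊤).comp (contDiff_id.add contDiff_const)
  have hn : ‖iteratedFDeriv ℝ i.2 (slice x f) y‖ ≤ ‖iteratedFDeriv ℝ i.2 f (x, y)‖ := by
    rw [hcomp, ContinuousLinearMap.iteratedFDeriv_comp_right _ hsm _ (by exact_mod_cast le_top),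
      iteratedFDeriv_comp_add_right]
    refine (ContinuousMultilinearMap.norm_compContinuousLinearMap_le _ _).trans ?_
    have : ‖ContinuousLinearMap.inr ℝ E F‖ ≤ 1 := ContinuousLinearMap.norm_inr_le_one ℝ E F
    simp only [ContinuousLinearMap.inr_apply, Prod.mk_add_mk, zero_add, add_zero]
    refine mul_le_of_le_one_right (norm_nonneg _) ?_
    exact Finset.prod_le_one (fun _ _ => norm_nonneg _) fun _ _ => this
  have hx : ‖x‖ ≤ ‖((x, y) : E × F)‖ := norm_fst_le (x, y)
  have hy : ‖y‖ ≤ ‖((x, y) : E × F)‖ := norm_snd_le (x, y)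
  calc ‖y‖ ^ i.1 * ‖iteratedFDeriv ℝ i.2 (((‖x‖ ^ k : ℝ) : ℂ) • slice x f) y‖
      = ‖x‖ ^ k * ‖y‖ ^ i.1 * ‖iteratedFDeriv ℝ i.2 (slice x f) y‖ := by
        rw [show (((((‖x‖ ^ k : ℝ) : ℂ) • slice x f : 𝓢(F, ℂ))) : F → ℂ)
          = ((‖x‖ ^ k : ℝ) : ℂ) • (slice x f : F → ℂ) from rfl, iteratedFDeriv_const_smul_apply
          ((slice x f).smooth _).contDiffAt, norm_smul]
        simp; ring
    _ ≤ ‖((x, y) : E × F)‖ ^ k * ‖((x, y) : E × F)‖ ^ i.1 * ‖iteratedFDeriv ℝ i.2 f (x, y)‖ := by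
        gcongr
    _ = ‖((x, y) : E × F)‖ ^ (k + i.1) * ‖iteratedFDeriv ℝ i.2 f (x, y)‖ := by rw [pow_add]
    _ ≤ _ := f.le_seminorm ℂ (k + i.1) i.2 (x, y)

theorem slice_bound (k : ℕ) (q : Seminorm ℂ 𝓢(F, ℂ)) (hq : Continuous q) :
    SBound (fun (f : 𝓢(E × F, ℂ)) (x : E) => ‖x‖ ^ k * q (slice x f)) := by
  obtain ⟨s, C, hC, h⟩ := exists_seminorm_bound q hq
  refine ((SBound.sum s fun i _ => slice_seminorm_bound k i).const_mul hC).mono fun f x => ?_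
  calc ‖x‖ ^ k * q (slice x f)
      ≤ ‖x‖ ^ k * (C * ∑ i ∈ s, schwartzSeminormFamily ℂ F ℂ i (slice x f)) := by
        gcongr
        exact (h _).trans (mul_le_mul_of_nonneg_left (sup_le_sum s _) hC)
    _ = _ := by rw [← Finset.mul_sum]; ring

/-- The `i`-th coordinate of a vector in the standard orthonormal basis. -/
noncomputable def coordCLM (E : Type) [NormedAddCommGroup E] [InnerProductSpace ℝ E]
    [FiniteDimensional ℝ E] (i : Fin (Module.finrank ℝ E)) : E →L[ℝ] ℝ :=
  innerSL ℝ (stdOrthonormalBasis ℝ E i)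

theorem sum_coord (v : E) : ∑ i, coordCLM E i v • stdOrthonormalBasis ℝ E i = v :=
  (stdOrthonormalBasis ℝ E).sum_repr' v

theorem sum_lineDeriv (f : 𝓢(E × F, ℂ)) (v : E) :
    ∂_{((v, 0) : E × F)} f
      = ∑ i, ((coordCLM E i v : ℝ) : ℂ) • ∂_{((stdOrthonormalBasis ℝ E i, 0) : E × F)} f := by
  ext z
  have hv : ((v, 0) : E × F)
      = ∑ i, coordCLM E i v • ((stdOrthonormalBasis ℝ E i, 0) : E × F) := by
    conv_lhs => rw [← sum_coord v]
    ext <;> simp [Prod.fst_sum, Prod.snd_sum]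
  rw [SchwartzMap.lineDerivOp_apply_eq_fderiv, hv, map_sum]
  simp_rw [map_smul]
  simp [SchwartzMap.lineDerivOp_apply_eq_fderiv]

theorem hasFDerivAt_pairing (g : 𝓢'(F, ℂ)) (Φ : 𝓢(E × F, ℂ)) (x : E) :
    HasFDerivAt (fun x => g (slice x Φ))
      (∑ i, ContinuousLinearMap.smulRightL ℝ E ℂ (coordCLM E i)
        (g (slice x (LineDeriv.lineDerivOpCLM ℂ 𝓢(E × F, ℂ)
          ((stdOrthonormalBasis ℝ E i, 0) : E × F) Φ)))) x := by
  set G : 𝓢(E × F, ℂ) →L[ℂ] ℂ :=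
    ContinuousLinearMap.comp ⟨(g : 𝓢(F, ℂ) →ₗ[ℂ] ℂ), map_continuous g⟩ (slice x) with hG
  obtain ⟨C, hC, h⟩ := clm_remainder_bound G Φ
  rw [hasFDerivAt_iff_isLittleO_nhds_zero]
  have hO : (fun v : E => g (slice (x + v) Φ) - g (slice x Φ) -
      (∑ i, ContinuousLinearMap.smulRightL ℝ E ℂ (coordCLM E i)
        (g (slice x (LineDeriv.lineDerivOpCLM ℂ 𝓢(E × F, ℂ)
          ((stdOrthonormalBasis ℝ E i, 0) : E × F) Φ)))) v) =O[nhds 0] fun v => ‖v‖ ^ 2 := by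
    refine Asymptotics.IsBigO.of_bound C ?_
    filter_upwards [Metric.closedBall_mem_nhds (0 : E) one_pos] with v hv
    have hv' : ‖((v, 0) : E × F)‖ = ‖v‖ := by simp [Prod.norm_def]
    have h1 := h (v, 0) (by rw [hv']; simpa using hv)
    have e : g (slice (x + v) Φ) - g (slice x Φ) -
      (∑ i, ContinuousLinearMap.smulRightL ℝ E ℂ (coordCLM E i)
        (g (slice x (LineDeriv.lineDerivOpCLM ℂ 𝓢(E × F, ℂ)
          ((stdOrthonormalBasis ℝ E i, 0) : E × F) Φ)))) v = G (remainder Φ (v, 0)) := by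
      have e1 : G (SchwartzMap.compSubConstCLM ℝ (-((v, 0) : E × F)) Φ)
          = g (slice (x + v) Φ) := by
        change g _ = g _
        congr 1
        ext y
        simp
      rw [remainder, map_sub, map_sub, e1, sum_lineDeriv, map_sum]
      simp only [map_smul, smul_eq_mul]
      congr 1
      simp [hG]
      rfl
    rw [e]
    rw [hv'] at h1
    simpa using h1
  exact hO.trans_isLittleO (Asymptotics.isLittleO_norm_pow_id one_lt_two)

/-- Pairing a tempered distribution `g` on `F` with `Φ (x, ·)`, for a Schwartz function `Φ` on
`E × F`, gives the Schwartz function `x ↦ g (Φ (x, ·))` on `E`. -/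
noncomputable def partialPairing (g : 𝓢'(F, ℂ)) : 𝓢(E × F, ℂ) →L[ℂ] 𝓢(E, ℂ) :=
  mkOp (ι := Fin (Module.finrank ℝ E)) (fun Φ x => g (slice x Φ))
    (fun Φ Ψ x => by simp) (fun c Φ x => by simp)
    (fun i => LineDeriv.lineDerivOpCLM ℂ 𝓢(E × F, ℂ)
      ((stdOrthonormalBasis ℝ E i, 0) : E × F))
    (fun i => ContinuousLinearMap.smulRightL ℝ E ℂ (coordCLM E i))
    (fun Φ x => hasFDerivAt_pairing g Φ x)
    (fun k => by
      exact slice_bound k ((normSeminorm ℂ ℂ).comp ((g : 𝓢(F, ℂ) →L[ℂ] ℂ) : 𝓢(F, ℂ) →ₗ[ℂ] ℂ))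
        (continuous_norm.comp (map_continuous g)))

@[simp] theorem partialPairing_apply (g : 𝓢'(F, ℂ)) (Φ : 𝓢(E × F, ℂ)) (x : E) :
    partialPairing g Φ x = g (slice x Φ) := rfl

end Slice

section PartialFourier

variable {E F : Type} [NormedAddCommGroup E] [InnerProductSpace ℝ E] [FiniteDimensional ℝ E]
  [NormedAddCommGroup F] [InnerProductSpace ℝ F] [FiniteDimensional ℝ F]
  [MeasurableSpace F] [BorelSpace F]

/-- Multiplication of `Φ (x, y)` by `-2πi yⱼ`. -/
noncomputable def mulCoord (j : Fin (Module.finrank ℝ F)) : 𝓢(E × F, ℂ) →L[ℂ] 𝓢(E × F, ℂ) :=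
  SchwartzMap.smulLeftCLM ℂ (fun z : E × F => -(2 * Real.pi * Complex.I) * ((coordCLM F j z.2 : ℝ) : ℂ))

theorem mulCoord_apply (j : Fin (Module.finrank ℝ F)) (Φ : 𝓢(E × F, ℂ)) (z : E × F) :
    mulCoord j Φ z = -(2 * Real.pi * Complex.I) * ((coordCLM F j z.2 : ℝ) : ℂ) * Φ z := by
  rw [mulCoord, SchwartzMap.smulLeftCLM_apply_apply, smul_eq_mul]
  have : (fun z : E × F => -(2 * Real.pi * Complex.I) * ((coordCLM F j z.2 : ℝ) : ℂ))
      = fun z => ((-(2 * Real.pi * Complex.I)) •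
        (Complex.ofRealCLM ∘L coordCLM F j ∘L ContinuousLinearMap.snd ℝ E F)) z := by
    ext z; simp
  rw [this]
  fun_prop

theorem slice_decay (Φ : 𝓢(E × F, ℂ)) :
    ∃ C : ℝ, ∀ x y, ‖Φ (x, y)‖ ≤ C * (1 + ‖y‖) ^ (-((Module.finrank ℝ F + 1 : ℕ) : ℝ)) := by
  set N := Module.finrank ℝ F + 1
  refine ⟨2 ^ N * ((Finset.Iic (N, 0)).sup fun m => SchwartzMap.seminorm ℝ m.1 m.2) Φ,
    fun x y => ?_⟩
  have h := SchwartzMap.one_add_le_sup_seminorm_apply (𝕜 := ℝ) (m := (N, 0))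
        (k := N) (n := 0) le_rfl le_rfl Φ (x, y)
  rw [norm_iteratedFDeriv_zero] at h
  rw [Real.rpow_neg (by positivity), Real.rpow_natCast, ← div_eq_mul_inv,
    le_div_iff₀ (by positivity), mul_comm]
  refine le_trans ?_ h
  gcongr
  exact norm_snd_le (x, y)

/-- The integrand of the partial Fourier transform. -/
noncomputable def pfIntegrand (Φ : 𝓢(E × F, ℂ)) (z : E × F) (y : F) : ℂ :=
  Complex.exp (-(2 * Real.pi * Complex.I) * ((⟪z.2, y⟫_ℝ : ℝ) : ℂ)) * Φ (z.1, y)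

theorem norm_pfIntegrand (Φ : 𝓢(E × F, ℂ)) (z : E × F) (y : F) :
    ‖pfIntegrand Φ z y‖ = ‖Φ (z.1, y)‖ := by
  have : -(2 * Real.pi * Complex.I) * ((⟪z.2, y⟫_ℝ : ℝ) : ℂ)
      = ((-(2 * Real.pi * ⟪z.2, y⟫_ℝ) : ℝ) : ℂ) * Complex.I := by push_cast; ring
  rw [pfIntegrand, norm_mul, this, Complex.norm_exp_ofReal_mul_I, one_mul]

theorem continuous_pfIntegrand (Φ : 𝓢(E × F, ℂ)) (z : E × F) :
    Continuous (pfIntegrand Φ z) := by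
  unfold pfIntegrand
  have := Φ.continuous
  fun_prop

theorem integrable_pfIntegrand (Φ : 𝓢(E × F, ℂ)) (z : E × F) :
    Integrable (pfIntegrand Φ z) := by
  obtain ⟨C, hC⟩ := slice_decay Φ
  refine Integrable.mono' ((integrable_one_add_norm (μ := volume) (E := F)
    (r := ((Module.finrank ℝ F + 1 : ℕ) : ℝ)) (by push_cast; linarith)).const_mul C)
    (continuous_pfIntegrand Φ z).aestronglyMeasurable
    (Filter.Eventually.of_forall fun y => ?_)
  rw [norm_pfIntegrand]
  exact hC _ _

/-- The operators and covectors describing the derivative of the partial Fourier transform. -/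
noncomputable def pfOp : Fin (Module.finrank ℝ E) ⊕ Fin (Module.finrank ℝ F) →
    𝓢(E × F, ℂ) →L[ℂ] 𝓢(E × F, ℂ)
  | .inl i => LineDeriv.lineDerivOpCLM ℂ 𝓢(E × F, ℂ) ((stdOrthonormalBasis ℝ E i, 0) : E × F)
  | .inr j => mulCoord j

/-- See `pfOp`. -/
noncomputable def pfCovector : Fin (Module.finrank ℝ E) ⊕ Fin (Module.finrank ℝ F) →
    ℂ →L[ℝ] (E × F →L[ℝ] ℂ)
  | .inl i => ContinuousLinearMap.smulRightL ℝ (E × F) ℂ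
      (coordCLM E i ∘L ContinuousLinearMap.fst ℝ E F)
  | .inr j => ContinuousLinearMap.smulRightL ℝ (E × F) ℂ
      (coordCLM F j ∘L ContinuousLinearMap.snd ℝ E F)

theorem hasFDerivAt_pfIntegrand (Φ : 𝓢(E × F, ℂ)) (z : E × F) (y : F) :
    HasFDerivAt (fun z => pfIntegrand Φ z y)
      (∑ i, pfCovector i (pfIntegrand (pfOp i Φ) z y)) z := by
  have h1 : HasFDerivAt (fun z : E × F => -(2 * Real.pi * Complex.I) * ((⟪z.2, y⟫_ℝ : ℝ) : ℂ))
      ((-(2 * Real.pi * Complex.I)) •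
        (Complex.ofRealCLM ∘L (innerSL ℝ y) ∘L ContinuousLinearMap.snd ℝ E F)) z := by
    have := ((-(2 * Real.pi * Complex.I)) •
        (Complex.ofRealCLM ∘L (innerSL ℝ y) ∘L ContinuousLinearMap.snd ℝ E F)).hasFDerivAt (x := z)
    refine this.congr_of_eventuallyEq (Filter.Eventually.of_forall fun w => ?_)
    simp [real_inner_comm]
  have h2 : HasFDerivAt (fun z : E × F => Φ (z.1, y))
      (fderiv ℝ Φ (z.1, y) ∘L ContinuousLinearMap.inl ℝ E F ∘L ContinuousLinearMap.fst ℝ E F) z := by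
    have h3 : HasFDerivAt (fun z : E × F => ((z.1, y) : E × F))
        (ContinuousLinearMap.inl ℝ E F ∘L ContinuousLinearMap.fst ℝ E F) z := by
      have := (hasFDerivAt_fst (𝕜 := ℝ) (p := z)).prodMk (hasFDerivAt_const y z)
      exact this
    exact (Φ.hasFDerivAt (z.1, y)).comp z h3
  have h := h1.cexp.mul h2
  refine h.congr_fderiv ?_
  ext v
  · have hv : ((v, 0) : E × F)
        = ∑ i, coordCLM E i v • ((stdOrthonormalBasis ℝ E i, 0) : E × F) := by
      conv_lhs => rw [← sum_coord v]
      ext <;> simp [Prod.fst_sum, Prod.snd_sum]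
    have := congrArg (fderiv ℝ Φ (z.1, y)) hv
    rw [map_sum] at this
    simp_rw [map_smul] at this
    simp [this, pfCovector, pfOp, pfIntegrand, Finset.mul_sum,
      SchwartzMap.lineDerivOp_apply_eq_fderiv]
    exact Finset.sum_congr rfl fun i _ => by ring
  · have hv : ((⟪y, v⟫_ℝ : ℝ) : ℂ) = ∑ j, ((coordCLM F j v : ℝ) : ℂ) * ((coordCLM F j y : ℝ) : ℂ) := by
      conv_lhs => rw [← sum_coord v]
      rw [inner_sum]
      push_cast
      refine Finset.sum_congr rfl fun j _ => ?_
      rw [inner_smul_right, coordCLM, innerSL_apply_apply, innerSL_apply_apply, real_inner_comm y]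
      push_cast; rfl
    have h0 : fderiv ℝ Φ (z.1, y) (0, 0) = 0 := map_zero (fderiv ℝ Φ (z.1, y))
    simp [pfCovector, pfOp, pfIntegrand, mulCoord_apply, hv, Finset.mul_sum, h0]
    exact Finset.sum_congr rfl fun i _ => by ring

/-- Differentiation under the integral sign, for families stable under differentiation. -/
theorem hasFDerivAt_integral_family {Z ι : Type} [NormedAddCommGroup Z] [NormedSpace ℝ Z]
    [Fintype ι] (a : Z → F → ℂ) (b : ι → Z → F → ℂ) (N : ι → ℂ →L[ℝ] (Z →L[ℝ] ℂ))
    (ha : ∀ z, Continuous (a z)) (hai : ∀ z, Integrable (a z))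
    (hbi : ∀ i z, Integrable (b i z)) (β : ι → F → ℝ) (hβ : ∀ i, Integrable (β i))
    (hb : ∀ i z y, ‖b i z y‖ ≤ β i y)
    (hd : ∀ y z, HasFDerivAt (fun z => a z y) (∑ i, N i (b i z y)) z) (z : Z) :
    HasFDerivAt (fun z => ∫ y, a z y) (∑ i, N i (∫ y, b i z y)) z := by
  have hint : ∀ i, Integrable (fun y => N i (b i z y)) := fun i =>
    (N i).integrable_comp (hbi i z)
  have e : (∑ i, N i (∫ y, b i z y)) = ∫ y, ∑ i, N i (b i z y) := by
    rw [integral_finsetSum _ fun i _ => hint i]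
    refine Finset.sum_congr rfl fun i _ => ?_
    exact ((N i).integral_comp_comm (hbi i z)).symm
  rw [e]
  have hm : AEStronglyMeasurable (fun y => ∑ i, N i (b i z y)) volume :=
    Finset.aestronglyMeasurable_fun_sum _ fun i _ =>
    ((N i).continuous.comp_aestronglyMeasurable (hbi i z).aestronglyMeasurable)
  have hB : ∀ y w, ‖∑ i, N i (b i w y)‖ ≤ ∑ i, ‖N i‖ * β i y := by
    intro y w
    refine (norm_sum_le _ _).trans (Finset.sum_le_sum fun i _ => ?_)
    exact ((N i).le_opNorm _).trans (mul_le_mul_of_nonneg_left (hb i w y) (norm_nonneg (N i)))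
  have hBi : Integrable (fun y => ∑ i, ‖N i‖ * β i y) :=
    integrable_finsetSum _ fun i _ => (hβ i).const_mul _
  exact hasFDerivAt_integral_of_dominated_of_fderiv_le (s := Set.univ)
    (F := a) (F' := fun z y => ∑ i, N i (b i z y))
    (bound := fun y => ∑ i, ‖N i‖ * β i y)
    Filter.univ_mem
    (Filter.Eventually.of_forall fun z => (ha z).aestronglyMeasurable)
    (hai z)
    hm
    (Filter.Eventually.of_forall fun y w _ => hB y w)
    hBi
    (Filter.Eventually.of_forall fun y w _ => hd y w)

theorem hasFDerivAt_partialFourier (Φ : 𝓢(E × F, ℂ)) (z : E × F) :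
    HasFDerivAt (fun z => ∫ y, pfIntegrand Φ z y)
      (∑ i, pfCovector i (∫ y, pfIntegrand (pfOp i Φ) z y)) z := by
  choose C hC using fun i => slice_decay (pfOp (E := E) (F := F) i Φ)
  exact hasFDerivAt_integral_family (fun z => pfIntegrand Φ z)
    (fun i z => pfIntegrand (pfOp i Φ) z) pfCovector
    (continuous_pfIntegrand Φ) (integrable_pfIntegrand Φ)
    (fun i z => integrable_pfIntegrand _ z)
    (fun i y => C i * (1 + ‖y‖) ^ (-((Module.finrank ℝ F + 1 : ℕ) : ℝ)))
    (fun i => (integrable_one_add_norm (μ := volume) (E := F)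
      (r := ((Module.finrank ℝ F + 1 : ℕ) : ℝ)) (by push_cast; linarith)).const_mul (C i))
    (fun i z y => by rw [norm_pfIntegrand]; exact hC i _ _)
    (fun y z => hasFDerivAt_pfIntegrand Φ z y) z

theorem pf_eq_fourier (Φ : 𝓢(E × F, ℂ)) (z : E × F) :
    ∫ y, pfIntegrand Φ z y = 𝓕 (slice z.1 Φ) z.2 := by
  rw [SchwartzMap.fourier_coe, Real.fourier_eq']
  refine integral_congr_ae (Filter.Eventually.of_forall fun y => ?_)
  simp only [pfIntegrand, slice_apply, smul_eq_mul]
  congr 2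
  rw [real_inner_comm]
  push_cast; ring

theorem partialFourier_bound (k : ℕ) :
    SBound (fun (Φ : 𝓢(E × F, ℂ)) (z : E × F) => ‖z‖ ^ k * ‖∫ y, pfIntegrand Φ z y‖) := by
  have hb : ∀ m l : ℕ, SBound (fun (Φ : 𝓢(E × F, ℂ)) (x : E) =>
      ‖x‖ ^ m * schwartzSeminormFamily ℂ F ℂ (l, 0) (FourierTransform.fourierCLM ℂ 𝓢(F, ℂ) (slice x Φ))) :=
    fun m l => slice_bound m _
      (continuous_seminorm_comp (FourierTransform.fourierCLM ℂ 𝓢(F, ℂ)) (l, 0))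
  refine ((hb k 0).add (hb 0 k)).comp_right Prod.fst |>.mono fun Φ z => ?_
  simp only [pow_zero, one_mul]
  have e : ∫ y, pfIntegrand Φ z y
      = (FourierTransform.fourierCLM ℂ 𝓢(F, ℂ) (slice z.1 Φ)) z.2 := pf_eq_fourier Φ z
  rw [e]
  set ψ := FourierTransform.fourierCLM ℂ 𝓢(F, ℂ) (slice z.1 Φ) with hψ
  have e1 : ‖ψ z.2‖ ≤ schwartzSeminormFamily ℂ F ℂ (0, 0) ψ := by
    simpa using ψ.le_seminorm ℂ 0 0 z.2
  have e2 : ‖z.2‖ ^ k * ‖ψ z.2‖ ≤ schwartzSeminormFamily ℂ F ℂ (k, 0) ψ := by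
    simpa using ψ.le_seminorm ℂ k 0 z.2
  rcases max_choice ‖z.1‖ ‖z.2‖ with hm | hm
  · rw [Prod.norm_def, hm]
    have := mul_le_mul_of_nonneg_left e1 (pow_nonneg (norm_nonneg z.1) k)
    exact this.trans (le_add_of_nonneg_right (apply_nonneg _ _))
  · rw [Prod.norm_def, hm]
    exact e2.trans (le_add_of_nonneg_left (mul_nonneg (by positivity) (apply_nonneg _ _)))

/-- The partial Fourier transform `(x, ξ) ↦ ∫ Φ (x, y) e^{-2πi ξ·y} dy` on Schwartz functions. -/
noncomputable def partialFourier : 𝓢(E × F, ℂ) →L[ℂ] 𝓢(E × F, ℂ) :=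
  mkOp (fun Φ z => ∫ y, pfIntegrand Φ z y)
    (fun Φ Ψ z => by
      rw [← integral_add (integrable_pfIntegrand Φ z) (integrable_pfIntegrand Ψ z)]
      simp [pfIntegrand, mul_add])
    (fun c Φ z => by
      rw [← integral_smul]
      simp only [pfIntegrand, smul_apply, smul_eq_mul]
      congr 1; ext y; ring)
    pfOp pfCovector hasFDerivAt_partialFourier partialFourier_bound

theorem partialFourier_apply (Φ : 𝓢(E × F, ℂ)) (x : E) (ξ : F) :
    partialFourier Φ (x, ξ)
      = ∫ y, Complex.exp (-(2 * Real.pi * Complex.I) * ((⟪ξ, y⟫_ℝ : ℝ) : ℂ)) * Φ (x, y) := rfl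

end PartialFourier

section Distributions

variable {V : Type} [NormedAddCommGroup V] [InnerProductSpace ℝ V]

/-- Complex conjugation of Schwartz functions. -/
noncomputable def conjS : 𝓢(V, ℂ) →L[ℝ] 𝓢(V, ℂ) :=
  SchwartzMap.postcompCLM (𝕜 := ℝ) (Complex.conjCLE : ℂ →L[ℝ] ℂ)

@[simp] theorem conjS_apply (f : 𝓢(V, ℂ)) (x : V) : conjS f x = (starRingEnd ℂ) (f x) := rfl

/-- The conjugate of a tempered distribution, `φ ↦ conj (f (conj φ))`. -/
noncomputable def conjD (f : 𝓢'(V, ℂ)) : 𝓢'(V, ℂ) :=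
  ContinuousLinearMap.toPointwiseConvergenceCLM ℂ (RingHom.id ℂ) 𝓢(V, ℂ) ℂ
    { toFun := fun φ => (starRingEnd ℂ) (f (conjS φ))
      map_add' := fun φ ψ => by simp
      map_smul' := fun c φ => by
        have : conjS (c • φ) = (starRingEnd ℂ) c • conjS φ := by
          ext x; simp
        simp [this]
      cont := Complex.continuous_conj.comp ((map_continuous f).comp conjS.continuous) }

@[simp] theorem conjD_apply (f : 𝓢'(V, ℂ)) (φ : 𝓢(V, ℂ)) :
    conjD f φ = (starRingEnd ℂ) (f (conjS φ)) := rfl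

/-- The character `t ↦ e^{2πi ⟨ξ, t⟩}`. -/
noncomputable def character (ξ t : V) : ℂ :=
  Complex.exp (2 * Real.pi * Complex.I * ((⟪ξ, t⟫_ℝ : ℝ) : ℂ))

theorem character_temperate (ξ : V) : (character ξ).HasTemperateGrowth := by
  have h1 : Function.HasTemperateGrowth
      (fun r : ℝ => Complex.exp (2 * Real.pi * Complex.I * (r : ℂ))) := by
    have hc : ContDiff ℝ ∞ (fun r : ℝ => 2 * Real.pi * Complex.I * (r : ℂ)) :=
      contDiff_const.mul Complex.ofRealCLM.contDiff
    refine ⟨hc.cexp, fun n => ⟨0, (2 * Real.pi) ^ n, fun r => ?_⟩⟩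
    have hn : ∀ n : ℕ, iteratedDeriv n
        (fun r : ℝ => Complex.exp (2 * Real.pi * Complex.I * (r : ℂ))) = fun r : ℝ =>
          (2 * Real.pi * Complex.I) ^ n * Complex.exp (2 * Real.pi * Complex.I * (r : ℂ)) := by
      intro n
      induction n with
      | zero => simp
      | succ n ih =>
        rw [iteratedDeriv_succ, ih]
        ext r
        have h := (((Complex.ofRealCLM.hasDerivAt (x := r)).const_mul
          (2 * Real.pi * Complex.I)).cexp).const_mul ((2 * Real.pi * Complex.I) ^ n)
        refine h.deriv.trans ?_
        simp only [Complex.ofRealCLM_apply, Complex.ofReal_one]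
        ring
    have hr : 2 * (Real.pi : ℂ) * Complex.I * (r : ℂ)
        = ((2 * Real.pi * r : ℝ) : ℂ) * Complex.I := by push_cast; ring
    rw [norm_iteratedFDeriv_eq_norm_iteratedDeriv, hn, norm_mul, norm_pow, hr,
      Complex.norm_exp_ofReal_mul_I]
    simp [abs_of_pos Real.pi_pos]
  have h2 : (fun t : V => ⟪ξ, t⟫_ℝ).HasTemperateGrowth := (innerSL ℝ ξ).hasTemperateGrowth
  exact h1.comp h2

/-- The time-frequency shift `M_ξ T_x g`, i.e. `t ↦ e^{2πi ⟨ξ, t⟩} g (t - x)`. -/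
noncomputable def tfShift (x ξ : V) (g : 𝓢(V, ℂ)) : 𝓢(V, ℂ) :=
  SchwartzMap.smulLeftCLM ℂ (character ξ) (SchwartzMap.compSubConstCLM ℂ x g)

theorem tfShift_apply (x ξ : V) (g : 𝓢(V, ℂ)) (t : V) :
    tfShift x ξ g t = Complex.exp (2 * Real.pi * Complex.I * ((⟪ξ, t⟫_ℝ : ℝ) : ℂ)) * g (t - x) := by
  rw [tfShift, SchwartzMap.smulLeftCLM_apply_apply (character_temperate ξ)]
  rfl

/-- The short-time Fourier transform `V_g f (x, ξ) = ⟨f, M_ξ T_x g⟩` of a tempered distribution `f`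
with respect to a Schwartz window `g`; for functions it is
`∫ f(t) conj (g(t - x)) e^{-2πi ⟨ξ, t⟩} dt`. -/
noncomputable def windowSTFT (g : 𝓢(V, ℂ)) (f : 𝓢'(V, ℂ)) (x ξ : V) : ℂ :=
  f (conjS (tfShift x ξ g))

variable [FiniteDimensional ℝ V] [MeasurableSpace V] [BorelSpace V]

/-- The modulation space norm `‖f‖_{M^{p,q}_m} = ‖V_g f‖_{L^{p,q}_m}` (possibly `∞`): the `L^p` norm
in the time variable `x` is taken first, the `L^q` norm in the frequency variable `ξ` last. -/
noncomputable def modNorm (g : 𝓢(V, ℂ)) (p q : ℝ≥0∞) (m : V → V → ℝ) (f : 𝓢'(V, ℂ)) : ℝ≥0∞ :=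
  eLpNorm (fun ξ : V => eLpNorm (fun x : V => ‖windowSTFT g f x ξ‖ * m x ξ) p volume) q volume

/-- The Wiener amalgam norm `‖f‖_{W(𝓕L^p, L^q_w)}` (possibly `∞`): the `L^p` norm in the frequency
variable `ξ` is taken first, the weighted `L^q` norm in `x` last. -/
noncomputable def amalgamNorm (g : 𝓢(V, ℂ)) (p q : ℝ≥0∞) (w : V → ℝ) (f : 𝓢'(V, ℂ)) : ℝ≥0∞ :=
  eLpNorm (fun x : V => eLpNorm (fun ξ : V => ‖windowSTFT g f x ξ‖) p volume * ENNReal.ofReal (w x))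
    q volume

/-- Membership in the modulation space `M^{p,q}_m`. -/
def MemModulation (g : 𝓢(V, ℂ)) (p q : ℝ≥0∞) (m : V → V → ℝ) (f : 𝓢'(V, ℂ)) : Prop :=
  modNorm g p q m f < ⊤

/-- Membership in the Wiener amalgam space `W(𝓕L^p, L^q_w)`. -/
def MemAmalgam (g : 𝓢(V, ℂ)) (p q : ℝ≥0∞) (w : V → ℝ) (f : 𝓢'(V, ℂ)) : Prop :=
  amalgamNorm g p q w f < ⊤

/-- The polynomial weight `v_s(z) = (1 + |z|²)^{s/2}`. -/
noncomputable def vWeight (s : ℝ) (z : V) : ℝ := (1 + ‖z‖ ^ 2) ^ (s / 2)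

/-- The linear change of variables `(t, u) ↦ (t - u, t)`. -/
noncomputable def stftChange : (V × V) ≃L[ℝ] (V × V) :=
  LinearEquiv.toContinuousLinearEquiv
    { toFun := fun z => (z.1 - z.2, z.1)
      invFun := fun z => (z.2, z.2 - z.1)
      left_inv := fun z => by simp
      right_inv := fun z => by simp
      map_add' := fun z w => by ext <;> simp; abel
      map_smul' := fun c z => by ext <;> simp [smul_sub] }

/-- The linear change of variables `(a, b) ↦ (a - b, (a + b) / 2)`, the inverse of
`(x, t) ↦ (t + x / 2, t - x / 2)`. -/
noncomputable def ambChange : (V × V) ≃L[ℝ] (V × V) :=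
  LinearEquiv.toContinuousLinearEquiv
    { toFun := fun z => (z.1 - z.2, (1 / 2 : ℝ) • (z.1 + z.2))
      invFun := fun z => (z.2 + (1 / 2 : ℝ) • z.1, z.2 - (1 / 2 : ℝ) • z.1)
      left_inv := fun z => by ext <;> simp <;> module
      right_inv := fun z => by ext <;> simp <;> module
      map_add' := fun z w => by ext <;> simp <;> module
      map_smul' := fun c z => by ext <;> simp <;> module }

/-- The pull-back `Φ ↦ T (L Φ)` of a tempered distribution `T` by a continuous linear map `L` of
Schwartz spaces. -/
noncomputable def transposeD {X Y : Type} [NormedAddCommGroup X] [NormedSpace ℝ X]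
    [NormedAddCommGroup Y] [NormedSpace ℝ Y] (L : 𝓢(Y, ℂ) →L[ℂ] 𝓢(X, ℂ)) (T : 𝓢'(X, ℂ)) :
    𝓢'(Y, ℂ) :=
  ContinuousLinearMap.toPointwiseConvergenceCLM ℂ (RingHom.id ℂ) 𝓢(Y, ℂ) ℂ
    { toFun := fun Φ => T (L Φ)
      map_add' := fun φ ψ => by simp
      map_smul' := fun c φ => by simp
      cont := (map_continuous T).comp L.continuous }

@[simp] theorem transposeD_apply {X Y : Type} [NormedAddCommGroup X] [NormedSpace ℝ X]
    [NormedAddCommGroup Y] [NormedSpace ℝ Y] (L : 𝓢(Y, ℂ) →L[ℂ] 𝓢(X, ℂ)) (T : 𝓢'(X, ℂ))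
    (Φ : 𝓢(Y, ℂ)) : transposeD L T Φ = T (L Φ) := rfl

/-- The tempered distribution `f ⊗ conj g` on `V × V` (variables `(t, u)`),
`Ψ ↦ f_t ((conj g)_u Ψ(t, u))`. -/
noncomputable def tensorConj (f g : 𝓢'(V, ℂ)) : 𝓢'(V × V, ℂ) :=
  transposeD (partialPairing (conjD g)) f

/-- Phase space `V × V` with its Euclidean norm. -/
abbrev Phase (V : Type) : Type := WithLp 2 (V × V)

/-- The weight `v_s` on phase space, as a function of the two variables `x` and `ξ`:
`v_s(x, ξ) = (1 + |x|² + |ξ|²)^{s/2}`. -/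
noncomputable def phaseWeight (s : ℝ) (x ξ : V) : ℝ := vWeight s (WithLp.toLp 2 (x, ξ) : Phase V)

/-- The operator `Φ ↦ (z ↦ (𝓕₂ Φ) (e z))`, where `𝓕₂` is the Fourier transform in the second
variable, `(𝓕₂ Φ) (x, t) = ∫ Φ(x, ξ) e^{-2πi ⟨ξ, t⟩} dξ`. -/
noncomputable def phaseOp (e : (V × V) ≃L[ℝ] (V × V)) : 𝓢(Phase V, ℂ) →L[ℂ] 𝓢(V × V, ℂ) :=
  SchwartzMap.compCLMOfContinuousLinearEquiv ℂ e ∘L partialFourier ∘L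
    SchwartzMap.compCLMOfContinuousLinearEquiv ℂ (WithLp.prodContinuousLinearEquiv 2 ℝ V V).symm

theorem phaseOp_apply (e : (V × V) ≃L[ℝ] (V × V)) (Φ : 𝓢(Phase V, ℂ)) (z : V × V) :
    phaseOp e Φ z = ∫ ξ, Complex.exp (-(2 * Real.pi * Complex.I) * ((⟪(e z).2, ξ⟫_ℝ : ℝ) : ℂ)) *
      Φ (WithLp.toLp 2 ((e z).1, ξ)) := rfl

/-- The short-time Fourier transform `V_{f₁} f₂` of two tempered distributions, as a tempered
distribution on phase space: the transpose of the formula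
`V_{f₁} f₂ (x, ξ) = ∫ f₂(t) conj (f₁(t - x)) e^{-2πi ⟨ξ, t⟩} dt`, that is,
`⟨V_{f₁} f₂, Φ⟩ = (f₂ ⊗ conj f₁) ((t, u) ↦ ∫ Φ(t - u, ξ) e^{-2πi ⟨ξ, t⟩} dξ)`. -/
noncomputable def stft (f₁ f₂ : 𝓢'(V, ℂ)) : 𝓢'(Phase V, ℂ) :=
  transposeD (phaseOp stftChange) (tensorConj f₂ f₁)

/-- The cross-ambiguity function `A(f₁, f₂)` of two tempered distributions, as a tempered
distribution on phase space: the transpose of the formula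
`A(f₁, f₂)(x, ξ) = ∫ e^{-2πi ⟨ξ, t⟩} f₁(t + x/2) conj (f₂(t - x/2)) dt`, that is,
`⟨A(f₁, f₂), Φ⟩ = (f₁ ⊗ conj f₂) ((a, b) ↦ ∫ Φ(a - b, ξ) e^{-2πi ⟨ξ, (a + b)/2⟩} dξ)`. -/
noncomputable def ambiguity (f₁ f₂ : 𝓢'(V, ℂ)) : 𝓢'(Phase V, ℂ) :=
  transposeD (phaseOp ambChange) (tensorConj f₁ f₂)

/-- The tempered distribution given by integration against a Schwartz function. -/
noncomputable def ofSchwartz (f : 𝓢(V, ℂ)) : 𝓢'(V, ℂ) :=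
  SchwartzMap.toTemperedDistributionCLM V ℂ volume f

/-- For a Schwartz function, `windowSTFT` is given by the usual integral. -/
theorem windowSTFT_ofSchwartz (g f : 𝓢(V, ℂ)) (x ξ : V) :
    windowSTFT g (ofSchwartz f) x ξ = ∫ t, f t * (starRingEnd ℂ) (g (t - x)) *
      Complex.exp (-(2 * Real.pi * Complex.I) * ((⟪ξ, t⟫_ℝ : ℝ) : ℂ)) := by
  refine (SchwartzMap.toTemperedDistributionCLM_apply_apply volume f _).trans ?_
  congr 1
  ext t
  rw [conjS_apply, tfShift_apply, map_mul, ← Complex.exp_conj]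
  simp only [map_mul, Complex.conj_ofReal, Complex.conj_I, map_ofNat, smul_eq_mul]
  rw [show (2 : ℂ) * Real.pi * -Complex.I * ((⟪ξ, t⟫_ℝ : ℝ) : ℂ)
    = -(2 * Real.pi * Complex.I) * ((⟪ξ, t⟫_ℝ : ℝ) : ℂ) by ring]
  ring

theorem ofSchwartz_apply (f φ : 𝓢(V, ℂ)) : ofSchwartz f φ = ∫ t, φ t * f t :=
  SchwartzMap.toTemperedDistributionCLM_apply_apply volume f φ

theorem conjD_ofSchwartz_apply (f φ : 𝓢(V, ℂ)) :
    conjD (ofSchwartz f) φ = ∫ u, φ u * (starRingEnd ℂ) (f u) := by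
  rw [conjD_apply, ofSchwartz_apply, ← integral_conj]
  simp

/-- On Schwartz functions `stft` is the distribution given by the function `V_{f₁} f₂`. -/
theorem stft_ofSchwartz (f₁ f₂ : 𝓢(V, ℂ)) (Φ : 𝓢(Phase V, ℂ)) :
    stft (ofSchwartz f₁) (ofSchwartz f₂) Φ
      = ∫ z : Phase V, Φ z * windowSTFT f₁ (ofSchwartz f₂) z.fst z.snd := by
  set Φ' : 𝓢(V × V, ℂ) := SchwartzMap.compCLMOfContinuousLinearEquiv ℂ
    (WithLp.prodContinuousLinearEquiv 2 ℝ V V).symm Φ with hΦ'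
  set c : V → V → ℂ := fun ξ t =>
    Complex.exp (-(2 * Real.pi * Complex.I) * ((⟪ξ, t⟫_ℝ : ℝ) : ℂ)) with hc
  have hcn : ∀ ξ t, ‖c ξ t‖ = 1 := fun ξ t => by
    have : -(2 * Real.pi * Complex.I) * ((⟪ξ, t⟫_ℝ : ℝ) : ℂ)
      = ((-(2 * Real.pi * ⟪ξ, t⟫_ℝ) : ℝ) : ℂ) * Complex.I := by push_cast; ring
    rw [hc]; beta_reduce; rw [this, Complex.norm_exp_ofReal_mul_I]
  have h1 : stft (ofSchwartz f₁) (ofSchwartz f₂) Φ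
      = ∫ t, (∫ u, (∫ ξ, c t ξ * Φ' (t - u, ξ)) * (starRingEnd ℂ) (f₁ u)) * f₂ t := by
    change ofSchwartz f₂ (partialPairing (conjD (ofSchwartz f₁)) (phaseOp stftChange Φ)) = _
    rw [ofSchwartz_apply]
    simp only [partialPairing_apply, conjD_ofSchwartz_apply]
    rfl
  have h2 : ∀ t, ∫ u, (∫ ξ, c t ξ * Φ' (t - u, ξ)) * (starRingEnd ℂ) (f₁ u)
      = ∫ x, (∫ ξ, c t ξ * Φ' (x, ξ)) * (starRingEnd ℂ) (f₁ (t - x)) := fun t => by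
    rw [← integral_sub_left_eq_self _ volume t]
    simp
  set H : V → V × V → ℂ := fun t z =>
    c t z.2 * Φ' z * (starRingEnd ℂ) (f₁ (t - z.1)) * f₂ t with hH
  have : (volume : Measure (V × V)).IsAddHaarMeasure := by
    rw [Measure.volume_eq_prod]; infer_instance
  have hΦi : Integrable (fun z => Φ' z) (volume : Measure (V × V)) := Φ'.integrable
  have hfi : Integrable (fun t => f₂ t) (volume : Measure V) := f₂.integrable
  obtain ⟨M, hM⟩ : ∃ M, ∀ u, ‖f₁ u‖ ≤ M :=
    ⟨SchwartzMap.seminorm ℝ 0 0 f₁, fun u => by simpa using f₁.norm_le_seminorm ℝ u⟩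
  have hHi : Integrable (Function.uncurry H) ((volume : Measure V).prod volume) := by
    refine Integrable.mono' ((hfi.norm.mul_prod hΦi.norm).const_mul M) ?_
      (Filter.Eventually.of_forall fun z => ?_)
    · refine Continuous.aestronglyMeasurable ?_
      have := f₁.continuous
      have := f₂.continuous
      have := Φ'.continuous
      simp only [hH, hc, Function.uncurry_def]
      fun_prop
    · simp only [hH, Function.uncurry_def, norm_mul, hcn, one_mul, RCLike.norm_conj]
      have := hM (z.1 - z.2.1)
      calc _ = ‖f₁ (z.1 - z.2.1)‖ * (‖f₂ z.1‖ * ‖Φ' z.2‖) := by ring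
        _ ≤ _ := by gcongr
  have h3 : ∀ᵐ t, (∫ x, (∫ ξ, c t ξ * Φ' (x, ξ)) * (starRingEnd ℂ) (f₁ (t - x))) * f₂ t
      = ∫ z, H t z := by
    filter_upwards [hHi.prod_right_ae] with t ht
    have ht' : Integrable (H t) ((volume : Measure V).prod volume) := ht
    have : ∫ z, H t z = ∫ x, ∫ ξ, H t (x, ξ) := integral_prod _ ht'
    rw [this, ← integral_mul_const]
    congr 1; ext x
    rw [← integral_mul_const, ← integral_mul_const]
  have h4 : ∀ z : V × V, ∫ t, H t z = Φ' z * windowSTFT f₁ (ofSchwartz f₂) z.1 z.2 := fun z => by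
    rw [windowSTFT_ofSchwartz, ← integral_const_mul]
    congr 1; ext t
    simp only [hH, hc]
    rw [real_inner_comm]
    ring
  rw [h1]
  simp_rw [h2]
  rw [integral_congr_ae h3, integral_integral_swap hHi]
  simp_rw [h4]
  exact ((WithLp.volume_preserving_symm_measurableEquiv_toLp_prod V V).integral_comp'
    (fun z : V × V => Φ' z * windowSTFT f₁ (ofSchwartz f₂) z.1 z.2)).symm

/-- On Schwartz functions `ambiguity` is the distribution given by the function `A(f₁, f₂)`. -/
theorem ambiguity_ofSchwartz (f₁ f₂ : 𝓢(V, ℂ)) (Φ : 𝓢(Phase V, ℂ)) :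
    ambiguity (ofSchwartz f₁) (ofSchwartz f₂) Φ
      = ∫ z : Phase V, Φ z * ∫ t,
        Complex.exp (-(2 * Real.pi * Complex.I) * ((⟪z.snd, t⟫_ℝ : ℝ) : ℂ)) *
          (f₁ (t + (1 / 2 : ℝ) • z.fst) * (starRingEnd ℂ) (f₂ (t - (1 / 2 : ℝ) • z.fst))) := by
  set Φ' : 𝓢(V × V, ℂ) := SchwartzMap.compCLMOfContinuousLinearEquiv ℂ
    (WithLp.prodContinuousLinearEquiv 2 ℝ V V).symm Φ with hΦ'
  set c : V → V → ℂ := fun ξ t =>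
    Complex.exp (-(2 * Real.pi * Complex.I) * ((⟪ξ, t⟫_ℝ : ℝ) : ℂ)) with hc
  have hcn : ∀ ξ t, ‖c ξ t‖ = 1 := fun ξ t => by
    have : -(2 * Real.pi * Complex.I) * ((⟪ξ, t⟫_ℝ : ℝ) : ℂ)
      = ((-(2 * Real.pi * ⟪ξ, t⟫_ℝ) : ℝ) : ℂ) * Complex.I := by push_cast; ring
    rw [hc]; beta_reduce; rw [this, Complex.norm_exp_ofReal_mul_I]
  have h1 : ambiguity (ofSchwartz f₁) (ofSchwartz f₂) Φ
      = ∫ t, (∫ u, (∫ ξ, c ((1 / 2 : ℝ) • (t + u)) ξ * Φ' (t - u, ξ)) *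
        (starRingEnd ℂ) (f₂ u)) * f₁ t := by
    change ofSchwartz f₁ (partialPairing (conjD (ofSchwartz f₂)) (phaseOp ambChange Φ)) = _
    rw [ofSchwartz_apply]
    simp only [partialPairing_apply, conjD_ofSchwartz_apply]
    rfl
  have h2 : ∀ t, ∫ u, (∫ ξ, c ((1 / 2 : ℝ) • (t + u)) ξ * Φ' (t - u, ξ)) * (starRingEnd ℂ) (f₂ u)
      = ∫ x, (∫ ξ, c ((1 / 2 : ℝ) • (t + (t - x))) ξ * Φ' (x, ξ)) *
        (starRingEnd ℂ) (f₂ (t - x)) := fun t => by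
    rw [← integral_sub_left_eq_self _ volume t]
    simp
  set H : V → V × V → ℂ := fun t z =>
    c ((1 / 2 : ℝ) • (t + (t - z.1))) z.2 * Φ' z * (starRingEnd ℂ) (f₂ (t - z.1)) * f₁ t with hH
  have : (volume : Measure (V × V)).IsAddHaarMeasure := by
    rw [Measure.volume_eq_prod]; infer_instance
  have hΦi : Integrable (fun z => Φ' z) (volume : Measure (V × V)) := Φ'.integrable
  have hfi : Integrable (fun t => f₁ t) (volume : Measure V) := f₁.integrable
  obtain ⟨M, hM⟩ : ∃ M, ∀ u, ‖f₂ u‖ ≤ M :=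
    ⟨SchwartzMap.seminorm ℝ 0 0 f₂, fun u => by simpa using f₂.norm_le_seminorm ℝ u⟩
  have hHi : Integrable (Function.uncurry H) ((volume : Measure V).prod volume) := by
    refine Integrable.mono' ((hfi.norm.mul_prod hΦi.norm).const_mul M) ?_
      (Filter.Eventually.of_forall fun z => ?_)
    · refine Continuous.aestronglyMeasurable ?_
      have := f₁.continuous
      have := f₂.continuous
      have := Φ'.continuous
      simp only [hH, hc, Function.uncurry_def]
      fun_prop
    · simp only [hH, Function.uncurry_def, norm_mul, hcn, one_mul, RCLike.norm_conj]
      have := hM (z.1 - z.2.1)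
      calc _ = ‖f₂ (z.1 - z.2.1)‖ * (‖f₁ z.1‖ * ‖Φ' z.2‖) := by ring
        _ ≤ _ := by gcongr
  have h3 : ∀ᵐ t, (∫ x, (∫ ξ, c ((1 / 2 : ℝ) • (t + (t - x))) ξ * Φ' (x, ξ)) *
      (starRingEnd ℂ) (f₂ (t - x))) * f₁ t
      = ∫ z, H t z := by
    filter_upwards [hHi.prod_right_ae] with t ht
    have ht' : Integrable (H t) ((volume : Measure V).prod volume) := ht
    have : ∫ z, H t z = ∫ x, ∫ ξ, H t (x, ξ) := integral_prod _ ht'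
    rw [this, ← integral_mul_const]
    congr 1; ext x
    rw [← integral_mul_const, ← integral_mul_const]
  have h4 : ∀ z : V × V, ∫ t, H t z = Φ' z * ∫ t, c z.2 t * (f₁ (t + (1 / 2 : ℝ) • z.1) *
      (starRingEnd ℂ) (f₂ (t - (1 / 2 : ℝ) • z.1))) := fun z => by
    rw [← integral_add_right_eq_self _ ((1 / 2 : ℝ) • z.1), ← integral_const_mul]
    congr 1; ext t
    have e1 : (1 / 2 : ℝ) • (t + (1 / 2 : ℝ) • z.1 + (t + (1 / 2 : ℝ) • z.1 - z.1)) = t := by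
      module
    have e2 : t + (1 / 2 : ℝ) • z.1 - z.1 = t - (1 / 2 : ℝ) • z.1 := by module
    simp only [hH, hc]
    rw [e1, e2, real_inner_comm]
    ring
  rw [h1]
  simp_rw [h2]
  rw [integral_congr_ae h3, integral_integral_swap hHi]
  simp_rw [h4]
  exact ((WithLp.volume_preserving_symm_measurableEquiv_toLp_prod V V).integral_comp'
    (fun z : V × V => Φ' z * ∫ t, c z.2 t * (f₁ (t + (1 / 2 : ℝ) • z.1) *
      (starRingEnd ℂ) (f₂ (t - (1 / 2 : ℝ) • z.1))))).symm

end Distributions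

/-- The conditions on the indices: `pᵢ, qᵢ ≤ q`, `1/p₁ + 1/p₂ ≥ 1/p + 1/q` and
`1/q₁ + 1/q₂ ≥ 1/p + 1/q`, with `1/∞ = 0`. -/
def IndexCondition (p₁ q₁ p₂ q₂ p q : ℝ≥0∞) : Prop :=
  (p₁ ≤ q ∧ q₁ ≤ q ∧ p₂ ≤ q ∧ q₂ ≤ q) ∧
    p⁻¹ + q⁻¹ ≤ p₁⁻¹ + p₂⁻¹ ∧ p⁻¹ + q⁻¹ ≤ q₁⁻¹ + q₂⁻¹

end TimeFreq

/-! Both V_{f₁}f₂ and A(f₁,f₂) come from a tensor product f ⊗ conj f' by the change of variables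
(t,u) ↦ (t-u, t-τ(t-u)), with τ = 0 or τ = 1/2, and a Fourier transform in the second variable. If
the window on phase space is built in the same way from g ⊗ conj h (`crossWindow`), its
time-frequency shifts correspond, up to a phase, to tensor products of time-frequency shifts of g
and h. Hence the short-time Fourier transform of the bilinear distribution factorises: its modulus
at (z,ζ) is |V_h f'(w-z)| |V_g f(w)| with w = `phasePoint τ z ζ` (`enorm_windowSTFT_phaseD`). For
fixed z the map ζ ↦ w preserves measure, so with A = |V_h f'| and B = |V_g f| the unweighted amalgam
norm is the L^q norm in z of ‖A(·-z) B‖_p (`amalgamNorm_phaseD`). The parameter τ has disappeared,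
and the two bilinear maps differ only in the order of their arguments.

Sufficiency. Peetre's inequality distributes v_s(z) over the points w-z and w. What remains for p ≤
q is Young's inequality in mixed norms (`mixNorm_young`). Its exponent relations are equalities;
they are reached by raising p₁, q₁, p₂, q₂, which is allowed because the transforms have slowly
varying majorants, for which an L^p norm controls every L^P norm with P ≥ p. The same inclusion
lowers the inner exponent to q when q ≤ p (`exists_conv_bound`).

Necessity. Test functions are sums f_L of L time-frequency shifts of one window, so far apart that
their transforms have disjoint supports. The modulation norms of f_L are O(L^{1/pᵢ}) for shifts in
time and O(L^{1/qᵢ}) for shifts in frequency, while the pair (f_{J+M}, f_M) makes the left side at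
least a multiple of J^{1/q} M^{1/p}. Large J with M = 1, and J = M large, give the index conditions
(`exponents_of_conv_bound`).

Both halves need freedom in the choice of windows. It follows from the inversion formula for
tempered distributions (`inversion`), which rests on the fact that a distribution commutes with
integration over a parameter (`distribution_integral`). The formula bounds |V_γ f| by a convolution
of |V_g f| with a rapidly decreasing kernel (`exists_window_bound`); the same convolution supplies
the slowly varying majorants. -/

namespace TimeFreq

set_option linter.unusedSectionVars false

/-! ### Extended-nonnegative Lebesgue norms and Minkowski's inequality -/

section MixedNorms

variable {α β : Type*} [MeasurableSpace α] [MeasurableSpace β] {μ : Measure α} {ν : Measure β}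

theorem eLpNorm_ennreal {p : ℝ≥0∞} (h0 : p ≠ 0) (ht : p ≠ ⊤) (f : α → ℝ≥0∞) :
    eLpNorm f p μ = (∫⁻ x, f x ^ p.toReal ∂μ) ^ (1 / p.toReal) := by
  rw [eLpNorm_eq_lintegral_rpow_enorm_toReal h0 ht]
  simp

theorem eLpNorm_ennreal_rpow {p : ℝ≥0∞} (h0 : p ≠ 0) (ht : p ≠ ⊤) (f : α → ℝ≥0∞) :
    eLpNorm f p μ ^ p.toReal = ∫⁻ x, f x ^ p.toReal ∂μ := by
  rw [eLpNorm_ennreal h0 ht, ← ENNReal.rpow_mul, one_div,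
    inv_mul_cancel₀ (ENNReal.toReal_pos h0 ht).ne', ENNReal.rpow_one]

/-- Taking p-th powers divides exponents by p; this reduces mixed-norm Minkowski to the case where
the inner norm is an integral. -/
theorem eLpNorm_pow_toReal {p : ℝ≥0∞} (h0 : p ≠ 0) (ht : p ≠ ⊤) (h : α → ℝ≥0∞) (q : ℝ≥0∞) :
    eLpNorm h q μ ^ p.toReal = eLpNorm (fun x => h x ^ p.toReal) (q / p) μ := by
  have := eLpNorm_enorm_rpow (μ := μ) (p := q / p) h (ENNReal.toReal_pos h0 ht)
  rw [ENNReal.ofReal_toReal ht, ENNReal.div_mul_cancel h0 ht] at this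
  simpa using this.symm

theorem eLpNorm_top_ennreal (f : α → ℝ≥0∞) : eLpNorm f ⊤ μ = essSup f μ := by
  simp [eLpNorm_exponent_top, eLpNormEssSup]

theorem ae_le_eLpNorm_top (f : α → ℝ≥0∞) : ∀ᵐ x ∂μ, f x ≤ eLpNorm f ⊤ μ := by
  simpa [eLpNorm_exponent_top] using (ae_le_eLpNormEssSup (f := f) (μ := μ))

theorem eLpNorm_top_le {f : α → ℝ≥0∞} {C : ℝ≥0∞} (h : ∀ᵐ x ∂μ, f x ≤ C) :
    eLpNorm f ⊤ μ ≤ C := by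
  rw [eLpNorm_exponent_top]
  exact eLpNormEssSup_le_of_ae_enorm_bound (by simpa using h)

theorem eLpNorm_ennreal_mono {f g : α → ℝ≥0∞} (p : ℝ≥0∞) (h : ∀ x, f x ≤ g x) :
    eLpNorm f p μ ≤ eLpNorm g p μ :=
  eLpNorm_mono_enorm (by simpa using h)

theorem eLpNorm_ennreal_mono_ae {f g : α → ℝ≥0∞} (p : ℝ≥0∞) (h : ∀ᵐ x ∂μ, f x ≤ g x) :
    eLpNorm f p μ ≤ eLpNorm g p μ :=
  eLpNorm_mono_enorm_ae (by simpa using h)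

theorem eLpNorm_ennreal_const_mul {c : ℝ≥0∞} (hc : c ≠ ⊤) (f : α → ℝ≥0∞) (p : ℝ≥0∞) :
    eLpNorm (fun x => c * f x) p μ = c * eLpNorm f p μ := by
  rcases eq_or_ne p 0 with rfl | h0
  · simp
  rcases eq_or_ne p ⊤ with rfl | ht
  · rw [eLpNorm_top_ennreal, eLpNorm_top_ennreal]
    exact ENNReal.essSup_const_mul
  have hp := ENNReal.toReal_pos h0 ht
  rw [eLpNorm_ennreal h0 ht, eLpNorm_ennreal h0 ht]
  simp_rw [ENNReal.mul_rpow_of_nonneg _ _ hp.le]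
  rw [lintegral_const_mul' _ _ (ENNReal.rpow_ne_top_of_nonneg hp.le hc),
    ENNReal.mul_rpow_of_nonneg _ _ (by positivity), ← ENNReal.rpow_mul, mul_one_div_cancel hp.ne',
    ENNReal.rpow_one]

theorem eLpNorm_ennreal_mul_const {c : ℝ≥0∞} (hc : c ≠ ⊤) (f : α → ℝ≥0∞) (p : ℝ≥0∞) :
    eLpNorm (fun x => f x * c) p μ = eLpNorm f p μ * c := by
  simp_rw [mul_comm _ c]
  exact eLpNorm_ennreal_const_mul hc f p

theorem measurable_eLpNorm_left [SFinite μ] {f : α → β → ℝ≥0∞}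
    (hf : Measurable (Function.uncurry f)) (p : ℝ≥0∞) :
    Measurable (fun y => eLpNorm (fun x => f x y) p μ) := by
  rcases eq_or_ne p 0 with rfl | h0
  · simp
  rcases eq_or_ne p ⊤ with rfl | ht
  · refine measurable_of_Ioi fun c => ?_
    -- An essential supremum exceeds c exactly when the section of {f > c} is not null, and the
    -- measure of sections is measurable.
    have e : (fun y => eLpNorm (fun x => f x y) ⊤ μ) ⁻¹' Set.Ioi c
        = {y | μ ((fun x => (x, y)) ⁻¹' (Function.uncurry f ⁻¹' Set.Ioi c)) = 0}ᶜ := by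
      ext y
      simp only [Set.mem_preimage, Set.mem_Ioi, Set.mem_compl_iff, Set.mem_ofPred_eq]
      rw [← not_le, not_iff_not]
      constructor
      · intro h
        have := ae_le_eLpNorm_top (μ := μ) (fun x => f x y)
        refine measure_mono_null (fun x hx => ?_) (ae_iff.1 this)
        simp only [Set.mem_preimage, Set.mem_Ioi, Function.uncurry_apply_pair] at hx
        simpa using h.trans_lt hx
      · intro h
        refine eLpNorm_top_le (ae_iff.2 (measure_mono_null (fun x hx => ?_) h))
        simpa using hx
    rw [e]
    exact ((measurable_measure_prodMk_right (hf measurableSet_Ioi)) (measurableSet_singleton 0)).compl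
  · simp_rw [eLpNorm_ennreal h0 ht]
    exact (Measurable.lintegral_prod_left' (f := fun z => Function.uncurry f z ^ p.toReal)
      (hf.pow_const _)).pow_const _

theorem measurable_eLpNorm_right [SFinite ν] {f : α → β → ℝ≥0∞}
    (hf : Measurable (Function.uncurry f)) (p : ℝ≥0∞) :
    Measurable (fun x => eLpNorm (f x) p ν) :=
  measurable_eLpNorm_left (f := fun y x => f x y) (hf.comp measurable_swap) p

/-- Minkowski's integral inequality. -/
theorem eLpNorm_lintegral_le [SFinite μ] [SFinite ν] {f : α → β → ℝ≥0∞}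
    (hf : Measurable (Function.uncurry f)) {p : ℝ≥0∞} (hp : 1 ≤ p) :
    eLpNorm (fun x => ∫⁻ y, f x y ∂ν) p μ ≤ ∫⁻ y, eLpNorm (fun x => f x y) p μ ∂ν := by
  have h0 : p ≠ 0 := (zero_lt_one.trans_le hp).ne'
  set φ : β → ℝ≥0∞ := fun y => eLpNorm (fun x => f x y) p μ with hφ
  have hφm : Measurable φ := measurable_eLpNorm_left hf p
  have hfx : ∀ y, Measurable (fun x => f x y) := fun y => hf.comp measurable_prodMk_right
  have hfy : ∀ x, Measurable (f x) := fun x => hf.comp measurable_prodMk_left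
  rcases eq_or_ne p ⊤ with rfl | ht
  · refine eLpNorm_top_le ?_
    have h1 : ∀ᵐ y ∂ν, ∀ᵐ x ∂μ, f x y ≤ φ y :=
      Filter.Eventually.of_forall fun y => ae_le_eLpNorm_top _
    have h2 : ∀ᵐ x ∂μ, ∀ᵐ y ∂ν, f x y ≤ φ y := by
      rw [Measure.ae_ae_comm]
      · exact h1
      · exact measurableSet_le hf (hφm.comp measurable_snd)
    filter_upwards [h2] with x hx
    exact lintegral_mono_ae hx
  have hr := ENNReal.toReal_pos h0 ht
  have hr1 : 1 ≤ p.toReal := by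
    have := ENNReal.toReal_mono ht hp
    simpa using this
  set r := p.toReal with hrdef
  rcases eq_or_ne (∫⁻ y, φ y ∂ν) ⊤ with hM | hM
  · rw [hM]; exact le_top
  have hfin : ∀ᵐ y ∂ν, φ y < ⊤ := ae_lt_top hφm hM
  -- Negative powers of φ appear below, and 0 to a negative power is ∞, so the set where φ vanishes
  -- is treated apart: there f vanishes almost everywhere.
  have hzero : ∀ᵐ x ∂μ, ∀ᵐ y ∂ν, φ y = 0 → f x y = 0 := by
    rw [Measure.ae_ae_comm]
    · refine Filter.Eventually.of_forall fun y => ?_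
      by_cases hy : φ y = 0
      · have : ∫⁻ x, f x y ^ r ∂μ = 0 := by
          rw [← eLpNorm_ennreal_rpow h0 ht]
          change φ y ^ r = 0
          rw [hy, ENNReal.zero_rpow_of_pos hr]
        rw [lintegral_eq_zero_iff ((hfx y).pow_const r)] at this
        filter_upwards [this] with x hx _
        simpa [hr.not_gt, hr] using hx
      · exact Filter.Eventually.of_forall fun x h => absurd h hy
    · exact (measurableSet_eq_fun (hφm.comp measurable_snd) measurable_const).himp
        (measurableSet_eq_fun hf measurable_const)
  -- Hölder applied to f = φ^{1-1/r} (f^r φ^{1-r})^{1/r}. This weighting is chosen so that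
  -- integrating f^r φ^{1-r} in x gives back φ.
  have hG : ∀ᵐ x ∂μ, (∫⁻ y, f x y ∂ν) ^ r
      ≤ (∫⁻ y, φ y ∂ν) ^ (r - 1) * ∫⁻ y, f x y ^ r * φ y ^ (1 - r) ∂ν := by
    filter_upwards [hzero] with x hx
    have key : ∫⁻ y, f x y ∂ν
        ≤ ∫⁻ y, φ y ^ (1 - 1 / r) * (f x y ^ r * φ y ^ (1 - r)) ^ (1 / r) ∂ν := by
      refine lintegral_mono_ae ?_
      filter_upwards [hx, hfin] with y hy hy'
      rcases eq_or_ne (φ y) 0 with h | h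
      · rw [hy h]; exact zero_le
      · rw [ENNReal.mul_rpow_of_nonneg _ _ (by positivity), ← ENNReal.rpow_mul, ← ENNReal.rpow_mul,
          mul_one_div_cancel hr.ne', ENNReal.rpow_one, mul_left_comm, ← ENNReal.rpow_add _ _ h hy'.ne]
        rw [show 1 - 1 / r + (1 - r) * (1 / r) = 0 by field_simp; ring]
        simp
    have h2 := key.trans (ENNReal.lintegral_mul_norm_pow_le (μ := ν) (f := φ)
      (g := fun y => f x y ^ r * φ y ^ (1 - r)) (p := 1 - 1 / r) (q := 1 / r)
      hφm.aemeasurable (((hfy x).pow_const _).mul (hφm.pow_const _)).aemeasurable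
      (by rw [sub_nonneg, div_le_one hr]; exact hr1) (by positivity) (by ring))
    calc _ ≤ _ := ENNReal.rpow_le_rpow h2 hr.le
      _ = _ := by
        rw [ENNReal.mul_rpow_of_nonneg _ _ hr.le, ← ENNReal.rpow_mul, ← ENNReal.rpow_mul,
          one_div_mul_cancel hr.ne', ENNReal.rpow_one]
        congr 2
        field_simp
  rw [eLpNorm_ennreal h0 ht]
  have hI : ∫⁻ x, (∫⁻ y, f x y ∂ν) ^ r ∂μ ≤ (∫⁻ y, φ y ∂ν) ^ r := by
    calc ∫⁻ x, (∫⁻ y, f x y ∂ν) ^ r ∂μ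
        ≤ ∫⁻ x, (∫⁻ y, φ y ∂ν) ^ (r - 1) * ∫⁻ y, f x y ^ r * φ y ^ (1 - r) ∂ν ∂μ :=
          lintegral_mono_ae hG
      _ = (∫⁻ y, φ y ∂ν) ^ (r - 1) * ∫⁻ x, ∫⁻ y, f x y ^ r * φ y ^ (1 - r) ∂ν ∂μ :=
          lintegral_const_mul' _ _ (ENNReal.rpow_ne_top_of_nonneg (by linarith) hM)
      _ = (∫⁻ y, φ y ∂ν) ^ (r - 1) * ∫⁻ y, ∫⁻ x, f x y ^ r * φ y ^ (1 - r) ∂μ ∂ν := by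
          rw [lintegral_lintegral_swap]
          exact ((hf.pow_const _).mul ((hφm.comp measurable_snd).pow_const _)).aemeasurable
      _ ≤ (∫⁻ y, φ y ∂ν) ^ (r - 1) * ∫⁻ y, φ y ∂ν := by
          gcongr 1
          refine lintegral_mono_ae ?_
          filter_upwards [hfin] with y hy
          rw [lintegral_mul_const _ ((hfx y).pow_const _)]
          have e : ∫⁻ x, f x y ^ r ∂μ = φ y ^ r :=
            (eLpNorm_ennreal_rpow h0 ht (fun x => f x y)).symm
          rw [e]
          rcases eq_or_ne (φ y) 0 with h | h
          · rw [h, ENNReal.zero_rpow_of_pos hr]; simp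
          · rw [← ENNReal.rpow_add _ _ h hy.ne]; simp
      _ = (∫⁻ y, φ y ∂ν) ^ r := by
          nth_rw 2 [← ENNReal.rpow_one (∫⁻ y, φ y ∂ν)]
          rw [← ENNReal.rpow_add_of_nonneg _ _ (by linarith) zero_le_one]
          simp
  calc _ ≤ ((∫⁻ y, φ y ∂ν) ^ r) ^ (1 / r) := ENNReal.rpow_le_rpow hI (by positivity)
    _ = _ := by rw [← ENNReal.rpow_mul, mul_one_div_cancel hr.ne', ENNReal.rpow_one]

theorem eLpNorm_prod_ennreal [SFinite μ] [SFinite ν] {f : α × β → ℝ≥0∞} (hf : Measurable f)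
    (p : ℝ≥0∞) :
    eLpNorm f p (μ.prod ν) = eLpNorm (fun x => eLpNorm (fun y => f (x, y)) p ν) p μ := by
  rcases eq_or_ne p 0 with rfl | h0
  · simp
  rcases eq_or_ne p ⊤ with rfl | ht
  · have hm : Measurable (fun x => eLpNorm (fun y => f (x, y)) ⊤ ν) :=
      measurable_eLpNorm_right (f := fun x y => f (x, y)) hf ⊤
    refine le_antisymm (eLpNorm_top_le ?_) (eLpNorm_top_le ?_)
    · rw [Measure.ae_prod_iff_ae_ae (measurableSet_le hf measurable_const)]
      filter_upwards [ae_le_eLpNorm_top (μ := μ) (fun x => eLpNorm (fun y => f (x, y)) ⊤ ν)] with x hx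
      filter_upwards [ae_le_eLpNorm_top (μ := ν) (fun y => f (x, y))] with y hy
      exact hy.trans hx
    · filter_upwards [Measure.ae_ae_of_ae_prod (ae_le_eLpNorm_top (μ := μ.prod ν) f)] with x hx
      exact eLpNorm_top_le hx
  · have hr := ENNReal.toReal_pos h0 ht
    rw [eLpNorm_ennreal h0 ht, eLpNorm_ennreal h0 ht, lintegral_prod _ (hf.pow_const _).aemeasurable]
    congr 1
    refine lintegral_congr fun x => ?_
    rw [eLpNorm_ennreal_rpow h0 ht]

theorem eLpNorm_swap [SFinite μ] [SFinite ν] {f : α → β → ℝ≥0∞}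
    (hf : Measurable (Function.uncurry f)) (p : ℝ≥0∞) :
    eLpNorm (fun x => eLpNorm (f x) p ν) p μ
      = eLpNorm (fun y => eLpNorm (fun x => f x y) p μ) p ν := by
  have h1 := eLpNorm_prod_ennreal (μ := μ) (ν := ν) hf p
  have h2 := eLpNorm_prod_ennreal (μ := ν) (ν := μ) (hf.comp measurable_swap) p
  simp only [Function.uncurry_apply_pair, Function.comp_def, Prod.swap_prod_mk] at h1 h2
  rw [← h1, ← h2]
  exact (eLpNorm_comp_measurePreserving hf.aestronglyMeasurable
    (Measure.measurePreserving_swap (μ := ν) (ν := μ))).symm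

/-- Minkowski's inequality for mixed norms. -/
theorem eLpNorm_eLpNorm_le_swap [SFinite μ] [SFinite ν] {f : α → β → ℝ≥0∞}
    (hf : Measurable (Function.uncurry f)) {p q : ℝ≥0∞} (hp : 1 ≤ p) (hpq : p ≤ q) :
    eLpNorm (fun x => eLpNorm (f x) p ν) q μ
      ≤ eLpNorm (fun y => eLpNorm (fun x => f x y) q μ) p ν := by
  have h0 : p ≠ 0 := (zero_lt_one.trans_le hp).ne'
  rcases eq_or_ne p ⊤ with rfl | ht
  · obtain rfl : q = ⊤ := top_le_iff.1 hpq
    exact (eLpNorm_swap hf _).le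
  have hr := ENNReal.toReal_pos h0 ht
  rw [← ENNReal.rpow_le_rpow_iff hr, eLpNorm_pow_toReal h0 ht, eLpNorm_ennreal_rpow h0 ht]
  simp_rw [eLpNorm_ennreal_rpow h0 ht]
  refine (eLpNorm_lintegral_le (f := fun x y => f x y ^ p.toReal) (hf.pow_const _) ?_).trans_eq ?_
  · rw [ENNReal.le_div_iff_mul_le (Or.inl h0) (Or.inl ht), one_mul]; exact hpq
  · refine lintegral_congr fun y => ?_
    rw [eLpNorm_pow_toReal h0 ht]

end MixedNorms

/-! ### Hölder, Young and convolution inequalities in mixed norms -/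

section Young

variable {α : Type*} [MeasurableSpace α] {μ : Measure α}

theorem eLpNorm_mul_le_top_mul {a b : α → ℝ≥0∞} (hb : Measurable b) (p : ℝ≥0∞) :
    eLpNorm (fun x => a x * b x) p μ ≤ eLpNorm a ⊤ μ * eLpNorm b p μ := by
  rcases eq_or_ne p 0 with rfl | h0
  · simp
  have hae := ae_le_eLpNorm_top (μ := μ) a
  by_cases hb0 : eLpNorm b p μ = 0
  · have : b =ᵐ[μ] 0 := (eLpNorm_eq_zero_iff hb.aestronglyMeasurable h0).1 hb0
    have h2 : (fun x => a x * b x) =ᵐ[μ] 0 := by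
      filter_upwards [this] with x hx
      simp [hx]
    rw [eLpNorm_congr_ae h2]
    simp
  by_cases ha : eLpNorm a ⊤ μ = ⊤
  · rw [ha, ENNReal.top_mul hb0]; exact le_top
  refine (eLpNorm_ennreal_mono_ae p ?_).trans_eq (eLpNorm_ennreal_const_mul ha b p)
  filter_upwards [hae] with x hx
  gcongr

theorem eLpNorm_mul_le_mul_top {a b : α → ℝ≥0∞} (ha : Measurable a) (p : ℝ≥0∞) :
    eLpNorm (fun x => a x * b x) p μ ≤ eLpNorm a p μ * eLpNorm b ⊤ μ := by
  simpa only [mul_comm] using eLpNorm_mul_le_top_mul (a := b) ha p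

/-- Hölder's inequality. -/
theorem eLpNorm_mul_le {a b : α → ℝ≥0∞} (ha : Measurable a) (hb : Measurable b)
    {p P₁ P₂ : ℝ≥0∞} (hp : 1 ≤ p) (h : P₁⁻¹ + P₂⁻¹ = p⁻¹) :
    eLpNorm (fun x => a x * b x) p μ ≤ eLpNorm a P₁ μ * eLpNorm b P₂ μ := by
  rcases eq_or_ne P₁ ⊤ with rfl | h1
  · obtain rfl : P₂ = p := by simpa using h
    exact eLpNorm_mul_le_top_mul hb _
  rcases eq_or_ne P₂ ⊤ with rfl | h2
  · obtain rfl : P₁ = p := by simpa using h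
    exact eLpNorm_mul_le_mul_top ha _
  have hp0 : p ≠ 0 := (zero_lt_one.trans_le hp).ne'
  have hpt : p ≠ ⊤ := by
    rintro rfl
    simp [h1] at h
  have hpi : p⁻¹ ≠ ⊤ := ENNReal.inv_ne_top.2 hp0
  have hi1 : P₁⁻¹ ≠ ⊤ := fun h' => hpi (by rw [← h, h', top_add])
  have hi2 : P₂⁻¹ ≠ ⊤ := fun h' => hpi (by rw [← h, h', add_top])
  have h10 : P₁ ≠ 0 := ENNReal.inv_ne_top.1 hi1
  have h20 : P₂ ≠ 0 := ENNReal.inv_ne_top.1 hi2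
  have hr := congrArg ENNReal.toReal h
  rw [ENNReal.toReal_add hi1 hi2, ENNReal.toReal_inv, ENNReal.toReal_inv, ENNReal.toReal_inv] at hr
  have q1 := ENNReal.toReal_pos h10 h1
  have q2 := ENNReal.toReal_pos h20 h2
  have q0 := ENNReal.toReal_pos hp0 hpt
  rw [eLpNorm_ennreal hp0 hpt, eLpNorm_ennreal h10 h1, eLpNorm_ennreal h20 h2]
  refine ENNReal.lintegral_Lp_mul_le_Lq_mul_Lr q0 ?_ (by simpa using hr.symm) μ ha.aemeasurable
    hb.aemeasurable
  have : (P₁.toReal)⁻¹ < (p.toReal)⁻¹ := by rw [← hr]; linarith [inv_pos.2 q2]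
  exact (inv_lt_inv₀ q1 q0).1 this

/-- The mixed norm of `L^q` in the second variable of the `L^p` norms in the first variable. -/
noncomputable def mixNorm (μ : Measure α) (p q : ℝ≥0∞) (H : α → α → ℝ≥0∞) : ℝ≥0∞ :=
  eLpNorm (fun ξ => eLpNorm (fun x => H x ξ) p μ) q μ

theorem mixNorm_mono (p q : ℝ≥0∞) {H H' : α → α → ℝ≥0∞} (h : ∀ x ξ, H x ξ ≤ H' x ξ) :
    mixNorm μ p q H ≤ mixNorm μ p q H' :=
  eLpNorm_ennreal_mono q fun ξ => eLpNorm_ennreal_mono p fun x => h x ξ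

theorem mixNorm_const_mul {c : ℝ≥0∞} (hc : c ≠ ⊤) (p q : ℝ≥0∞) (H : α → α → ℝ≥0∞) :
    mixNorm μ p q (fun x ξ => c * H x ξ) = c * mixNorm μ p q H := by
  simp_rw [mixNorm, eLpNorm_ennreal_const_mul hc]

variable {G : Type*} [AddCommGroup G] [MeasurableSpace G] [MeasurableAdd₂ G] [MeasurableNeg G]
  {κ : Measure G} [SFinite κ] [κ.IsAddLeftInvariant] [κ.IsNegInvariant]

theorem eLpNorm_sub_right {a : G → ℝ≥0∞} (ha : Measurable a) (p : ℝ≥0∞) (z : G) :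
    eLpNorm (fun w => a (w - z)) p κ = eLpNorm a p κ :=
  eLpNorm_comp_measurePreserving ha.aestronglyMeasurable (measurePreserving_sub_right κ z)

/-- Young's inequality, in terms of the `L^q` norm of `z ↦ ‖a(· - z) b‖_p`. -/
theorem eLpNorm_young {a b : G → ℝ≥0∞} (ha : Measurable a) (hb : Measurable b)
    {p q P₁ P₂ : ℝ≥0∞} (hp : 1 ≤ p) (h₁p : p ≤ P₁) (h₁q : P₁ ≤ q) (h₂p : p ≤ P₂) (h₂q : P₂ ≤ q)
    (h : P₁⁻¹ + P₂⁻¹ = p⁻¹ + q⁻¹) :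
    eLpNorm (fun z => eLpNorm (fun w => a (w - z) * b w) p κ) q κ
      ≤ eLpNorm a P₁ κ * eLpNorm b P₂ κ := by
  have ham : ∀ z, Measurable (fun w => a (w - z)) := fun z => ha.comp (measurable_id.sub_const z)
  -- For q = ∞ the claim is Hölder's inequality for each z, together with translation invariance.
  rcases eq_or_ne q ⊤ with rfl | hqt
  · refine eLpNorm_top_le (Filter.Eventually.of_forall fun z => ?_)
    rw [← eLpNorm_sub_right ha P₁ z]
    exact eLpNorm_mul_le (ham z) hb hp (by simpa using h)
  have hpt : p ≠ ⊤ := ne_top_of_le_ne_top hqt (h₁p.trans h₁q)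
  have h1t : P₁ ≠ ⊤ := ne_top_of_le_ne_top hqt h₁q
  have h2t : P₂ ≠ ⊤ := ne_top_of_le_ne_top hqt h₂q
  have hp0 : p ≠ 0 := (zero_lt_one.trans_le hp).ne'
  have h10 : P₁ ≠ 0 := (zero_lt_one.trans_le (hp.trans h₁p)).ne'
  have h20 : P₂ ≠ 0 := (zero_lt_one.trans_le (hp.trans h₂p)).ne'
  have hq0 : q ≠ 0 := (zero_lt_one.trans_le (hp.trans (h₁p.trans h₁q))).ne'
  have hr := congrArg ENNReal.toReal h
  rw [ENNReal.toReal_add (ENNReal.inv_ne_top.2 h10) (ENNReal.inv_ne_top.2 h20),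
    ENNReal.toReal_add (ENNReal.inv_ne_top.2 hp0) (ENNReal.inv_ne_top.2 hq0),
    ENNReal.toReal_inv, ENNReal.toReal_inv, ENNReal.toReal_inv, ENNReal.toReal_inv] at hr
  have r1 := ENNReal.toReal_pos h10 h1t
  have r2 := ENNReal.toReal_pos h20 h2t
  have r0 := ENNReal.toReal_pos hp0 hpt
  have rq := ENNReal.toReal_pos hq0 hqt
  have e1 := ENNReal.toReal_mono hqt h₁q
  have e2 := ENNReal.toReal_mono hqt h₂q
  rw [eLpNorm_ennreal hq0 hqt, eLpNorm_ennreal h10 h1t, eLpNorm_ennreal h20 h2t]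
  simp_rw [eLpNorm_ennreal hp0 hpt]
  set s := p.toReal
  set r := q.toReal
  set s₁ := P₁.toReal
  set s₂ := P₂.toReal
  set A := ∫⁻ x, a x ^ s₁ ∂κ with hA
  set B := ∫⁻ x, b x ^ s₂ ∂κ with hB
  have n1 : 0 ≤ r / s₁ - 1 := by rw [sub_nonneg, le_div_iff₀ r1]; linarith
  have n2 : 0 ≤ r / s₂ - 1 := by rw [sub_nonneg, le_div_iff₀ r2]; linarith
  -- The three Hölder exponents; that they sum to one is the relation between P₁, P₂, p and q.
  have hsum : s * (1 / r) + (s * (1 / s₁ - 1 / r) + s * (1 / s₂ - 1 / r)) = 1 := by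
    have : s * (s₁⁻¹ + s₂⁻¹) = s * (s⁻¹ + r⁻¹) := by rw [hr]
    field_simp at this ⊢
    linarith
  have m1 : 0 ≤ s * (1 / s₁ - 1 / r) := by
    have : 1 / s₁ - 1 / r = (r / s₁ - 1) / r := by field_simp
    rw [this]; positivity
  have m2 : 0 ≤ s * (1 / s₂ - 1 / r) := by
    have : 1 / s₂ - 1 / r = (r / s₂ - 1) / r := by field_simp
    rw [this]; positivity
  have hz : ∀ z, ((∫⁻ w, (a (w - z) * b w) ^ s ∂κ) ^ (1 / s)) ^ r
      ≤ (∫⁻ w, a (w - z) ^ s₁ * b w ^ s₂ ∂κ) * (A ^ (r / s₁ - 1) * B ^ (r / s₂ - 1)) := by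
    intro z
    -- Only the first factor keeps a and b together. It survives to the z-integral, where Tonelli
    -- splits it into A * B; the other two integrate to powers of A and B that do not depend on z.
    have h1 : ∀ w, (a (w - z) * b w) ^ s = (a (w - z) ^ s₁ * b w ^ s₂) ^ (s * (1 / r)) *
        ∏ i : Fin 2, (![fun w => a (w - z) ^ s₁, fun w => b w ^ s₂] i w) ^
          (![s * (1 / s₁ - 1 / r), s * (1 / s₂ - 1 / r)] i) := by
      intro w
      rw [Fin.prod_univ_two]
      simp only [Matrix.cons_val_zero, Matrix.cons_val_one]
      rw [ENNReal.mul_rpow_of_nonneg _ _ r0.le,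
        ENNReal.mul_rpow_of_nonneg _ _ (by positivity), ← ENNReal.rpow_mul, ← ENNReal.rpow_mul,
        ← ENNReal.rpow_mul, ← ENNReal.rpow_mul, mul_mul_mul_comm,
        ← ENNReal.rpow_add_of_nonneg _ _ (by positivity) (by positivity),
        ← ENNReal.rpow_add_of_nonneg _ _ (by positivity) (by positivity)]
      congr 2 <;> field_simp <;> ring
    have h2 := ENNReal.lintegral_mul_prod_norm_pow_le (μ := κ) (Finset.univ : Finset (Fin 2))
      (g := fun w => a (w - z) ^ s₁ * b w ^ s₂)
      (f := ![fun w => a (w - z) ^ s₁, fun w => b w ^ s₂])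
      (((ham z).pow_const _).mul (hb.pow_const _)).aemeasurable
      (by
        intro i _
        fin_cases i
        · exact ((ham z).pow_const _).aemeasurable
        · exact (hb.pow_const _).aemeasurable)
      (s * (1 / r)) (p := ![s * (1 / s₁ - 1 / r), s * (1 / s₂ - 1 / r)])
      (by simpa [Fin.sum_univ_two] using hsum) (by positivity)
      (by
        intro i _
        fin_cases i
        · exact m1
        · exact m2)
    simp_rw [h1]
    rw [← ENNReal.rpow_mul]
    refine (ENNReal.rpow_le_rpow h2 (by positivity)).trans_eq ?_
    rw [Fin.prod_univ_two]
    simp only [Matrix.cons_val_zero, Matrix.cons_val_one]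
    rw [show ∫⁻ w, a (w - z) ^ s₁ ∂κ = A from
      lintegral_sub_right_eq_self (fun w => a w ^ s₁) z]
    rw [ENNReal.mul_rpow_of_nonneg _ _ (by positivity),
      ENNReal.mul_rpow_of_nonneg _ _ (by positivity), ← ENNReal.rpow_mul, ← ENNReal.rpow_mul,
      ← ENNReal.rpow_mul]
    congr 1
    · rw [show s * (1 / r) * (1 / s * r) = 1 by field_simp, ENNReal.rpow_one]
    · congr 2 <;> field_simp
  have hm : Measurable (Function.uncurry fun z w => a (w - z) ^ s₁ * b w ^ s₂) :=
    ((ha.comp (measurable_snd.sub measurable_fst)).pow_const _).mul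
      ((hb.comp measurable_snd).pow_const _)
  have hI : ∫⁻ z, ∫⁻ w, a (w - z) ^ s₁ * b w ^ s₂ ∂κ ∂κ = A * B := by
    rw [lintegral_lintegral_swap hm.aemeasurable]
    have : ∀ w, ∫⁻ z, a (w - z) ^ s₁ * b w ^ s₂ ∂κ = A * b w ^ s₂ := fun w => by
      rw [lintegral_mul_const, lintegral_sub_left_eq_self (fun w => a w ^ s₁) w]
      exact (ha.comp (measurable_id.const_sub w)).pow_const _
    simp_rw [this]
    rw [lintegral_const_mul _ (hb.pow_const _)]
  calc (∫⁻ z, ((∫⁻ w, (a (w - z) * b w) ^ s ∂κ) ^ (1 / s)) ^ r ∂κ) ^ (1 / r)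
      ≤ (∫⁻ z, (∫⁻ w, a (w - z) ^ s₁ * b w ^ s₂ ∂κ) *
          (A ^ (r / s₁ - 1) * B ^ (r / s₂ - 1)) ∂κ) ^ (1 / r) :=
        ENNReal.rpow_le_rpow (lintegral_mono hz) (by positivity)
    _ = ((A * B) * (A ^ (r / s₁ - 1) * B ^ (r / s₂ - 1))) ^ (1 / r) := by
        rw [lintegral_mul_const, hI]
        exact hm.lintegral_prod_right'
    _ = A ^ (1 / s₁) * B ^ (1 / s₂) := by
        rw [mul_mul_mul_comm]
        have hadd : ∀ (X : ℝ≥0∞) {t : ℝ}, 0 ≤ t → X * X ^ t = X ^ (1 + t) := fun X t ht => by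
          rw [ENNReal.rpow_add_of_nonneg _ _ zero_le_one ht, ENNReal.rpow_one]
        rw [hadd A n1, hadd B n2,
          ENNReal.mul_rpow_of_nonneg _ _ (by positivity), ← ENNReal.rpow_mul, ← ENNReal.rpow_mul]
        congr 2 <;> field_simp <;> ring

/-- The convolution inequality `‖u * k‖_p ≤ ‖k‖_1 ‖u‖_p`. -/
theorem eLpNorm_conv_le {u k : G → ℝ≥0∞} (hu : Measurable u) (hk : Measurable k)
    (hkt : ∀ x, k x ≠ ⊤) {p : ℝ≥0∞} (hp : 1 ≤ p) :
    eLpNorm (fun x => ∫⁻ y, u y * k (x - y) ∂κ) p κ ≤ (∫⁻ y, k y ∂κ) * eLpNorm u p κ := by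
  have e : ∀ x, ∫⁻ y, u y * k (x - y) ∂κ = ∫⁻ y, u (x - y) * k y ∂κ := fun x => by
    rw [← lintegral_sub_left_eq_self (fun y => u y * k (x - y)) x]
    simp
  simp_rw [e]
  refine (eLpNorm_lintegral_le (f := fun x y => u (x - y) * k y) ?_ hp).trans_eq ?_
  · exact (hu.comp (measurable_fst.sub measurable_snd)).mul (hk.comp measurable_snd)
  · simp_rw [eLpNorm_ennreal_mul_const (hkt _), eLpNorm_sub_right hu]
    rw [lintegral_const_mul _ hk, mul_comm]

/-- Minkowski moves the inner norm inside the η-integral; the one-variable convolution inequality is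
then used once in each variable, whence the square. -/
theorem mixNorm_conv_le {H : G → G → ℝ≥0∞} (hH : Measurable (Function.uncurry H)) {k : G → ℝ≥0∞}
    (hk : Measurable k) (hkt : ∀ x, k x ≠ ⊤) (hki : ∫⁻ y, k y ∂κ ≠ ⊤)
    {p q : ℝ≥0∞} (hp : 1 ≤ p) (hq : 1 ≤ q) :
    mixNorm κ p q (fun x ξ => ∫⁻ η, (∫⁻ y, H y η * k (x - y) ∂κ) * k (ξ - η) ∂κ)
      ≤ (∫⁻ y, k y ∂κ) ^ 2 * mixNorm κ p q H := by
  have hHy : ∀ η, Measurable (fun y => H y η) := fun η => hH.comp measurable_prodMk_right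
  have hm : Measurable (fun η => eLpNorm (fun y => H y η) p κ) := measurable_eLpNorm_left hH p
  have hT : Measurable (fun z : (G × G) × G => H z.2 z.1.2 * k (z.1.1 - z.2)) :=
    (hH.comp (measurable_snd.prodMk (measurable_snd.comp measurable_fst))).mul
      (hk.comp ((measurable_fst.comp measurable_fst).sub measurable_snd))
  have hin : ∀ ξ, eLpNorm (fun x => ∫⁻ η, (∫⁻ y, H y η * k (x - y) ∂κ) * k (ξ - η) ∂κ) p κ
      ≤ (∫⁻ y, k y ∂κ) * ∫⁻ η, eLpNorm (fun y => H y η) p κ * k (ξ - η) ∂κ := by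
    intro ξ
    refine (eLpNorm_lintegral_le
      (f := fun x η => (∫⁻ y, H y η * k (x - y) ∂κ) * k (ξ - η)) ?_ hp).trans ?_
    · exact (hT.lintegral_prod_right').mul (hk.comp (measurable_snd.const_sub ξ))
    · simp_rw [eLpNorm_ennreal_mul_const (hkt _)]
      have hm' : Measurable (fun η => eLpNorm (fun y => H y η) p κ * k (ξ - η)) :=
        hm.mul (hk.comp (measurable_id.const_sub ξ))
      rw [← lintegral_const_mul _ hm']
      refine lintegral_mono fun η => ?_
      rw [← mul_assoc]
      gcongr
      exact eLpNorm_conv_le (hHy η) hk hkt hp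
  refine (eLpNorm_ennreal_mono q hin).trans ?_
  rw [eLpNorm_ennreal_const_mul hki, sq, mul_assoc]
  gcongr
  exact eLpNorm_conv_le hm hk hkt hq

theorem eLpNorm_prod_symm_ennreal {f : G × G → ℝ≥0∞} (hf : Measurable f) (p : ℝ≥0∞) :
    eLpNorm f p (κ.prod κ) = eLpNorm (fun y => eLpNorm (fun x => f (x, y)) p κ) p κ := by
  rw [eLpNorm_prod_ennreal hf, eLpNorm_swap (f := fun x y => f (x, y)) hf]

/-- Young's inequality for mixed norms. -/
theorem mixNorm_young {A B : G × G → ℝ≥0∞} (hA : Measurable A) (hB : Measurable B)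
    {p q P₁ Q₁ P₂ Q₂ : ℝ≥0∞} (hp : 1 ≤ p)
    (h₁p : p ≤ P₁) (h₁q : P₁ ≤ q) (h₂p : p ≤ P₂) (h₂q : P₂ ≤ q) (h : P₁⁻¹ + P₂⁻¹ = p⁻¹ + q⁻¹)
    (h₁p' : p ≤ Q₁) (h₁q' : Q₁ ≤ q) (h₂p' : p ≤ Q₂) (h₂q' : Q₂ ≤ q)
    (h' : Q₁⁻¹ + Q₂⁻¹ = p⁻¹ + q⁻¹) :
    eLpNorm (fun z => eLpNorm (fun w => A (w - z) * B w) p (κ.prod κ)) q (κ.prod κ)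
      ≤ mixNorm κ P₁ Q₁ (fun x ξ => A (x, ξ)) * mixNorm κ P₂ Q₂ (fun x ξ => B (x, ξ)) := by
  have hm : Measurable (Function.uncurry fun (z w : G × G) => A (w - z) * B w) := by
    refine (hA.comp (g := A) (f := fun t : (G × G) × (G × G) =>
      (t.2.1 - t.1.1, t.2.2 - t.1.2)) ?_).mul (hB.comp measurable_snd)
    fun_prop
  have hmA : Measurable (fun η => eLpNorm (fun y => A (y, η)) P₁ κ) :=
    measurable_eLpNorm_left (f := fun y η => A (y, η)) hA P₁
  have hmB : Measurable (fun η => eLpNorm (fun y => B (y, η)) P₂ κ) :=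
    measurable_eLpNorm_left (f := fun y η => B (y, η)) hB P₂
  rw [eLpNorm_prod_symm_ennreal (measurable_eLpNorm_right hm p)]
  -- Young in the second variables is applied to the inner norms of A and B, so it remains to bound
  -- the norm in z₁ for each fixed z₂.
  refine le_trans (eLpNorm_ennreal_mono q fun z₂ => ?_)
    (eLpNorm_young (κ := κ) hmA hmB hp h₁p' h₁q' h₂p' h₂q' h')
  have e : ∀ z₁, eLpNorm (fun w : G × G => A (w - (z₁, z₂)) * B w) p (κ.prod κ)
      = eLpNorm (fun η => eLpNorm (fun y => A (y - z₁, η - z₂) * B (y, η)) p κ) p κ := fun z₁ => by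
    exact eLpNorm_prod_symm_ennreal (f := fun w => A (w - (z₁, z₂)) * B w)
      (hm.comp measurable_prodMk_left) p
  simp_rw [e]
  have hg : Measurable (fun t : G × (G × G) => A (t.1 - t.2.1, t.2.2 - z₂) * B (t.1, t.2.2)) := by
    refine (hA.comp ?_).mul (hB.comp ?_) <;> fun_prop
  -- The norms in z₁ and η come in the wrong order for Young in the first variables; as p ≤ q,
  -- Minkowski exchanges them at no cost.
  refine (eLpNorm_eLpNorm_le_swap
    (f := fun z₁ η => eLpNorm (fun y => A (y - z₁, η - z₂) * B (y, η)) p κ)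
    (measurable_eLpNorm_left (f := fun (y : G) (t : G × G) =>
      A (y - t.1, t.2 - z₂) * B (y, t.2)) hg p) hp (h₁p.trans h₁q)).trans ?_
  refine eLpNorm_ennreal_mono p fun η => ?_
  exact eLpNorm_young (κ := κ) (a := fun y => A (y, η - z₂)) (b := fun y => B (y, η))
    (hA.comp measurable_prodMk_right) (hB.comp measurable_prodMk_right) hp h₁p h₁q h₂p h₂q h

end Young

/-! ### Slowly varying functions and the convolution estimate -/

section Inclusion

variable {E : Type*} [NormedAddCommGroup E] [ProperSpace E] [MeasurableSpace E] [BorelSpace E]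

/-- The values of `a` at points of distance at most one are comparable. -/
def IsSlow (c : ℝ≥0∞) (a : E → ℝ≥0∞) : Prop := ∀ x x', ‖x - x'‖ ≤ 1 → a x ≤ c * a x'

/-- Averaging over a unit ball bounds the supremum of a slowly varying function by its L^p norm, and
a^P = a^{P-p} a^p then gives every larger exponent. The constant depends on c but not on the
function. -/
theorem exists_eLpNorm_inclusion (κ : Measure E) [κ.IsAddHaarMeasure] {c : ℝ≥0∞} (hc : c ≠ ⊤)
    {p P : ℝ≥0∞} (hp : 1 ≤ p) (hpP : p ≤ P) :
    ∃ C : ℝ≥0∞, C ≠ ⊤ ∧ ∀ a : E → ℝ≥0∞, Measurable a → IsSlow c a →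
      eLpNorm a P κ ≤ C * eLpNorm a p κ := by
  rcases eq_or_ne p ⊤ with rfl | ht
  · obtain rfl : P = ⊤ := top_le_iff.1 hpP
    exact ⟨1, by simp, fun a _ _ => by simp⟩
  have h0 : p ≠ 0 := (zero_lt_one.trans_le hp).ne'
  have hr := ENNReal.toReal_pos h0 ht
  set v := κ (Metric.closedBall 0 1) with hv
  have hv0 : v ≠ 0 := (Metric.measure_closedBall_pos κ 0 one_pos).ne'
  have hvt : v ≠ ⊤ := (isCompact_closedBall (0 : E) 1).measure_lt_top.ne
  set K := c * (v⁻¹) ^ (1 / p.toReal) with hK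
  have hKt : K ≠ ⊤ := ENNReal.mul_ne_top hc
    (ENNReal.rpow_ne_top_of_nonneg (by positivity) (ENNReal.inv_ne_top.2 hv0))
  have hsup : ∀ a : E → ℝ≥0∞, Measurable a → IsSlow c a → ∀ x, a x ≤ K * eLpNorm a p κ := by
    intro a ha hs x
    have hvx : κ (Metric.closedBall x 1) = v := by
      rw [hv, Measure.addHaar_closedBall_center]
    have h1 : a x ^ p.toReal * v ≤ c ^ p.toReal * eLpNorm a p κ ^ p.toReal := by
      calc a x ^ p.toReal * v = ∫⁻ _ in Metric.closedBall x 1, a x ^ p.toReal ∂κ := by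
            rw [setLIntegral_const, hvx]
        _ ≤ ∫⁻ y in Metric.closedBall x 1, c ^ p.toReal * a y ^ p.toReal ∂κ := by
            refine setLIntegral_mono ((ha.pow_const _).const_mul _) fun y hy => ?_
            rw [← ENNReal.mul_rpow_of_nonneg _ _ hr.le]
            refine ENNReal.rpow_le_rpow (hs x y ?_) hr.le
            rw [norm_sub_rev]; exact mem_closedBall_iff_norm.1 hy
        _ ≤ ∫⁻ y, c ^ p.toReal * a y ^ p.toReal ∂κ := setLIntegral_le_lintegral _ _
        _ = _ := by
            rw [lintegral_const_mul _ (ha.pow_const _), eLpNorm_ennreal_rpow h0 ht]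
    have h2 : a x ^ p.toReal ≤ (K * eLpNorm a p κ) ^ p.toReal := by
      rw [hK, ENNReal.mul_rpow_of_nonneg _ _ hr.le, ENNReal.mul_rpow_of_nonneg _ _ hr.le,
        ← ENNReal.rpow_mul, one_div_mul_cancel hr.ne', ENNReal.rpow_one, mul_right_comm]
      rw [← div_eq_mul_inv, ENNReal.le_div_iff_mul_le (Or.inl hv0) (Or.inl hvt)]
      exact h1
    exact (ENNReal.rpow_le_rpow_iff hr).1 h2
  rcases eq_or_ne P ⊤ with rfl | hPt
  · exact ⟨K, hKt, fun a ha hs => eLpNorm_top_le (Filter.Eventually.of_forall (hsup a ha hs))⟩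
  have hP0 : P ≠ 0 := (zero_lt_one.trans_le (hp.trans hpP)).ne'
  have hR := ENNReal.toReal_pos hP0 hPt
  have hrR := ENNReal.toReal_mono hPt hpP
  refine ⟨K ^ ((P.toReal - p.toReal) / P.toReal),
    ENNReal.rpow_ne_top_of_nonneg (div_nonneg (by linarith) hR.le) hKt, fun a ha hs => ?_⟩
  rw [← ENNReal.rpow_le_rpow_iff hR, eLpNorm_ennreal_rpow hP0 hPt]
  calc ∫⁻ x, a x ^ P.toReal ∂κ = ∫⁻ x, a x ^ (P.toReal - p.toReal) * a x ^ p.toReal ∂κ := by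
        refine lintegral_congr fun x => ?_
        rw [← ENNReal.rpow_add_of_nonneg _ _ (by linarith) hr.le, sub_add_cancel]
    _ ≤ ∫⁻ x, (K * eLpNorm a p κ) ^ (P.toReal - p.toReal) * a x ^ p.toReal ∂κ := by
        refine lintegral_mono fun x => ?_
        exact mul_le_mul_left (ENNReal.rpow_le_rpow (hsup a ha hs x) (by linarith)) _
    _ = (K * eLpNorm a p κ) ^ (P.toReal - p.toReal) * eLpNorm a p κ ^ p.toReal := by
        rw [lintegral_const_mul _ (ha.pow_const _), eLpNorm_ennreal_rpow h0 ht]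
    _ = _ := by
        rw [ENNReal.mul_rpow_of_nonneg _ _ (by linarith), mul_assoc,
          ← ENNReal.rpow_add_of_nonneg _ _ (by linarith) hr.le, sub_add_cancel,
          ENNReal.mul_rpow_of_nonneg _ _ hR.le, ← ENNReal.rpow_mul, div_mul_cancel₀ _ hR.ne']

theorem exists_mixNorm_inclusion (κ : Measure E) [κ.IsAddHaarMeasure] [SFinite κ]
    {c : ℝ≥0∞} (hc : c ≠ ⊤)
    {p P q Q : ℝ≥0∞} (hp : 1 ≤ p) (hpP : p ≤ P) (hq : 1 ≤ q) (hqQ : q ≤ Q) :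
    ∃ C : ℝ≥0∞, C ≠ ⊤ ∧ ∀ A : E × E → ℝ≥0∞, Measurable A → IsSlow c A →
      mixNorm κ P Q (fun x ξ => A (x, ξ)) ≤ C * mixNorm κ p q (fun x ξ => A (x, ξ)) := by
  obtain ⟨C₁, hC₁, h₁⟩ := exists_eLpNorm_inclusion κ hc hp hpP
  obtain ⟨C₂, hC₂, h₂⟩ := exists_eLpNorm_inclusion κ hc hq hqQ
  refine ⟨C₁ * C₂, ENNReal.mul_ne_top hC₁ hC₂, fun A hA hs => ?_⟩
  have hm := measurable_eLpNorm_left (μ := κ) (f := fun x ξ => A (x, ξ)) hA p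
  calc mixNorm κ P Q (fun x ξ => A (x, ξ))
      ≤ eLpNorm (fun ξ => C₁ * eLpNorm (fun x => A (x, ξ)) p κ) Q κ := by
        refine eLpNorm_ennreal_mono Q fun ξ => h₁ _ (hA.comp measurable_prodMk_right) ?_
        intro x x' hx
        exact hs _ _ (by simpa using hx)
    _ = C₁ * eLpNorm (fun ξ => eLpNorm (fun x => A (x, ξ)) p κ) Q κ :=
        eLpNorm_ennreal_const_mul hC₁ _ _
    _ ≤ C₁ * (C₂ * mixNorm κ p q (fun x ξ => A (x, ξ))) := by
        gcongr
        -- Slow variation in ξ passes to the inner norms, with the same constant.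
        refine h₂ _ hm fun ξ ξ' hξ => ?_
        rw [← eLpNorm_ennreal_const_mul hc]
        refine eLpNorm_ennreal_mono p fun x => ?_
        exact hs _ _ (by simpa using hξ)
    _ = _ := by rw [mul_assoc]

/-- The witnesses are 1/P₁ = min(1/p₁, 1/p) and 1/P₂ = 1/p + 1/q - 1/P₁. If the minimum is 1/p₁, the
bound on P₂ is the sum hypothesis; if it is 1/p, then 1/P₂ = 1/q and the bound is p₂ ≤ q. -/
theorem exists_young_exponents {p₁ p₂ p q : ℝ≥0∞} (hpq : p ≤ q) (hp : 1 ≤ p)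
    (h₁ : p₁ ≤ q) (h₂ : p₂ ≤ q) (h : p⁻¹ + q⁻¹ ≤ p₁⁻¹ + p₂⁻¹) :
    ∃ P₁ P₂ : ℝ≥0∞, p₁ ≤ P₁ ∧ p₂ ≤ P₂ ∧ p ≤ P₁ ∧ P₁ ≤ q ∧ p ≤ P₂ ∧ P₂ ≤ q ∧
      P₁⁻¹ + P₂⁻¹ = p⁻¹ + q⁻¹ := by
  have hpt : p⁻¹ ≠ ⊤ := ENNReal.inv_ne_top.2 (zero_lt_one.trans_le hp).ne'
  have hqp : q⁻¹ ≤ p⁻¹ := ENNReal.inv_le_inv.2 hpq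
  set U := min p₁⁻¹ p⁻¹ with hU
  have hUp : U ≤ p⁻¹ := min_le_right _ _
  have hUq : q⁻¹ ≤ U := le_min (ENNReal.inv_le_inv.2 h₁) hqp
  have hUt : U ≠ ⊤ := ne_top_of_le_ne_top hpt hUp
  have hsum : U + (p⁻¹ + q⁻¹ - U) = p⁻¹ + q⁻¹ :=
    add_tsub_cancel_of_le (hUp.trans le_self_add)
  refine ⟨U⁻¹, (p⁻¹ + q⁻¹ - U)⁻¹, ENNReal.le_inv_iff_le_inv.2 (min_le_left _ _),
    ENNReal.le_inv_iff_le_inv.2 ?_, ENNReal.le_inv_iff_le_inv.2 hUp,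
    ENNReal.inv_le_iff_inv_le.2 hUq, ENNReal.le_inv_iff_le_inv.2 ?_,
    ENNReal.inv_le_iff_inv_le.2 ?_, by rw [inv_inv, inv_inv, hsum]⟩
  · rw [tsub_le_iff_left]
    rcases min_choice p₁⁻¹ p⁻¹ with h' | h'
    · rw [hU, h']; exact h
    · rw [hU, h']; gcongr
  · rw [tsub_le_iff_left, add_comm]
    gcongr
  · rw [ENNReal.le_sub_iff_add_le_left hUt (hUp.trans le_self_add)]
    gcongr

/-- The convolution inequality behind the sufficiency of the index conditions. -/
theorem exists_conv_bound [SecondCountableTopology E] (κ : Measure E) [κ.IsAddHaarMeasure]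
    [SFinite κ] [κ.IsNegInvariant]
    {c : ℝ≥0∞} (hc : c ≠ ⊤) {p₁ q₁ p₂ q₂ p q : ℝ≥0∞} (hp₁ : 1 ≤ p₁) (hq₁ : 1 ≤ q₁) (hp₂ : 1 ≤ p₂)
    (hq₂ : 1 ≤ q₂) (hp : 1 ≤ p) (hq : 1 ≤ q) (h : IndexCondition p₁ q₁ p₂ q₂ p q) :
    ∃ C : ℝ≥0∞, C ≠ ⊤ ∧ ∀ A B : E × E → ℝ≥0∞, Measurable A → Measurable B → IsSlow c A →
      IsSlow c B →
      eLpNorm (fun z => eLpNorm (fun w => A (w - z) * B w) p (κ.prod κ)) q (κ.prod κ)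
        ≤ C * (mixNorm κ p₁ q₁ (fun x ξ => A (x, ξ)) * mixNorm κ p₂ q₂ (fun x ξ => B (x, ξ))) := by
  obtain ⟨⟨hp₁q, hq₁q, hp₂q, hq₂q⟩, hP, hQ⟩ := h
  have fin : ∀ {P₁ Q₁ P₂ Q₂ : ℝ≥0∞}, p₁ ≤ P₁ → q₁ ≤ Q₁ → p₂ ≤ P₂ → q₂ ≤ Q₂ →
      ∃ C : ℝ≥0∞, C ≠ ⊤ ∧ ∀ A B : E × E → ℝ≥0∞, Measurable A → Measurable B → IsSlow c A →
        IsSlow c B →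
        mixNorm κ P₁ Q₁ (fun x ξ => A (x, ξ)) * mixNorm κ P₂ Q₂ (fun x ξ => B (x, ξ)) ≤
        C * (mixNorm κ p₁ q₁ (fun x ξ => A (x, ξ)) * mixNorm κ p₂ q₂ (fun x ξ => B (x, ξ))) := by
    intro P₁ Q₁ P₂ Q₂ i1 i2 i3 i4
    obtain ⟨C₁, hC₁, k₁⟩ := exists_mixNorm_inclusion κ hc hp₁ i1 hq₁ i2
    obtain ⟨C₂, hC₂, k₂⟩ := exists_mixNorm_inclusion κ hc hp₂ i3 hq₂ i4
    refine ⟨C₁ * C₂, ENNReal.mul_ne_top hC₁ hC₂, fun A B hA hB sA sB => ?_⟩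
    rw [mul_mul_mul_comm]
    exact mul_le_mul' (k₁ A hA sA) (k₂ B hB sB)
  rcases le_total p q with hpq | hqp
  · obtain ⟨P₁, P₂, a1, a2, a3, a4, a5, a6, a7⟩ := exists_young_exponents hpq hp hp₁q hp₂q hP
    obtain ⟨Q₁, Q₂, b1, b2, b3, b4, b5, b6, b7⟩ := exists_young_exponents hpq hp hq₁q hq₂q hQ
    obtain ⟨C, hC, k⟩ := fin a1 b1 a2 b2
    exact ⟨C, hC, fun A B hA hB sA sB =>
      (mixNorm_young hA hB hp a3 a4 a5 a6 a7 b3 b4 b5 b6 b7).trans (k A B hA hB sA sB)⟩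
  -- For q ≤ p the product w ↦ A(w-z) B(w) is slowly varying with constant c², uniformly in z, so
  -- its L^p norm is dominated by its L^q norm. Young with all exponents equal to q finishes.
  · obtain ⟨C, hC, k⟩ := fin hp₁q hq₁q hp₂q hq₂q
    obtain ⟨D, hD, kD⟩ := exists_eLpNorm_inclusion (κ.prod κ) (ENNReal.mul_ne_top hc hc) hq hqp
    refine ⟨D * C, ENNReal.mul_ne_top hD hC, fun A B hA hB sA sB => ?_⟩
    rw [mul_assoc]
    refine le_trans ?_ (mul_le_mul_right (k A B hA hB sA sB) D)
    refine le_trans ?_ (mul_le_mul_right (mixNorm_young hA hB hq le_rfl le_rfl le_rfl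
      le_rfl rfl le_rfl le_rfl le_rfl le_rfl rfl) D)
    rw [← eLpNorm_ennreal_const_mul hD]
    refine eLpNorm_ennreal_mono q fun z => kD _ ?_ ?_
    · exact (hA.comp (measurable_id.sub_const z)).mul hB
    · intro w w' hw
      rw [mul_mul_mul_comm]
      exact mul_le_mul' (sA _ _ (by simpa using hw)) (sB _ _ hw)

end Inclusion

/-! ### Polynomially decaying kernels and smearing -/

section Decay

variable {V : Type*} [NormedAddCommGroup V]

/-- The weight `(1 + |x|)^{-N}`. -/
noncomputable def decay (N : ℝ) (x : V) : ℝ≥0∞ := ENNReal.ofReal ((1 + ‖x‖) ^ (-N))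

theorem decay_ne_top (N : ℝ) (x : V) : decay N x ≠ ⊤ := ENNReal.ofReal_ne_top

theorem decay_neg (N : ℝ) (x : V) : decay N (-x) = decay N x := by simp [decay]

theorem decay_add (N σ : ℝ) (x : V) : decay (N + σ) x = decay N x * decay σ x := by
  rw [decay, decay, decay, ← ENNReal.ofReal_mul (by positivity), ← Real.rpow_add (by positivity)]
  ring_nf

theorem isSlow_decay {N : ℝ} (hN : 0 ≤ N) :
    IsSlow (ENNReal.ofReal (2 ^ N)) (decay N : V → ℝ≥0∞) := by
  intro x x' h
  rw [decay, decay, ← ENNReal.ofReal_mul (by positivity)]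
  refine ENNReal.ofReal_le_ofReal ?_
  have h1 : 1 + ‖x'‖ ≤ 2 * (1 + ‖x‖) := by
    have := norm_sub_norm_le x' x
    rw [norm_sub_rev] at this
    linarith [norm_nonneg x]
  have h2 : (1 + ‖x'‖) ^ N ≤ (2 * (1 + ‖x‖)) ^ N := Real.rpow_le_rpow (by positivity) h1 hN
  rw [Real.mul_rpow (by norm_num) (by positivity)] at h2
  rw [Real.rpow_neg (by positivity), Real.rpow_neg (by positivity), ← div_eq_mul_inv,
    le_div_iff₀ (by positivity), inv_mul_le_iff₀ (by positivity)]
  linarith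

variable [MeasurableSpace V] [BorelSpace V]

theorem measurable_decay (N : ℝ) : Measurable (decay N : V → ℝ≥0∞) := by
  unfold decay
  refine ENNReal.measurable_ofReal.comp (Continuous.measurable ?_)
  exact (continuous_const.add continuous_norm).rpow_const fun x => Or.inl (by positivity : (0 : ℝ) < 1 + ‖x‖).ne'

theorem lintegral_decay_ne_top [NormedSpace ℝ V] [FiniteDimensional ℝ V] (κ : Measure V)
    [κ.IsAddHaarMeasure] {N : ℝ} (hN : Module.finrank ℝ V < N) : ∫⁻ x, decay N x ∂κ ≠ ⊤ :=
  (integrable_one_add_norm (μ := κ) hN).lintegral_lt_top.ne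

/-- The convolution of `H` with the product of two copies of `decay N`. -/
noncomputable def smear (κ : Measure V) (N : ℝ) (H : V → V → ℝ≥0∞) (x ξ : V) : ℝ≥0∞ :=
  ∫⁻ η, (∫⁻ y, H y η * decay N (x - y) ∂κ) * decay N (ξ - η) ∂κ

variable [SecondCountableTopology V]

theorem measurable_smear (κ : Measure V) [SFinite κ] (N : ℝ) {H : V → V → ℝ≥0∞}
    (hH : Measurable (Function.uncurry H)) :
    Measurable (fun z : V × V => smear κ N H z.1 z.2) := by
  have h1 : Measurable (fun t : (V × V) × V => H t.2 t.1.2 * decay N (t.1.1 - t.2)) :=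
    (hH.comp (measurable_snd.prodMk (measurable_snd.comp measurable_fst))).mul
      ((measurable_decay N).comp (by fun_prop))
  have h2 : Measurable (fun z : V × V => ∫⁻ y, H y z.2 * decay N (z.1 - y) ∂κ) :=
    h1.lintegral_prod_right'
  have h3 : Measurable (fun t : (V × V) × V =>
      (∫⁻ y, H y t.2 * decay N (t.1.1 - y) ∂κ) * decay N (t.1.2 - t.2)) :=
    (h2.comp (f := fun t : (V × V) × V => (t.1.1, t.2)) (by fun_prop)).mul
      ((measurable_decay N).comp (by fun_prop))
  exact h3.lintegral_prod_right'

/-- The kernel is slowly varying in each variable, and integration preserves this. A transform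
itself may vanish at isolated points and so need not be slowly varying; its smearing is, whatever H
may be. -/
theorem isSlow_smear (κ : Measure V) [SFinite κ] {N : ℝ} (hN : 0 ≤ N) {H : V → V → ℝ≥0∞} :
    IsSlow (ENNReal.ofReal (2 ^ N) * ENNReal.ofReal (2 ^ N))
      (fun z : V × V => smear κ N H z.1 z.2) := by
  intro z z' h
  have h1 : ‖z.1 - z'.1‖ ≤ 1 := (norm_fst_le (z - z')).trans h
  have h2 : ‖z.2 - z'.2‖ ≤ 1 := (norm_snd_le (z - z')).trans h
  have k : ∀ (x x' y : V), ‖x - x'‖ ≤ 1 →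
      decay N (x - y) ≤ ENNReal.ofReal (2 ^ N) * decay N (x' - y) := fun x x' y hx =>
    isSlow_decay hN _ _ (by simpa using hx)
  unfold smear
  rw [mul_assoc, ← lintegral_const_mul' _ _ ENNReal.ofReal_ne_top,
    ← lintegral_const_mul' _ _ ENNReal.ofReal_ne_top]
  refine lintegral_mono fun η => ?_
  rw [← mul_assoc, mul_mul_mul_comm]
  refine mul_le_mul' ?_ (k _ _ _ h2)
  rw [← lintegral_const_mul' _ _ ENNReal.ofReal_ne_top]
  refine lintegral_mono fun y => ?_
  rw [mul_left_comm]
  gcongr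
  exact k _ _ _ h1

theorem mixNorm_smear_le (κ : Measure V) [SFinite κ] [κ.IsAddLeftInvariant] [κ.IsNegInvariant]
    {N : ℝ} (hN : ∫⁻ x : V, decay N x ∂κ ≠ ⊤) {H : V → V → ℝ≥0∞}
    (hH : Measurable (Function.uncurry H)) {p q : ℝ≥0∞} (hp : 1 ≤ p) (hq : 1 ≤ q) :
    mixNorm κ p q (smear κ N H) ≤ (∫⁻ x : V, decay N x ∂κ) ^ 2 * mixNorm κ p q H :=
  mixNorm_conv_le hH (measurable_decay N) (decay_ne_top N) hN hp hq

/-- Moderate weights can be moved inside `smear`. -/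
theorem mul_smear_le (κ : Measure V) [SFinite κ] (N σ : ℝ) {c : ℝ≥0∞} (hc : c ≠ ⊤)
    {m : V → V → ℝ≥0∞} (hmt : ∀ x ξ, m x ξ ≠ ⊤)
    (hm : ∀ x ξ y η, m x ξ * (decay σ (x - y) * decay σ (ξ - η)) ≤ c * m y η)
    (H : V → V → ℝ≥0∞) (x ξ : V) :
    m x ξ * smear κ (N + σ) H x ξ ≤ c * smear κ N (fun y η => m y η * H y η) x ξ := by
  unfold smear
  rw [← lintegral_const_mul' _ _ (hmt x ξ), ← lintegral_const_mul' _ _ hc]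
  refine lintegral_mono fun η => ?_
  rw [decay_add, ← mul_assoc, ← mul_assoc, ← mul_assoc, mul_right_comm]
  refine mul_le_mul_left ?_ _
  rw [← lintegral_const_mul' _ _ (hmt x ξ), ← lintegral_mul_const' _ _ (decay_ne_top _ _),
    ← lintegral_const_mul' _ _ hc]
  refine lintegral_mono fun y => ?_
  rw [decay_add]
  calc m x ξ * (H y η * (decay N (x - y) * decay σ (x - y))) * decay σ (ξ - η)
      = (m x ξ * (decay σ (x - y) * decay σ (ξ - η))) * (H y η * decay N (x - y)) := by ring
    _ ≤ (c * m y η) * (H y η * decay N (x - y)) := mul_le_mul_left (hm _ _ _ _) _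
    _ = _ := by ring

end Decay

/-! ### Tensor products of Schwartz functions, and extension of functionals -/

section Tensor

variable {E F : Type} [NormedAddCommGroup E] [NormedSpace ℝ E] [NormedAddCommGroup F]
  [NormedSpace ℝ F]

theorem norm_iteratedFDeriv_comp_fst_le (f : 𝓢(E, ℂ)) (n : ℕ) (z : E × F) :
    ‖iteratedFDeriv ℝ n (fun z : E × F => f z.1) z‖ ≤ ‖iteratedFDeriv ℝ n f z.1‖ := by
  have := ContinuousLinearMap.iteratedFDeriv_comp_right (ContinuousLinearMap.fst ℝ E F)
    (f.smooth ⊤) z (i := n) (by exact_mod_cast le_top)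
  rw [show (fun z : E × F => f z.1) = f ∘ ContinuousLinearMap.fst ℝ E F from rfl, this]
  refine (ContinuousMultilinearMap.norm_compContinuousLinearMap_le _ _).trans ?_
  refine mul_le_of_le_one_right (norm_nonneg _) ?_
  exact Finset.prod_le_one (fun _ _ => norm_nonneg _) fun _ _ =>
    ContinuousLinearMap.norm_fst_le ℝ E F

theorem norm_iteratedFDeriv_comp_snd_le (g : 𝓢(F, ℂ)) (n : ℕ) (z : E × F) :
    ‖iteratedFDeriv ℝ n (fun z : E × F => g z.2) z‖ ≤ ‖iteratedFDeriv ℝ n g z.2‖ := by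
  have := ContinuousLinearMap.iteratedFDeriv_comp_right (ContinuousLinearMap.snd ℝ E F)
    (g.smooth ⊤) z (i := n) (by exact_mod_cast le_top)
  rw [show (fun z : E × F => g z.2) = g ∘ ContinuousLinearMap.snd ℝ E F from rfl, this]
  refine (ContinuousMultilinearMap.norm_compContinuousLinearMap_le _ _).trans ?_
  refine mul_le_of_le_one_right (norm_nonneg _) ?_
  exact Finset.prod_le_one (fun _ _ => norm_nonneg _) fun _ _ =>
    ContinuousLinearMap.norm_snd_le ℝ E F

/-- The tensor product `(x, y) ↦ f x * g y` of two Schwartz functions. -/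
noncomputable def tensor (f : 𝓢(E, ℂ)) (g : 𝓢(F, ℂ)) : 𝓢(E × F, ℂ) where
  toFun z := f z.1 * g z.2
  smooth' := ((f.smooth ⊤).comp contDiff_fst).mul ((g.smooth ⊤).comp contDiff_snd)
  decay' k n := by
    refine ⟨∑ i ∈ Finset.range (n + 1), (n.choose i : ℝ) *
      (SchwartzMap.seminorm ℝ k i f * SchwartzMap.seminorm ℝ 0 (n - i) g +
        SchwartzMap.seminorm ℝ 0 i f * SchwartzMap.seminorm ℝ k (n - i) g), fun z => ?_⟩
    have h1 : ContDiff ℝ ∞ (fun z : E × F => f z.1) := (f.smooth ⊤).comp contDiff_fst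
    have h2 : ContDiff ℝ ∞ (fun z : E × F => g z.2) := (g.smooth ⊤).comp contDiff_snd
    refine (mul_le_mul_of_nonneg_left (norm_iteratedFDeriv_mul_le h1 h2 z (n := n)
      (by exact_mod_cast le_top)) (by positivity)).trans ?_
    rw [Finset.mul_sum]
    refine Finset.sum_le_sum fun i _ => ?_
    have a1 : ‖iteratedFDeriv ℝ i (fun z : E × F => f z.1) z‖ ≤ _ :=
      norm_iteratedFDeriv_comp_fst_le f i z
    have a2 : ‖iteratedFDeriv ℝ (n - i) (fun z : E × F => g z.2) z‖ ≤ _ :=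
      norm_iteratedFDeriv_comp_snd_le g (n - i) z
    have hz : ‖z‖ ^ k ≤ ‖z.1‖ ^ k + ‖z.2‖ ^ k := by
      rcases max_choice ‖z.1‖ ‖z.2‖ with h | h
      · rw [Prod.norm_def, h]; exact le_add_of_nonneg_right (by positivity)
      · rw [Prod.norm_def, h]; exact le_add_of_nonneg_left (by positivity)
    have b1 := f.le_seminorm ℝ k i z.1
    have b2 := g.le_seminorm ℝ k (n - i) z.2
    have b3 := f.norm_iteratedFDeriv_le_seminorm ℝ i z.1
    have b4 := g.norm_iteratedFDeriv_le_seminorm ℝ (n - i) z.2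
    calc ‖z‖ ^ k * ((n.choose i : ℝ) * ‖iteratedFDeriv ℝ i (fun z : E × F => f z.1) z‖ *
          ‖iteratedFDeriv ℝ (n - i) (fun z : E × F => g z.2) z‖)
        ≤ (‖z.1‖ ^ k + ‖z.2‖ ^ k) * ((n.choose i : ℝ) * ‖iteratedFDeriv ℝ i f z.1‖ *
          ‖iteratedFDeriv ℝ (n - i) g z.2‖) := by gcongr
      _ = (n.choose i : ℝ) * ((‖z.1‖ ^ k * ‖iteratedFDeriv ℝ i f z.1‖) *
            ‖iteratedFDeriv ℝ (n - i) g z.2‖ + ‖iteratedFDeriv ℝ i f z.1‖ *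
            (‖z.2‖ ^ k * ‖iteratedFDeriv ℝ (n - i) g z.2‖)) := by ring
      _ ≤ _ := by gcongr

@[simp] theorem tensor_apply (f : 𝓢(E, ℂ)) (g : 𝓢(F, ℂ)) (z : E × F) :
    tensor f g z = f z.1 * g z.2 := rfl

end Tensor

/-- The bound makes G vanish on the kernel of J, so G factors through the range of J as a bounded
functional there; Hahn–Banach extends it. -/
theorem exists_clm_of_bound {X Y : Type*} [AddCommGroup X] [Module ℂ X] [NormedAddCommGroup Y]
    [NormedSpace ℂ Y] (J : X →ₗ[ℂ] Y) (G : X →ₗ[ℂ] ℂ) (M : ℝ) (h : ∀ x, ‖G x‖ ≤ M * ‖J x‖) :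
    ∃ ℓ : Y →L[ℂ] ℂ, ∀ x, ℓ (J x) = G x := by
  obtain ⟨s, hs⟩ := J.rangeRestrict.exists_rightInverse_of_surjective
    (LinearMap.range_eq_top.2 J.surjective_rangeRestrict)
  have hJs : ∀ y : LinearMap.range J, J (s y) = y := fun y => by
    have := congrArg Subtype.val (LinearMap.congr_fun hs y)
    simpa using this
  obtain ⟨ℓ, hℓ, -⟩ := exists_extension_norm_eq (LinearMap.range J)
    ((G ∘ₗ s).mkContinuous M fun y => by
      have := h (s y)
      rw [hJs] at this
      simpa using this)
  refine ⟨ℓ, fun x => ?_⟩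
  have h1 := hℓ ⟨J x, LinearMap.mem_range_self J x⟩
  rw [show ℓ (J x) = ℓ ((⟨J x, LinearMap.mem_range_self J x⟩ : LinearMap.range J) : Y) from rfl, h1]
  -- The section s returns a preimage that may differ from x; the difference lies in the kernel of
  -- J, where G vanishes.
  have h2 := h (s ⟨J x, LinearMap.mem_range_self J x⟩ - x)
  rw [map_sub J, hJs, sub_self, norm_zero, mul_zero, norm_le_zero_iff, map_sub, sub_eq_zero] at h2
  exact h2

/-! ### Tempered distributions commute with parameter integrals -/

section Fubini

variable {E F : Type} [NormedAddCommGroup E] [InnerProductSpace ℝ E] [FiniteDimensional ℝ E]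
  [NormedAddCommGroup F] [InnerProductSpace ℝ F] [FiniteDimensional ℝ F]
  [MeasurableSpace E] [BorelSpace E]

/-- `φ` is the integral of `Ψ` over the first variable. -/
def IsMarginal (Ψ : 𝓢(E × F, ℂ)) (φ : 𝓢(F, ℂ)) : Prop := ∀ y, φ y = ∫ x, Ψ (x, y)

/-- An operator commutes with the integration of Schwartz functions depending on a parameter. -/
def CommutesWithMarginals (E : Type) {F : Type} [NormedAddCommGroup E] [InnerProductSpace ℝ E]
    [FiniteDimensional ℝ E] [MeasurableSpace E] [BorelSpace E] [NormedAddCommGroup F]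
    [InnerProductSpace ℝ F] [FiniteDimensional ℝ F] (D : 𝓢(F, ℂ) →L[ℂ] 𝓢(F, ℂ)) : Prop :=
  ∀ (Ψ : 𝓢(E × F, ℂ)) (φ : 𝓢(F, ℂ)), IsMarginal Ψ φ →
    ∃ Ψ' : 𝓢(E × F, ℂ), IsMarginal Ψ' (D φ) ∧ ∀ x, slice x Ψ' = D (slice x Ψ)

theorem CommutesWithMarginals.comp {D D' : 𝓢(F, ℂ) →L[ℂ] 𝓢(F, ℂ)}
    (h : CommutesWithMarginals E D) (h' : CommutesWithMarginals E D') :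
    CommutesWithMarginals E (D ∘L D') := by
  intro Ψ φ hΨ
  obtain ⟨Ψ', h1, h2⟩ := h' Ψ φ hΨ
  obtain ⟨Ψ'', h3, h4⟩ := h Ψ' _ h1
  exact ⟨Ψ'', h3, fun x => by rw [h4, h2]; rfl⟩

theorem commutesWithMarginals_smul {u : F → ℂ} (hu : u.HasTemperateGrowth) :
    CommutesWithMarginals E (SchwartzMap.smulLeftCLM ℂ u) := by
  intro Ψ φ hΨ
  have hu' : (fun z : E × F => u z.2).HasTemperateGrowth :=
    hu.comp (ContinuousLinearMap.snd ℝ E F).hasTemperateGrowth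
  refine ⟨SchwartzMap.smulLeftCLM ℂ (fun z : E × F => u z.2) Ψ, fun y => ?_, fun x => ?_⟩
  · simp_rw [SchwartzMap.smulLeftCLM_apply_apply hu, SchwartzMap.smulLeftCLM_apply_apply hu', hΨ y]
    exact (integral_smul _ _).symm
  · ext y
    simp_rw [slice_apply, SchwartzMap.smulLeftCLM_apply_apply hu,
      SchwartzMap.smulLeftCLM_apply_apply hu', slice_apply]

/-- Integration, as a tempered distribution. -/
noncomputable def integralD (E : Type) [NormedAddCommGroup E] [InnerProductSpace ℝ E]
    [FiniteDimensional ℝ E] [MeasurableSpace E] [BorelSpace E] : 𝓢'(E, ℂ) :=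
  ContinuousLinearMap.toPointwiseConvergenceCLM ℂ (RingHom.id ℂ) 𝓢(E, ℂ) ℂ
    (SchwartzMap.integralCLM ℂ volume)

theorem integralD_apply (φ : 𝓢(E, ℂ)) : integralD E φ = ∫ x, φ x := rfl

/-- With the variables exchanged, the marginal is the pairing of the distribution `integralD` with
the slices, so differentiation under the integral is the derivative formula `hasFDerivAt_pairing`.
-/
theorem commutesWithMarginals_lineDeriv (v : F) :
    CommutesWithMarginals E (LineDeriv.lineDerivOpCLM ℂ 𝓢(F, ℂ) v) := by
  intro Ψ φ hΨ
  set σ := ContinuousLinearEquiv.prodComm ℝ F E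
  set Ψs : 𝓢(F × E, ℂ) := SchwartzMap.compCLMOfContinuousLinearEquiv ℂ σ Ψ with hΨs
  have hd : ∀ x y, (∂_{((v, 0) : F × E)} Ψs) (y, x) = (∂_{((0, v) : E × F)} Ψ) (x, y) := by
    intro x y
    rw [hΨs, SchwartzMap.lineDerivOp_compCLMOfContinuousLinearEquiv]
    rfl
  refine ⟨∂_{((0, v) : E × F)} Ψ, fun y => ?_, fun x => ?_⟩
  · have h := hasFDerivAt_pairing (integralD E) Ψs y
    have e : (φ : F → ℂ) = fun y => integralD E (slice y Ψs) := by
      ext y; rw [hΨ y, integralD_apply]; rfl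
    rw [LineDeriv.lineDerivOpCLM_apply, SchwartzMap.lineDerivOp_apply_eq_fderiv, e, h.fderiv]
    have e2 : ∫ x, (∂_{((0, v) : E × F)} Ψ) (x, y)
        = integralD E (slice y (∂_{((v, 0) : F × E)} Ψs)) := by
      rw [integralD_apply]
      simp_rw [slice_apply, hd]
    rw [e2, sum_lineDeriv, map_sum, map_sum]
    simp only [map_smul, smul_eq_mul, FunLike.coe_sum, Finset.sum_apply]
    refine Finset.sum_congr rfl fun i _ => ?_
    simp
  · ext y
    rw [slice_apply, LineDeriv.lineDerivOpCLM_apply, SchwartzMap.lineDerivOp_apply_eq_fderiv,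
      SchwartzMap.lineDerivOp_apply_eq_fderiv]
    have h3 : HasFDerivAt (fun y : F => ((x, y) : E × F)) (ContinuousLinearMap.inr ℝ E F) y :=
      hasFDerivAt_prodMk_right x y
    have h4 := (Ψ.hasFDerivAt (x, y)).comp y h3
    have h5 : ((slice x Ψ : 𝓢(F, ℂ)) : F → ℂ) = Ψ ∘ fun y => (x, y) := rfl
    rw [h5, h4.fderiv]
    simp

theorem hasTemperateGrowth_one_add_sq_pow (k : ℕ) :
    (fun y : F => (((1 + ‖y‖ ^ 2) ^ k : ℝ) : ℂ)).HasTemperateGrowth := by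
  have h : (fun y : F => (1 + ‖y‖ ^ 2) ^ k).HasTemperateGrowth := by fun_prop
  exact (Complex.ofRealCLM.hasTemperateGrowth).comp h

/-- Schwartz seminorms are dominated by sup norms of multiplications and derivatives, all of which
commute with parameter integrals. This replaces the Schwartz topology by finitely many copies of a
Banach space, in which Bochner integrals are available. -/
theorem exists_commuting_bound (n : ℕ) (k : ℕ) :
    ∃ (ι : Type) (_ : Fintype ι) (D : ι → 𝓢(F, ℂ) →L[ℂ] 𝓢(F, ℂ)) (C : ℝ), 0 ≤ C ∧
      (∀ i, CommutesWithMarginals E (D i)) ∧ ∀ (φ : 𝓢(F, ℂ)) (y : F),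
        ‖y‖ ^ k * ‖iteratedFDeriv ℝ n φ y‖
          ≤ C * ∑ i, ‖SchwartzMap.toBoundedContinuousFunctionCLM ℂ F ℂ (D i φ)‖ := by
  induction n with
  | zero =>
    have hu := hasTemperateGrowth_one_add_sq_pow (F := F) k
    refine ⟨Unit, inferInstance, fun _ => SchwartzMap.smulLeftCLM ℂ
      (fun y : F => (((1 + ‖y‖ ^ 2) ^ k : ℝ) : ℂ)), 1, zero_le_one,
      fun _ => commutesWithMarginals_smul hu, fun φ y => ?_⟩
    rw [norm_iteratedFDeriv_zero, one_mul, Fintype.sum_unique]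
    refine le_trans ?_ (BoundedContinuousFunction.norm_coe_le_norm _ y)
    rw [SchwartzMap.toBoundedContinuousFunctionCLM_apply, SchwartzMap.smulLeftCLM_apply_apply hu,
      norm_smul, Complex.norm_real, Real.norm_of_nonneg (by positivity)]
    gcongr
    nlinarith [norm_nonneg y, sq_nonneg (‖y‖ - 1)]
  | succ n ih =>
    obtain ⟨ι, _, D, C, hC, hD, hb⟩ := ih
    set N : Fin (Module.finrank ℝ F) → ℂ →L[ℝ] (F →L[ℝ] ℂ) := fun i =>
      ContinuousLinearMap.smulRightL ℝ F ℂ (coordCLM F i) with hN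
    set d : Fin (Module.finrank ℝ F) → 𝓢(F, ℂ) →L[ℂ] 𝓢(F, ℂ) := fun i =>
      LineDeriv.lineDerivOpCLM ℂ 𝓢(F, ℂ) (stdOrthonormalBasis ℝ F i) with hd
    have hf : ∀ φ : 𝓢(F, ℂ), fderiv ℝ φ = fun z => ∑ i, (N i ∘ d i φ) z := fun φ => by
      ext z v
      conv_lhs => rw [← sum_coord v]
      rw [map_sum]
      simp [hN, hd, SchwartzMap.lineDerivOp_apply_eq_fderiv]
    refine ⟨Fin (Module.finrank ℝ F) × ι, inferInstance, fun j => D j.2 ∘L d j.1,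
      (∑ i, ‖N i‖) * C, by positivity,
      fun j => (hD _).comp (commutesWithMarginals_lineDeriv _), fun φ y => ?_⟩
    have hc : ∀ i, ContDiff ℝ n (N i ∘ d i φ) := fun i =>
      (N i).contDiff.comp ((d i φ).smooth n)
    rw [← norm_iteratedFDeriv_fderiv, hf, iteratedFDeriv_sum fun i _ => hc i]
    simp only [Finset.sum_apply]
    calc _ ≤ ‖y‖ ^ k * ∑ i, ‖iteratedFDeriv ℝ n (N i ∘ d i φ) y‖ := by
          gcongr; exact norm_sum_le _ _
      _ ≤ ‖y‖ ^ k * ∑ i, ‖N i‖ * ‖iteratedFDeriv ℝ n (d i φ) y‖ := by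
          gcongr with i
          exact (N i).norm_iteratedFDeriv_comp_left ((d i φ).smooth n).contDiffAt le_rfl
      _ = ∑ i, ‖N i‖ * (‖y‖ ^ k * ‖iteratedFDeriv ℝ n (d i φ) y‖) := by
          rw [Finset.mul_sum]
          exact Finset.sum_congr rfl fun i _ => by ring
      _ ≤ ∑ i, ‖N i‖ * (C * ∑ i' : Fin (Module.finrank ℝ F), ∑ j,
            ‖SchwartzMap.toBoundedContinuousFunctionCLM ℂ F ℂ (D j (d i' φ))‖) := by
          refine Finset.sum_le_sum fun i _ => mul_le_mul_of_nonneg_left ?_ (norm_nonneg (N i))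
          refine (hb _ y).trans (mul_le_mul_of_nonneg_left ?_ hC)
          exact Finset.single_le_sum (f := fun i' => ∑ j,
            ‖SchwartzMap.toBoundedContinuousFunctionCLM ℂ F ℂ (D j (d i' φ))‖)
            (fun _ _ => Finset.sum_nonneg fun _ _ => norm_nonneg _) (Finset.mem_univ i)
      _ = _ := by
          rw [← Finset.sum_mul, mul_assoc, Fintype.sum_prod_type]
          rfl

/-- The slices form a Bochner integrable family in the sup norm: they depend on x in a Lipschitz way
and decay like an integrable power of 1 + |x|. Evaluation at points identifies the integral with φ.
-/
theorem marginal_clm_bcf (ℓ : (BoundedContinuousFunction F ℂ) →L[ℂ] ℂ) (Ψ : 𝓢(E × F, ℂ))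
    (φ : 𝓢(F, ℂ)) (h : IsMarginal Ψ φ) :
    Integrable (fun x => ℓ (SchwartzMap.toBoundedContinuousFunctionCLM ℂ F ℂ (slice x Ψ))) ∧
    ℓ (SchwartzMap.toBoundedContinuousFunctionCLM ℂ F ℂ φ)
      = ∫ x, ℓ (SchwartzMap.toBoundedContinuousFunctionCLM ℂ F ℂ (slice x Ψ)) := by
  set B := SchwartzMap.toBoundedContinuousFunctionCLM ℂ F ℂ with hB
  have hcont : Continuous (fun x => B (slice x Ψ)) := by
    set K : ℝ≥0 := ⟨SchwartzMap.seminorm ℝ 0 1 Ψ, apply_nonneg _ _⟩ with hK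
    have hlip : LipschitzWith K (Ψ : E × F → ℂ) := by
      refine lipschitzWith_of_nnnorm_fderiv_le Ψ.differentiable fun z => ?_
      have := Ψ.norm_iteratedFDeriv_le_seminorm ℝ 1 z
      rw [norm_iteratedFDeriv_one] at this
      exact this
    refine LipschitzWith.continuous (K := K) (LipschitzWith.of_dist_le_mul fun x x' => ?_)
    rw [BoundedContinuousFunction.dist_le (by positivity)]
    intro y
    refine (hlip.dist_le_mul (x, y) (x', y)).trans ?_
    simp [Prod.dist_eq]
  have hint : Integrable (fun x => B (slice x Ψ)) := by
    set M := Module.finrank ℝ E + 1 with hM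
    refine Integrable.mono' ((integrable_one_add_norm (μ := volume) (E := E)
      (r := (M : ℝ)) (by rw [hM]; push_cast; linarith)).const_mul
      (2 ^ M * ((Finset.Iic (M, 0)).sup fun m => SchwartzMap.seminorm ℝ m.1 m.2) Ψ))
      hcont.aestronglyMeasurable (Filter.Eventually.of_forall fun x => ?_)
    rw [BoundedContinuousFunction.norm_le (by positivity)]
    intro y
    have h := SchwartzMap.one_add_le_sup_seminorm_apply (𝕜 := ℝ) (m := (M, 0))
        (k := M) (n := 0) le_rfl le_rfl Ψ (x, y)
    rw [norm_iteratedFDeriv_zero] at h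
    rw [Real.rpow_neg (by positivity), Real.rpow_natCast, ← div_eq_mul_inv,
      le_div_iff₀ (by positivity), mul_comm]
    refine le_trans ?_ h
    change (1 + ‖x‖) ^ M * ‖Ψ (x, y)‖ ≤ _
    gcongr
    exact norm_fst_le (x, y)
  refine ⟨ℓ.integrable_comp hint, ?_⟩
  rw [ℓ.integral_comp_comm hint]
  congr 1
  ext y
  have := (BoundedContinuousFunction.evalCLM ℂ y : BoundedContinuousFunction F ℂ →L[ℂ] ℂ).integral_comp_comm hint
  change φ y = (BoundedContinuousFunction.evalCLM ℂ y : BoundedContinuousFunction F ℂ →L[ℂ] ℂ) (∫ x, B (slice x Ψ))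
  rw [← this, h y]
  rfl

/-- A tempered distribution commutes with the integration of Schwartz functions depending on a
parameter. -/
theorem distribution_integral (G : 𝓢'(F, ℂ)) (Ψ : 𝓢(E × F, ℂ)) (φ : 𝓢(F, ℂ))
    (h : IsMarginal Ψ φ) : G φ = ∫ x, G (slice x Ψ) := by
  obtain ⟨s, C, hC, hG⟩ := exists_seminorm_bound
    ((normSeminorm ℂ ℂ).comp ((G : 𝓢(F, ℂ) →L[ℂ] ℂ) : 𝓢(F, ℂ) →ₗ[ℂ] ℂ))
    (continuous_norm.comp (map_continuous G))
  choose ι hι D K hK hD hb using fun i : ℕ × ℕ => exists_commuting_bound (E := E) (F := F) i.2 i.1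
  -- One index for each operator attached to each seminorm bounding G, so that G is controlled by
  -- the norm of J in a finite product.
  set T := Σ i : s, ι i with hT
  set J : 𝓢(F, ℂ) →ₗ[ℂ] (T → BoundedContinuousFunction F ℂ) :=
    LinearMap.pi fun t => ((SchwartzMap.toBoundedContinuousFunctionCLM ℂ F ℂ ∘L D t.1 t.2 :
      𝓢(F, ℂ) →L[ℂ] BoundedContinuousFunction F ℂ) : 𝓢(F, ℂ) →ₗ[ℂ] _) with hJ
  obtain ⟨ℓ, hℓ⟩ := exists_clm_of_bound J ((G : 𝓢(F, ℂ) →L[ℂ] ℂ) : 𝓢(F, ℂ) →ₗ[ℂ] ℂ)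
    (C * ∑ i : s, K i * Fintype.card (ι i)) (fun φ => by
      refine (hG φ).trans ?_
      rw [mul_assoc]
      refine mul_le_mul_of_nonneg_left ((sup_le_sum s φ).trans ?_) hC
      rw [← Finset.sum_coe_sort s, Finset.sum_mul]
      refine Finset.sum_le_sum fun i _ => ?_
      refine SchwartzMap.seminorm_le_bound ℂ _ _ _ (by
        have := hK i; positivity) fun y => ?_
      refine (hb i φ y).trans ?_
      rw [mul_assoc]
      refine mul_le_mul_of_nonneg_left ?_ (hK i)
      refine (Finset.sum_le_card_nsmul _ _ ‖J φ‖ fun j _ => ?_).trans_eq (by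
        simp [Finset.card_univ])
      exact norm_le_pi_norm (J φ) ⟨i, j⟩)
  classical
  -- G is thereby a finite sum of bounded functionals on continuous functions, each composed with a
  -- commuting operator, and the integral can be exchanged term by term.
  have hdec : ∀ φ, G φ = ∑ t : T, (ℓ ∘L ContinuousLinearMap.single ℂ
      (fun _ : T => BoundedContinuousFunction F ℂ) t)
        (SchwartzMap.toBoundedContinuousFunctionCLM ℂ F ℂ (D t.1 t.2 φ)) := fun φ => by
    rw [show G φ = ℓ (J φ) from (hℓ φ).symm]
    conv_lhs => rw [← Finset.univ_sum_single (J φ)]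
    rw [map_sum]
    rfl
  choose Ψ' h1 h2 using fun t : T => hD t.1 t.2 Ψ φ h
  have hm := fun t => marginal_clm_bcf (ℓ ∘L ContinuousLinearMap.single ℂ
      (fun _ : T => BoundedContinuousFunction F ℂ) t) (Ψ' t) _ (h1 t)
  rw [hdec]
  simp_rw [hdec, ← h2]
  rw [integral_finsetSum _ fun t _ => (hm t).1]
  exact Finset.sum_congr rfl fun t _ => (hm t).2

end Fubini

/-- The character `r ↦ e^{2πi r}` of the real line. -/
noncomputable def chi (r : ℝ) : ℂ := Complex.exp (2 * Real.pi * Complex.I * (r : ℂ))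

theorem chi_add (r s : ℝ) : chi (r + s) = chi r * chi s := by
  rw [chi, chi, chi, ← Complex.exp_add]
  congr 1; push_cast; ring

@[simp] theorem norm_chi (r : ℝ) : ‖chi r‖ = 1 := by
  rw [chi, show 2 * (Real.pi : ℂ) * Complex.I * (r : ℂ) = ((2 * Real.pi * r : ℝ) : ℂ) * Complex.I by
    push_cast; ring, Complex.norm_exp_ofReal_mul_I]

theorem conj_chi (r : ℝ) : (starRingEnd ℂ) (chi r) = chi (-r) := by
  rw [chi, chi, ← Complex.exp_conj]
  simp only [map_mul, Complex.conj_ofReal, Complex.conj_I, map_ofNat]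
  congr 1; push_cast; ring

theorem chi_neg (r : ℝ) : Complex.exp (-(2 * Real.pi * Complex.I) * (r : ℂ)) = chi (-r) := by
  rw [chi]; congr 1; push_cast; ring

@[simp] theorem chi_zero : chi 0 = 1 := by simp [chi]

theorem chi_temperate : chi.HasTemperateGrowth := by
  have := character_temperate (1 : ℝ)
  have e : chi = character (1 : ℝ) := by
    ext r; simp [chi, character]
  rw [e]; exact this

theorem chi_inner_temperate {D V : Type*} [NormedAddCommGroup D] [NormedSpace ℝ D]
    [NormedAddCommGroup V] [InnerProductSpace ℝ V] {f g : D → V} (hf : f.HasTemperateGrowth)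
    (hg : g.HasTemperateGrowth) : (fun z => chi ⟪f z, g z⟫_ℝ).HasTemperateGrowth :=
  chi_temperate.comp ((innerSL ℝ).bilinear_hasTemperateGrowth hf hg)

/-! ### Inversion formula and change of window -/

section Window

variable {V : Type} [NormedAddCommGroup V] [InnerProductSpace ℝ V] [FiniteDimensional ℝ V]
  [MeasurableSpace V] [BorelSpace V]

theorem tfShift_eq_chi (x ξ : V) (g : 𝓢(V, ℂ)) (t : V) :
    tfShift x ξ g t = chi ⟪ξ, t⟫_ℝ * g (t - x) := tfShift_apply x ξ g t

theorem windowSTFT_eq_chi (g f : 𝓢(V, ℂ)) (x ξ : V) :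
    windowSTFT g (ofSchwartz f) x ξ
      = ∫ t, f t * (starRingEnd ℂ) (g (t - x)) * chi (-⟪ξ, t⟫_ℝ) := by
  rw [windowSTFT_ofSchwartz]
  simp_rw [chi_neg]

/-- The function on phase space whose inverse Fourier transform in the second variable is
`(g ⊗ conj h) ∘ e⁻¹`. -/
noncomputable def crossWindow (e : (V × V) ≃L[ℝ] (V × V)) (g h : 𝓢(V, ℂ)) : 𝓢(Phase V, ℂ) :=
  SchwartzMap.compCLMOfContinuousLinearEquiv ℂ (WithLp.prodContinuousLinearEquiv 2 ℝ V V)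
    (partialFourier (SchwartzMap.compCLMOfContinuousLinearEquiv ℂ e.symm (tensor g (conjS h))))

theorem crossWindow_apply (e : (V × V) ≃L[ℝ] (V × V)) (g h : 𝓢(V, ℂ)) (w : Phase V) :
    crossWindow e g h w = ∫ y, chi (-⟪w.snd, y⟫_ℝ) *
      (g (e.symm (w.fst, y)).1 * (starRingEnd ℂ) (h (e.symm (w.fst, y)).2)) := by
  have : crossWindow e g h w = partialFourier (SchwartzMap.compCLMOfContinuousLinearEquiv ℂ e.symm
    (tensor g (conjS h))) (w.fst, w.snd) := rfl
  rw [this, partialFourier_apply]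
  simp_rw [chi_neg]
  rfl

theorem integral_chi_partialFourier (Θ : 𝓢(V × V, ℂ)) (x m : V) :
    ∫ ξ, chi ⟪m, ξ⟫_ℝ * partialFourier Θ (x, ξ) = Θ (x, m) := by
  have h1 : ∀ ξ, partialFourier Θ (x, ξ) = 𝓕 (slice x Θ) ξ := fun ξ => pf_eq_fourier Θ (x, ξ)
  have h2 : 𝓕⁻ (𝓕 (slice x Θ)) = slice x Θ := FourierTransform.fourierInv_fourier_eq _
  have h3 := congrArg (fun φ : 𝓢(V, ℂ) => φ m) h2
  simp only [slice_apply, SchwartzMap.fourierInv_coe, Real.fourierInv_eq'] at h3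
  rw [← h3]
  refine integral_congr_ae (Filter.Eventually.of_forall fun ξ => ?_)
  simp only [smul_eq_mul, h1, chi]
  congr 2
  rw [real_inner_comm]
  push_cast; ring

/-- This is what adapts `crossWindow` to `phaseOp`: the partial Fourier transform is undone and a
pure product of g and conj h remains. -/
theorem integral_chi_crossWindow (e : (V × V) ≃L[ℝ] (V × V)) (g h : 𝓢(V, ℂ)) (x m : V) :
    ∫ ξ, chi ⟪m, ξ⟫_ℝ * crossWindow e g h (WithLp.toLp 2 (x, ξ))
      = g (e.symm (x, m)).1 * (starRingEnd ℂ) (h (e.symm (x, m)).2) :=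
  integral_chi_partialFourier _ x m

theorem crossWindow_ne_zero (e : (V × V) ≃L[ℝ] (V × V)) {g h : 𝓢(V, ℂ)} (hg : g ≠ 0)
    (hh : h ≠ 0) : crossWindow e g h ≠ 0 := by
  intro h0
  obtain ⟨t, ht⟩ : ∃ t, g t ≠ 0 := by
    by_contra! hc
    exact hg (SchwartzMap.ext hc)
  obtain ⟨u, hu⟩ : ∃ u, h u ≠ 0 := by
    by_contra! hc
    exact hh (SchwartzMap.ext hc)
  have := integral_chi_crossWindow e g h (e (t, u)).1 (e (t, u)).2
  simp [h0] at this
  tauto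

/-- The short-time Fourier transform of a Schwartz function, as a Schwartz function on phase
space. -/
noncomputable def stftS (g φ : 𝓢(V, ℂ)) : 𝓢(Phase V, ℂ) := crossWindow stftChange φ g

theorem stftChange_symm_apply (x t : V) : (stftChange : (V × V) ≃L[ℝ] (V × V)).symm (x, t)
    = (t, t - x) := rfl

theorem stftS_apply (g φ : 𝓢(V, ℂ)) (w : Phase V) :
    stftS g φ w = windowSTFT g (ofSchwartz φ) w.fst w.snd := by
  rw [stftS, crossWindow_apply, windowSTFT_eq_chi]
  refine integral_congr_ae (Filter.Eventually.of_forall fun t => ?_)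
  simp only [stftChange_symm_apply]
  ring

theorem integral_chi_stftS (g φ : 𝓢(V, ℂ)) (x t : V) :
    ∫ ξ, chi ⟪t, ξ⟫_ℝ * stftS g φ (WithLp.toLp 2 (x, ξ)) = φ t * (starRingEnd ℂ) (g (t - x)) := by
  rw [stftS, integral_chi_crossWindow, stftChange_symm_apply]

/-- The shear `(w, t) ↦ (w, t - w₁)`. -/
noncomputable def shear : (Phase V × V) ≃L[ℝ] (Phase V × V) :=
  LinearEquiv.toContinuousLinearEquiv
    { toFun := fun z => (z.1, z.2 - z.1.fst)
      invFun := fun z => (z.1, z.2 + z.1.fst)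
      left_inv := fun z => by simp
      right_inv := fun z => by simp
      map_add' := fun z w => by ext <;> simp; abel
      map_smul' := fun c z => by ext <;> simp [smul_sub] }

theorem shear_apply (w : Phase V) (t : V) : shear (w, t) = (w, t - w.fst) := rfl

theorem chi_phase_temperate :
    (fun z : Phase V × V => chi ⟪z.1.snd, z.2⟫_ℝ).HasTemperateGrowth :=
  chi_inner_temperate
    (WithLp.sndL 2 ℝ V V ∘L ContinuousLinearMap.fst ℝ (Phase V) V).hasTemperateGrowth
    (ContinuousLinearMap.snd ℝ (Phase V) V).hasTemperateGrowth

/-- The function `(w, t) ↦ conj (V_g φ(w) M_{w₂} T_{w₁} g(t))`. -/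
noncomputable def synthesis (g φ : 𝓢(V, ℂ)) : 𝓢(Phase V × V, ℂ) :=
  -- `conjS` is stated for inner product spaces, so the product is given its Euclidean norm for the
  -- conjugation and then returned to the sup norm.
  conjS (V := WithLp 2 (Phase V × V)) (SchwartzMap.compCLMOfContinuousLinearEquiv ℂ
    (WithLp.prodContinuousLinearEquiv 2 ℝ (Phase V) V)
    (SchwartzMap.smulLeftCLM ℂ (fun z : Phase V × V => chi ⟪z.1.snd, z.2⟫_ℝ)
    (SchwartzMap.compCLMOfContinuousLinearEquiv ℂ shear (tensor (stftS g φ) g)))) |>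
  SchwartzMap.compCLMOfContinuousLinearEquiv ℂ
    (WithLp.prodContinuousLinearEquiv 2 ℝ (Phase V) V).symm

theorem synthesis_apply (g φ : 𝓢(V, ℂ)) (w : Phase V) (t : V) :
    synthesis g φ (w, t) = (starRingEnd ℂ) (stftS g φ w * tfShift w.fst w.snd g t) := by
  have : synthesis g φ (w, t) = (starRingEnd ℂ) ((SchwartzMap.smulLeftCLM ℂ
    (fun z : Phase V × V => chi ⟪z.1.snd, z.2⟫_ℝ)
    (SchwartzMap.compCLMOfContinuousLinearEquiv ℂ shear (tensor (stftS g φ) g))) (w, t)) := rfl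
  rw [this, SchwartzMap.smulLeftCLM_apply_apply chi_phase_temperate, tfShift_eq_chi]
  rw [SchwartzMap.compCLMOfContinuousLinearEquiv_apply, Function.comp_apply, shear_apply,
    tensor_apply, smul_eq_mul]
  congr 1
  ring

theorem slice_synthesis (g φ : 𝓢(V, ℂ)) (w : Phase V) :
    slice w (synthesis g φ) = (starRingEnd ℂ) (stftS g φ w) • conjS (tfShift w.fst w.snd g) := by
  ext t
  rw [slice_apply, synthesis_apply, map_mul]
  rfl

theorem map_slice_synthesis (g φ : 𝓢(V, ℂ)) (G : 𝓢'(V, ℂ)) (w : Phase V) :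
    G (slice w (synthesis g φ)) = (starRingEnd ℂ) (stftS g φ w) * windowSTFT g G w.fst w.snd := by
  rw [slice_synthesis, map_smul, smul_eq_mul]
  rfl

/-- The square of the `L²` norm. -/
noncomputable def normSq (g : 𝓢(V, ℂ)) : ℝ := ∫ t, ‖g t‖ ^ 2

theorem normSq_pos {g : 𝓢(V, ℂ)} (hg : g ≠ 0) : 0 < normSq g := by
  have hi : Integrable (fun t => ‖g t‖ ^ 2) := (g.memLp 2 volume).integrable_norm_pow (by simp)
  refine (integral_pos_iff_support_of_nonneg (fun t => by positivity) hi).2 ?_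
  have hc : Continuous (fun t => ‖g t‖ ^ 2) := by
    have := g.continuous
    fun_prop
  refine (hc.isOpen_support).measure_pos _ ?_
  by_contra hne
  rw [Set.not_nonempty_iff_eq_empty, Function.support_eq_empty_iff] at hne
  exact hg (SchwartzMap.ext fun t => by simpa using congrFun hne t)

theorem integral_phase (f : Phase V → ℂ) :
    ∫ w, f w = ∫ z : V × V, f (WithLp.toLp 2 z) :=
  (WithLp.volume_preserving_symm_measurableEquiv_toLp_prod V V).integral_comp'
    (fun z : V × V => f (WithLp.toLp 2 z))

theorem measurePreserving_toLp :
    MeasurePreserving (fun z : V × V => (WithLp.toLp 2 z : Phase V)) volume volume :=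
  (WithLp.volume_preserving_symm_measurableEquiv_toLp_prod V V).symm _

theorem measurePreserving_ofLp :
    MeasurePreserving (fun w : Phase V => w.ofLp) volume volume :=
  WithLp.volume_preserving_symm_measurableEquiv_toLp_prod V V

/-- This is the inversion formula in conjugated form: Fourier inversion in the frequency variable
leaves φ(t) |g(t-x)|², and the x-integral of |g(t-x)|² is `normSq g`. -/
theorem isMarginal_synthesis (g φ : 𝓢(V, ℂ)) :
    IsMarginal (synthesis g φ) ((normSq g : ℂ) • conjS φ) := by
  intro t
  have hint : Integrable (fun w : Phase V => stftS g φ w * tfShift w.fst w.snd g t) := by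
    set σ := ContinuousLinearEquiv.prodComm ℝ V (Phase V)
    have h1 := (slice t (SchwartzMap.compCLMOfContinuousLinearEquiv ℂ σ (synthesis g φ))).integrable
      (μ := volume)
    have h2 := (Complex.conjCLE : ℂ →L[ℝ] ℂ).integrable_comp h1
    refine h2.congr (Filter.Eventually.of_forall fun w => ?_)
    change (starRingEnd ℂ) (synthesis g φ (w, t)) = _
    rw [synthesis_apply, Complex.conj_conj]
  have hint' : Integrable (fun z : V × V => stftS g φ (WithLp.toLp 2 z) * tfShift z.1 z.2 g t)
      (volume.prod volume) :=
    (measurePreserving_toLp (V := V)).integrable_comp_of_integrable hint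
  simp_rw [synthesis_apply]
  rw [integral_conj, integral_phase]
  have e1 : ∫ z : V × V, stftS g φ (WithLp.toLp 2 z) * tfShift z.1 z.2 g t
      = ∫ x, ∫ ξ, stftS g φ (WithLp.toLp 2 (x, ξ)) * tfShift x ξ g t := integral_prod _ hint'
  have e2 : ∀ x, ∫ ξ, stftS g φ (WithLp.toLp 2 (x, ξ)) * tfShift x ξ g t
      = φ t * ((‖g (t - x)‖ ^ 2 : ℝ) : ℂ) := fun x => by
    calc ∫ ξ, stftS g φ (WithLp.toLp 2 (x, ξ)) * tfShift x ξ g t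
        = ∫ ξ, (chi ⟪t, ξ⟫_ℝ * stftS g φ (WithLp.toLp 2 (x, ξ))) * g (t - x) := by
          refine integral_congr_ae (Filter.Eventually.of_forall fun ξ => ?_)
          simp only [tfShift_eq_chi, real_inner_comm]
          ring
      _ = φ t * (starRingEnd ℂ) (g (t - x)) * g (t - x) := by
          rw [integral_mul_const, integral_chi_stftS]
      _ = _ := by
          rw [mul_assoc, Complex.conj_mul']
          push_cast; rfl
  have e3 : ∫ x, ((‖g (t - x)‖ ^ 2 : ℝ) : ℂ) = normSq g := by
    rw [integral_complex_ofReal, normSq, integral_sub_left_eq_self (fun x => ‖g x‖ ^ 2) volume t]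
  have e4 : ∫ z : V × V, stftS g φ (WithLp.toLp 2 z) * tfShift (WithLp.toLp 2 z : Phase V).fst
      (WithLp.toLp 2 z : Phase V).snd g t = φ t * normSq g := by
    refine e1.trans ?_
    simp_rw [e2]
    rw [integral_const_mul, e3]
  rw [e4, map_mul, Complex.conj_ofReal, mul_comm]
  rfl

/-- The inversion formula for the short-time Fourier transform of a tempered distribution. -/
theorem inversion (g φ : 𝓢(V, ℂ)) (G : 𝓢'(V, ℂ)) :
    (normSq g : ℂ) * G (conjS φ)
      = ∫ w : Phase V, (starRingEnd ℂ) (stftS g φ w) * windowSTFT g G w.fst w.snd := by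
  have := distribution_integral G _ _ (isMarginal_synthesis g φ)
  rw [map_smul, smul_eq_mul] at this
  rw [this]
  simp_rw [map_slice_synthesis]

/-- Translating the integration variable by x leaves only a phase factor, which the modulus removes.
-/
theorem stftS_tfShift (g γ : 𝓢(V, ℂ)) (x ξ : V) (w : Phase V) :
    ‖stftS g (tfShift x ξ γ) w‖ = ‖stftS g γ (w - WithLp.toLp 2 (x, ξ))‖ := by
  rw [stftS_apply, stftS_apply, windowSTFT_eq_chi, windowSTFT_eq_chi,
    ← integral_add_right_eq_self _ x]
  have : ∀ t, tfShift x ξ γ (t + x) * (starRingEnd ℂ) (g (t + x - w.fst)) *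
      chi (-⟪w.snd, t + x⟫_ℝ) = chi (⟪ξ - w.snd, x⟫_ℝ) * (γ t *
        (starRingEnd ℂ) (g (t - (w - WithLp.toLp 2 (x, ξ)).fst)) *
        chi (-⟪(w - WithLp.toLp 2 (x, ξ)).snd, t⟫_ℝ)) := fun t => by
    rw [tfShift_eq_chi, add_sub_cancel_right]
    have h1 : t + x - w.fst = t - (w - WithLp.toLp 2 (x, ξ)).fst := by
      simp; abel
    have h2 : chi ⟪ξ, t + x⟫_ℝ * chi (-⟪w.snd, t + x⟫_ℝ) = chi (⟪ξ - w.snd, x⟫_ℝ) *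
        chi (-⟪(w - WithLp.toLp 2 (x, ξ)).snd, t⟫_ℝ) := by
      rw [← chi_add, ← chi_add]
      congr 1
      have e : (w - WithLp.toLp 2 (x, ξ)).snd = w.snd - ξ := rfl
      rw [e]
      simp only [inner_add_right, inner_sub_left]
      ring
    rw [h1]
    linear_combination (γ t * (starRingEnd ℂ) (g (t - (w - WithLp.toLp 2 (x, ξ)).fst))) * h2
  simp_rw [this]
  rw [integral_const_mul, norm_mul, norm_chi, one_mul]

theorem stftS_self_ne_zero {g : 𝓢(V, ℂ)} (hg : g ≠ 0) (x ξ : V) :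
    stftS g (tfShift x ξ g) (WithLp.toLp 2 (x, ξ)) ≠ 0 := by
  rw [← norm_ne_zero_iff, stftS_tfShift, sub_self, stftS_apply, windowSTFT_eq_chi, norm_ne_zero_iff]
  have : ∀ t, g t * (starRingEnd ℂ) (g (t - (0 : Phase V).fst)) * chi (-⟪(0 : Phase V).snd, t⟫_ℝ)
      = ((‖g t‖ ^ 2 : ℝ) : ℂ) := fun t => by
    simp [Complex.mul_conj']
  simp_rw [this]
  rw [integral_complex_ofReal]
  exact_mod_cast (normSq_pos hg).ne'

/-- The product conj(V_g φ) V_g G is a Schwartz function of w, being `partialPairing G` of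
`synthesis g φ`. Near w₀ it may be divided by conj(V_g φ) once φ is the shift of g by w₀, for which
V_g φ(w₀) ≠ 0. -/
theorem continuous_windowSTFT {g : 𝓢(V, ℂ)} (hg : g ≠ 0) (G : 𝓢'(V, ℂ)) :
    Continuous (fun w : Phase V => windowSTFT g G w.fst w.snd) := by
  refine continuous_iff_continuousAt.2 fun w₀ => ?_
  set φ := tfShift w₀.fst w₀.snd g
  have h1 : Continuous (fun w => partialPairing G (synthesis g φ) w) := SchwartzMap.continuous _
  have h2 : Continuous (fun w => (starRingEnd ℂ) (stftS g φ w)) :=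
    Complex.continuous_conj.comp (SchwartzMap.continuous _)
  have h3 : (starRingEnd ℂ) (stftS g φ w₀) ≠ 0 :=
    (map_ne_zero _).2 (stftS_self_ne_zero hg w₀.fst w₀.snd)
  refine (h1.continuousAt.div h2.continuousAt h3).congr ?_
  filter_upwards [h2.continuousAt.eventually_ne h3] with w hw
  rw [Pi.div_apply, partialPairing_apply, map_slice_synthesis, mul_div_cancel_left₀ _ hw]

theorem measurable_windowSTFT {g : 𝓢(V, ℂ)} (hg : g ≠ 0) (G : 𝓢'(V, ℂ)) :
    Measurable (fun z : V × V => ‖windowSTFT g G z.1 z.2‖ₑ) :=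
  ((continuous_windowSTFT hg G).comp
    (WithLp.prodContinuousLinearEquiv 2 ℝ V V).symm.continuous).enorm.measurable

theorem exists_decay_bound (S : 𝓢(Phase V, ℂ)) (N : ℕ) : ∃ C : ℝ≥0∞, C ≠ ⊤ ∧ ∀ w : Phase V,
    ‖S w‖ₑ ≤ C * (decay N w.fst * decay N w.snd) := by
  refine ⟨ENNReal.ofReal (2 ^ (N + N) * ((Finset.Iic (N + N, 0)).sup fun m =>
    SchwartzMap.seminorm ℝ m.1 m.2) S), ENNReal.ofReal_ne_top, fun w => ?_⟩
  have h := SchwartzMap.one_add_le_sup_seminorm_apply (𝕜 := ℝ) (m := (N + N, 0))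
        (k := N + N) (n := 0) le_rfl le_rfl S w
  rw [norm_iteratedFDeriv_zero] at h
  rw [decay, decay, ← ENNReal.ofReal_mul (by positivity), ← ENNReal.ofReal_mul (by positivity),
    ← ofReal_norm]
  refine ENNReal.ofReal_le_ofReal ?_
  rw [Real.rpow_neg (by positivity), Real.rpow_neg (by positivity), Real.rpow_natCast,
    Real.rpow_natCast, ← mul_inv, ← div_eq_mul_inv, le_div_iff₀ (by positivity), mul_comm]
  refine le_trans ?_ h
  rw [pow_add]
  gcongr
  · exact WithLp.norm_fst_le _ w
  · exact WithLp.norm_snd_le _ w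

/-- The short-time Fourier transforms for two windows are comparable. -/
theorem exists_window_bound {g : 𝓢(V, ℂ)} (hg : g ≠ 0) (γ : 𝓢(V, ℂ)) (N : ℕ) :
    ∃ C : ℝ≥0∞, C ≠ ⊤ ∧ ∀ (G : 𝓢'(V, ℂ)) (x ξ : V),
      ‖windowSTFT γ G x ξ‖ₑ ≤ C * smear volume N (fun y η => ‖windowSTFT g G y η‖ₑ) x ξ := by
  obtain ⟨C, hC, hb⟩ := exists_decay_bound (stftS g γ) N
  have hn := normSq_pos hg
  set κ := ‖(normSq g : ℂ)‖ₑ with hκ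
  have hκ0 : κ ≠ 0 := by
    rw [hκ, enorm_ne_zero]; exact_mod_cast hn.ne'
  have hκt : κ ≠ ⊤ := enorm_ne_top
  refine ⟨κ⁻¹ * C, ENNReal.mul_ne_top (ENNReal.inv_ne_top.2 hκ0) hC, fun G x ξ => ?_⟩
  set φ := tfShift x ξ γ with hφ
  have hm := measurable_windowSTFT hg G
  -- The inversion formula is applied to φ = M_ξ T_x γ. By covariance |V_g φ(w)| = |V_g γ(w -
  -- (x,ξ))|, so the right side is a convolution with a rapidly decreasing kernel.
  have h1 : κ * ‖windowSTFT γ G x ξ‖ₑ ≤ C * smear volume N (fun y η => ‖windowSTFT g G y η‖ₑ) x ξ := by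
    calc κ * ‖windowSTFT γ G x ξ‖ₑ = ‖(normSq g : ℂ) * G (conjS φ)‖ₑ := by
          rw [enorm_mul]; rfl
      _ ≤ ∫⁻ w : Phase V, ‖(starRingEnd ℂ) (stftS g φ w) * windowSTFT g G w.fst w.snd‖ₑ := by
          rw [inversion]; exact enorm_integral_le_lintegral_enorm _
      _ ≤ ∫⁻ w : Phase V, C * (‖windowSTFT g G w.fst w.snd‖ₑ * decay N (x - w.fst) *
            decay N (ξ - w.snd)) := by
          refine lintegral_mono fun w => ?_
          rw [enorm_mul]
          have e : ‖(starRingEnd ℂ) (stftS g φ w)‖ₑ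
              = ‖stftS g γ (w - WithLp.toLp 2 (x, ξ))‖ₑ := by
            rw [← ofReal_norm, ← ofReal_norm, RCLike.norm_conj, hφ, stftS_tfShift]
          rw [e]
          refine (mul_le_mul_left (hb _) _).trans ?_
          rw [← decay_neg (N : ℝ) (x - w.fst), ← decay_neg (N : ℝ) (ξ - w.snd), neg_sub, neg_sub]
          have e₁ : (w - WithLp.toLp 2 (x, ξ)).fst = w.fst - x := rfl
          have e₂ : (w - WithLp.toLp 2 (x, ξ)).snd = w.snd - ξ := rfl
          rw [e₁, e₂]
          exact le_of_eq (by ring)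
      _ = C * ∫⁻ z : V × V, (‖windowSTFT g G z.1 z.2‖ₑ * decay N (x - z.1) * decay N (ξ - z.2)) := by
          rw [lintegral_const_mul' _ _ hC]
          congr 1
          exact (measurePreserving_ofLp (V := V)).lintegral_comp_emb
            (MeasurableEquiv.toLp 2 (V × V)).symm.measurableEmbedding
            (fun z : V × V => ‖windowSTFT g G z.1 z.2‖ₑ * decay N (x - z.1) * decay N (ξ - z.2))
      _ = _ := by
          congr 1
          have hmm : Measurable (fun z : V × V =>
              ‖windowSTFT g G z.1 z.2‖ₑ * decay N (x - z.1) * decay N (ξ - z.2)) :=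
            (hm.mul ((measurable_decay _).comp (by fun_prop))).mul
              ((measurable_decay _).comp (by fun_prop))
          have := lintegral_prod_symm (μ := (volume : Measure V)) (ν := (volume : Measure V)) _
            hmm.aemeasurable
          rw [Measure.volume_eq_prod, this]
          unfold smear
          refine lintegral_congr fun η => ?_
          dsimp only
          rw [lintegral_mul_const]
          exact (hm.comp measurable_prodMk_right).mul ((measurable_decay _).comp (by fun_prop))
  rw [mul_assoc]
  calc _ = κ⁻¹ * (κ * ‖windowSTFT γ G x ξ‖ₑ) := by
        rw [← mul_assoc, ENNReal.inv_mul_cancel hκ0 hκt, one_mul]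
    _ ≤ _ := mul_le_mul_right h1 _

end Window

/-! ### Factorisation of the transform of a bilinear distribution -/

section Covariance

variable {V : Type} [NormedAddCommGroup V] [InnerProductSpace ℝ V] [FiniteDimensional ℝ V]
  [MeasurableSpace V] [BorelSpace V]

/-- `e` is the change of variables `(t, u) ↦ (t - u, (1 - τ) t + τ u)`. -/
def IsPhaseChange (τ : ℝ) (e : (V × V) ≃L[ℝ] (V × V)) : Prop :=
  ∀ z, e z = (z.1 - z.2, z.1 - τ • (z.1 - z.2))

theorem isPhaseChange_stftChange : IsPhaseChange (V := V) 0 stftChange := fun z => by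
  rw [zero_smul, sub_zero]; rfl

theorem isPhaseChange_ambChange : IsPhaseChange (V := V) (1 / 2) ambChange := fun z => by
  have : ambChange z = (z.1 - z.2, (1 / 2 : ℝ) • (z.1 + z.2)) := rfl
  rw [this]
  congr 1
  module

theorem IsPhaseChange.symm_apply {τ : ℝ} {e : (V × V) ≃L[ℝ] (V × V)} (he : IsPhaseChange τ e)
    (x m : V) : e.symm (x, m) = (m + τ • x, m + τ • x - x) := by
  rw [ContinuousLinearEquiv.symm_apply_eq, he]
  ext <;> simp

/-- The point of phase space at which the first factor of `phaseD` is evaluated. -/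
noncomputable def phasePoint (τ : ℝ) (z ζ : Phase V) : V × V :=
  (τ • z.fst - ζ.snd, ζ.fst + (1 - τ) • z.snd)

/-- The change of variables is linear and `phaseOp` undoes the partial Fourier transform in the
window. Shifting by z translates x and modulates m, modulating by ζ does the reverse, and on the
factors in t and u both act as time-frequency shifts. -/
theorem phaseOp_conjS_tfShift {τ : ℝ} {e : (V × V) ≃L[ℝ] (V × V)} (he : IsPhaseChange τ e)
    (g h : 𝓢(V, ℂ)) (z ζ : Phase V) :
    phaseOp e (conjS (tfShift z ζ (crossWindow e g h))) =
      chi (-⟪ζ.snd, z.snd⟫_ℝ) •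
        tensor (conjS (tfShift (phasePoint τ z ζ).1 (phasePoint τ z ζ).2 g))
          (tfShift ((phasePoint τ z ζ).1 - z.fst) ((phasePoint τ z ζ).2 - z.snd) h) := by
  ext ⟨t, u⟩
  rw [phaseOp_apply, he]
  dsimp only
  simp_rw [chi_neg]
  set x := t - u
  set m := t - τ • x with hm
  -- After the translation ξ ↦ ξ + z₂ the ξ-dependent phases combine into the single character at m
  -- + ζ₂, which `integral_chi_crossWindow` inverts.
  have h1 : ∀ ξ, chi (-⟪m, ξ + z.snd⟫_ℝ) * conjS (tfShift z ζ (crossWindow e g h))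
      (WithLp.toLp 2 (x, ξ + z.snd)) = (starRingEnd ℂ) (chi (⟪ζ.fst, x⟫_ℝ + ⟪m + ζ.snd, z.snd⟫_ℝ) *
        (chi ⟪m + ζ.snd, ξ⟫_ℝ * crossWindow e g h (WithLp.toLp 2 (x - z.fst, ξ)))) := fun ξ => by
    rw [conjS_apply, tfShift_eq_chi, ← conj_chi, ← map_mul]
    congr 1
    have e1 : (WithLp.toLp 2 (x, ξ + z.snd) : Phase V) - z = WithLp.toLp 2 (x - z.fst, ξ) := by
      have : ((x, ξ + z.snd) : V × V) - z.ofLp = (x - z.fst, ξ) :=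
        Prod.ext rfl (add_sub_cancel_right _ _)
      rw [← this]; rfl
    have e2 : ⟪ζ, (WithLp.toLp 2 (x, ξ + z.snd) : Phase V)⟫_ℝ
        = ⟪ζ.fst, x⟫_ℝ + ⟪ζ.snd, ξ + z.snd⟫_ℝ := WithLp.prod_inner_apply _ _
    rw [e1, e2, ← mul_assoc, ← mul_assoc, ← chi_add, ← chi_add]
    congr 2
    simp only [inner_add_left, inner_add_right]
    ring
  rw [← integral_add_right_eq_self _ z.snd]
  simp_rw [h1]
  rw [integral_conj, integral_const_mul, integral_chi_crossWindow, he.symm_apply]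
  have e1 : m + ζ.snd + τ • (x - z.fst) = t - (phasePoint τ z ζ).1 := by
    rw [hm, phasePoint]; module
  have e2 : t - (phasePoint τ z ζ).1 - (x - z.fst) = u - ((phasePoint τ z ζ).1 - z.fst) := by
    simp only [x]; abel
  dsimp only
  rw [e1, e2]
  change _ = chi (-⟪ζ.snd, z.snd⟫_ℝ) * tensor (conjS (tfShift (phasePoint τ z ζ).1
    (phasePoint τ z ζ).2 g)) (tfShift ((phasePoint τ z ζ).1 - z.fst)
    ((phasePoint τ z ζ).2 - z.snd) h) (t, u)
  rw [tensor_apply, conjS_apply, tfShift_eq_chi, tfShift_eq_chi]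
  simp only [map_mul, Complex.conj_conj, conj_chi]
  have h3 : chi (-(⟪ζ.fst, x⟫_ℝ + ⟪m + ζ.snd, z.snd⟫_ℝ)) = chi (-⟪ζ.snd, z.snd⟫_ℝ) *
      chi (-⟪(phasePoint τ z ζ).2, t⟫_ℝ) * chi ⟪(phasePoint τ z ζ).2 - z.snd, u⟫_ℝ := by
    rw [← chi_add, ← chi_add]
    congr 1
    simp only [hm, x, phasePoint, inner_add_left, inner_sub_left, inner_sub_right, inner_add_right,
      inner_smul_left, inner_smul_right, conj_trivial, real_inner_comm z.snd]
    ring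
  rw [h3]
  ring

theorem partialPairing_tensor (T : 𝓢'(V, ℂ)) (φ ψ : 𝓢(V, ℂ)) :
    partialPairing T (tensor φ ψ) = T ψ • φ := by
  ext x
  rw [partialPairing_apply]
  have : slice x (tensor φ ψ) = φ x • ψ := by
    ext y; rw [slice_apply, tensor_apply]; rfl
  rw [this, map_smul, smul_apply, smul_eq_mul, smul_eq_mul, mul_comm]

/-- The tempered distribution on phase space attached to `f ⊗ conj f'` and a change of variables. -/
noncomputable def phaseD (e : (V × V) ≃L[ℝ] (V × V)) (f f' : 𝓢'(V, ℂ)) : 𝓢'(Phase V, ℂ) :=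
  transposeD (phaseOp e) (tensorConj f f')

/-- A tensor product of test functions decouples f ⊗ conj f', and the remaining phase has modulus
one. The conjugated factor f' is evaluated at w - z, the other one at w. -/
theorem enorm_windowSTFT_phaseD {τ : ℝ} {e : (V × V) ≃L[ℝ] (V × V)} (he : IsPhaseChange τ e)
    (g h : 𝓢(V, ℂ)) (f f' : 𝓢'(V, ℂ)) (z ζ : Phase V) :
    ‖windowSTFT (crossWindow e g h) (phaseD e f f') z ζ‖ₑ =
      ‖windowSTFT h f' (phasePoint τ z ζ - z.ofLp).1 (phasePoint τ z ζ - z.ofLp).2‖ₑ *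
        ‖windowSTFT g f (phasePoint τ z ζ).1 (phasePoint τ z ζ).2‖ₑ := by
  have h1 : windowSTFT (crossWindow e g h) (phaseD e f f') z ζ =
      f (partialPairing (conjD f') (phaseOp e (conjS (tfShift z ζ (crossWindow e g h))))) := rfl
  rw [h1, phaseOp_conjS_tfShift he, map_smul, partialPairing_tensor, map_smul, map_smul,
    smul_eq_mul, smul_eq_mul, enorm_mul, enorm_mul, conjD_apply]
  have h2 : ‖chi (-⟪ζ.snd, z.snd⟫_ℝ)‖ₑ = 1 := by
    rw [← ofReal_norm, norm_chi, ENNReal.ofReal_one]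
  rw [h2, one_mul, RCLike.enorm_conj]
  rfl

/-- For fixed z the map is (a,b) ↦ (-b,a) followed by a translation; τ enters only the translation.
-/
theorem measurePreserving_phasePoint (τ : ℝ) (z : Phase V) :
    MeasurePreserving (phasePoint τ z) volume volume := by
  have h1 : MeasurePreserving (fun w : V × V => (-w.2, w.1)) volume volume := by
    have h2 : MeasurePreserving (fun x : V => -x) volume volume := Measure.measurePreserving_neg _
    have h3 := (h2.prod (MeasurePreserving.id (volume : Measure V))).comp
      (Measure.measurePreserving_swap (μ := (volume : Measure V)) (ν := (volume : Measure V)))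
    exact h3
  have h2 : MeasurePreserving
      (fun w : V × V => w + (τ • z.fst, (1 - τ) • z.snd)) volume volume := by
    have : (volume : Measure (V × V)).IsAddRightInvariant := by
      rw [Measure.volume_eq_prod]; infer_instance
    exact measurePreserving_add_right volume _
  have := (h2.comp h1).comp (measurePreserving_ofLp (V := V))
  convert this using 1
  ext ζ
  · simp [phasePoint, sub_eq_neg_add]
  · simp [phasePoint]

/-- The norm controlling the time-frequency behaviour of bilinear time-frequency
distributions. -/
noncomputable def convNorm (p q : ℝ≥0∞) (ρ : V × V → ℝ≥0∞) (A B : V × V → ℝ≥0∞) : ℝ≥0∞ :=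
  eLpNorm (fun z => eLpNorm (fun w => A (w - z) * B w) p volume * ρ z) q volume

theorem amalgamNorm_eq_convNorm (τ : ℝ) {Φ : 𝓢(Phase V, ℂ)} {T : 𝓢'(Phase V, ℂ)}
    {A B : V × V → ℝ≥0∞} (hA : Measurable A) (hB : Measurable B)
    (hT : ∀ z ζ, ‖windowSTFT Φ T z ζ‖ₑ = A (phasePoint τ z ζ - z.ofLp) * B (phasePoint τ z ζ))
    (p q : ℝ≥0∞) {ρ : Phase V → ℝ} (hρ : Measurable ρ) :
    amalgamNorm Φ p q ρ T = convNorm p q (fun z => ENNReal.ofReal (ρ (WithLp.toLp 2 z))) A B := by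
  have hsub : Measurable (fun z : (V × V) × (V × V) => z.2 - z.1) := by fun_prop
  have hm : Measurable (Function.uncurry fun (z w : V × V) => A (w - z) * B w) :=
    (hA.comp hsub).mul (hB.comp measurable_snd)
  have h1 : ∀ z : Phase V, eLpNorm (fun ζ : Phase V => ‖windowSTFT Φ T z ζ‖) p volume
      = eLpNorm (fun w => A (w - z.ofLp) * B w) p volume := fun z => by
    have hz : Measurable (fun w => A (w - z.ofLp) * B w) :=
      (hA.comp (measurable_id.sub_const _)).mul hB
    rw [← eLpNorm_comp_measurePreserving (p := p) hz.aestronglyMeasurable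
      (measurePreserving_phasePoint τ z), eLpNorm_norm, ← eLpNorm_enorm]
    congr 1
    ext ζ
    exact hT z ζ
  have h2 : Measurable (fun z : V × V => eLpNorm (fun w => A (w - z) * B w) p volume *
      ENNReal.ofReal (ρ (WithLp.toLp 2 z))) := by
    refine (measurable_eLpNorm_right hm p).mul (ENNReal.measurable_ofReal.comp (hρ.comp ?_))
    exact (measurePreserving_toLp (V := V)).measurable
  calc amalgamNorm Φ p q ρ T = eLpNorm ((fun z : V × V =>
        eLpNorm (fun w => A (w - z) * B w) p volume * ENNReal.ofReal (ρ (WithLp.toLp 2 z))) ∘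
        fun w : Phase V => w.ofLp) q volume := by
        unfold amalgamNorm
        congr 1
        ext z
        rw [h1]
        rfl
    _ = _ := eLpNorm_comp_measurePreserving h2.aestronglyMeasurable
      (measurePreserving_ofLp (V := V))

theorem amalgamNorm_phaseD {τ : ℝ} {e : (V × V) ≃L[ℝ] (V × V)} (he : IsPhaseChange τ e)
    {g h : 𝓢(V, ℂ)} (hg : g ≠ 0) (hh : h ≠ 0) (p q : ℝ≥0∞) {ρ : Phase V → ℝ} (hρ : Measurable ρ)
    (f f' : 𝓢'(V, ℂ)) :
    amalgamNorm (crossWindow e g h) p q ρ (phaseD e f f') =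
      convNorm p q (fun z => ENNReal.ofReal (ρ (WithLp.toLp 2 z)))
        (fun z => ‖windowSTFT h f' z.1 z.2‖ₑ) (fun z => ‖windowSTFT g f z.1 z.2‖ₑ) :=
  amalgamNorm_eq_convNorm τ (measurable_windowSTFT hh f') (measurable_windowSTFT hg f)
    (enorm_windowSTFT_phaseD he g h f f') p q hρ

end Covariance

/-! ### Polynomial weights and Peetre's inequality -/

section Weights

variable {W : Type} [NormedAddCommGroup W] [InnerProductSpace ℝ W]

theorem vWeight_pos (s : ℝ) (z : W) : 0 < vWeight s z := by
  unfold vWeight; positivity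

theorem vWeight_zero (z : W) : vWeight 0 z = 1 := by simp [vWeight]

theorem vWeight_neg (s : ℝ) (z : W) : vWeight s (-z) = vWeight s z := by simp [vWeight]

theorem continuous_vWeight (s : ℝ) : Continuous (vWeight s : W → ℝ) := by
  unfold vWeight
  refine Continuous.rpow_const (by fun_prop) fun z => Or.inl ?_
  positivity

theorem one_add_norm_add_sq_le (z w : W) :
    1 + ‖z + w‖ ^ 2 ≤ 2 * ((1 + ‖z‖ ^ 2) * (1 + ‖w‖ ^ 2)) := by
  have h := norm_add_le z w
  nlinarith [sq_nonneg (‖z‖ - ‖w‖), norm_nonneg (z + w), norm_nonneg z, norm_nonneg w,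
    mul_nonneg (sq_nonneg ‖z‖) (sq_nonneg ‖w‖)]

/-- Peetre's inequality. -/
theorem vWeight_add_le (s : ℝ) (z w : W) :
    vWeight s (z + w) ≤ 2 ^ (|s| / 2) * (vWeight s z * vWeight |s| w) := by
  unfold vWeight
  rcases le_total 0 s with h | h
  · rw [abs_of_nonneg h, ← Real.mul_rpow (by positivity) (by positivity),
      ← Real.mul_rpow (by positivity) (by positivity)]
    exact Real.rpow_le_rpow (by positivity) (one_add_norm_add_sq_le z w) (by linarith)
  -- For s < 0 the basic inequality is used with z = (z + w) + (-w), and the resulting bound is then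
  -- inverted.
  · rw [abs_of_nonpos h]
    have h1 : 1 + ‖z‖ ^ 2 ≤ 2 * ((1 + ‖z + w‖ ^ 2) * (1 + ‖w‖ ^ 2)) := by
      simpa using one_add_norm_add_sq_le (z + w) (-w)
    have h2 : (1 + ‖z‖ ^ 2) ^ (-s / 2) ≤ 2 ^ (-s / 2) * ((1 + ‖z + w‖ ^ 2) ^ (-s / 2) *
        (1 + ‖w‖ ^ 2) ^ (-s / 2)) := by
      rw [← Real.mul_rpow (by positivity) (by positivity),
        ← Real.mul_rpow (by positivity) (by positivity)]
      exact Real.rpow_le_rpow (by positivity) h1 (by linarith)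
    have e : ∀ r : ℝ, 0 < r → r ^ (s / 2) = (r ^ (-s / 2))⁻¹ := fun r hr => by
      rw [← Real.rpow_neg hr.le]; congr 1; ring
    rw [e _ (by positivity), e (1 + ‖z‖ ^ 2) (by positivity), inv_le_iff_one_le_mul₀ (by positivity)]
    have h3 : (1 + ‖z‖ ^ 2) ^ (-s / 2) * ((1 + ‖z‖ ^ 2) ^ (-s / 2))⁻¹ = 1 :=
      mul_inv_cancel₀ (by positivity)
    refine h3.symm.trans_le ((mul_le_mul_of_nonneg_right h2 (by positivity)).trans_eq ?_)
    ring

/-- Peetre's inequality in the form needed to carry a weight through a convolution, at the expense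
of σ powers of decay. -/
theorem vWeight_mul_decay_le (s : ℝ) {σ : ℝ} (hσ : |s| ≤ σ) (x y : W) :
    ENNReal.ofReal (vWeight s x) * decay σ (x - y)
      ≤ ENNReal.ofReal (2 ^ (|s| / 2)) * ENNReal.ofReal (vWeight s y) := by
  rw [decay, ← ENNReal.ofReal_mul (vWeight_pos _ _).le, ← ENNReal.ofReal_mul (by positivity)]
  refine ENNReal.ofReal_le_ofReal ?_
  have h1 := vWeight_add_le s y (x - y)
  rw [add_sub_cancel] at h1
  have h2 : vWeight |s| (x - y) ≤ (1 + ‖x - y‖) ^ σ := by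
    calc vWeight |s| (x - y) ≤ ((1 + ‖x - y‖) ^ (2 : ℝ)) ^ (|s| / 2) := by
          unfold vWeight
          refine Real.rpow_le_rpow (by positivity) ?_ (by positivity)
          rw [Real.rpow_two]
          nlinarith [norm_nonneg (x - y)]
      _ = (1 + ‖x - y‖) ^ |s| := by
          rw [← Real.rpow_mul (by positivity)]; congr 1; ring
      _ ≤ _ := Real.rpow_le_rpow_of_exponent_le (by linarith [norm_nonneg (x - y)]) hσ
  rw [Real.rpow_neg (by positivity), ← div_eq_mul_inv, div_le_iff₀ (by positivity), mul_assoc]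
  refine h1.trans ?_
  have := vWeight_pos s y
  gcongr

end Weights

/-! ### Independence of windows and the sufficiency estimate -/

section Windows

variable {V : Type} [NormedAddCommGroup V] [InnerProductSpace ℝ V] [FiniteDimensional ℝ V]
  [MeasurableSpace V] [BorelSpace V]

theorem phaseWeight_mul_decay_le (s : ℝ) {σ : ℝ} (hσ : |s| ≤ σ) (x ξ y η : V) :
    ENNReal.ofReal (phaseWeight s x ξ) * (decay σ (x - y) * decay σ (ξ - η))
      ≤ ENNReal.ofReal (2 ^ (|s| / 2)) * ENNReal.ofReal (phaseWeight s y η) := by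
  set a : Phase V := WithLp.toLp 2 (x, ξ)
  set b : Phase V := WithLp.toLp 2 (y, η)
  have h1 : ‖a - b‖ ^ 2 = ‖x - y‖ ^ 2 + ‖ξ - η‖ ^ 2 := WithLp.prod_norm_sq_eq_of_L2 (a - b)
  have h2 : ‖a - b‖ ≤ ‖x - y‖ + ‖ξ - η‖ := by
    refine le_of_sq_le_sq ?_ (by positivity)
    rw [h1]
    nlinarith [mul_nonneg (norm_nonneg (x - y)) (norm_nonneg (ξ - η))]
  have h0 : 0 ≤ σ := (abs_nonneg s).trans hσ
  refine le_trans (mul_le_mul_right ?_ _) (vWeight_mul_decay_le s hσ a b)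
  unfold decay
  rw [← ENNReal.ofReal_mul (by positivity), ← Real.mul_rpow (by positivity) (by positivity)]
  refine ENNReal.ofReal_le_ofReal (Real.rpow_le_rpow_of_nonpos (by positivity) ?_ (by linarith))
  nlinarith [mul_nonneg (norm_nonneg (x - y)) (norm_nonneg (ξ - η))]

theorem phaseWeight_nonneg (s : ℝ) (x ξ : V) : 0 ≤ phaseWeight s x ξ := (vWeight_pos s _).le

theorem modNorm_eq_mixNorm (g : 𝓢(V, ℂ)) (p q : ℝ≥0∞) {m : V → V → ℝ} (hm : ∀ x ξ, 0 ≤ m x ξ)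
    (f : 𝓢'(V, ℂ)) : modNorm g p q m f =
      mixNorm volume p q (fun x ξ => ENNReal.ofReal (m x ξ) * ‖windowSTFT g f x ξ‖ₑ) := by
  unfold modNorm mixNorm
  congr 1
  ext ξ
  rw [← eLpNorm_enorm]
  congr 1
  ext x
  rw [enorm_mul, enorm_norm, Real.enorm_eq_ofReal (hm x ξ), mul_comm]

theorem amalgamNorm_eq_mixNorm (g : 𝓢(V, ℂ)) (p q : ℝ≥0∞) (w : V → ℝ) (f : 𝓢'(V, ℂ)) :
    amalgamNorm g p q w f =
      mixNorm volume p q (fun ξ x => ENNReal.ofReal (w x) * ‖windowSTFT g f x ξ‖ₑ) := by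
  unfold amalgamNorm mixNorm
  congr 1
  ext x
  rw [eLpNorm_ennreal_const_mul ENNReal.ofReal_ne_top, eLpNorm_norm, mul_comm, eLpNorm_enorm]

/-- Amalgam norms integrate frequency first and modulation norms integrate time first. This symmetry
lets one estimate for `smear` serve both. -/
theorem smear_swap (N : ℝ) {H : V → V → ℝ≥0∞} (hH : Measurable (Function.uncurry H)) (x ξ : V) :
    smear volume N (fun ξ x => H x ξ) ξ x = smear volume N H x ξ := by
  unfold smear
  have e1 : ∀ y, (∫⁻ η, H y η * decay N (ξ - η)) * decay N (x - y)
      = ∫⁻ η, H y η * decay N (x - y) * decay N (ξ - η) := fun y => by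
    rw [← lintegral_mul_const' _ _ (decay_ne_top _ _)]
    exact lintegral_congr fun η => by ring
  have e2 : ∀ η, (∫⁻ y, H y η * decay N (x - y)) * decay N (ξ - η)
      = ∫⁻ y, H y η * decay N (x - y) * decay N (ξ - η) := fun η =>
    (lintegral_mul_const' _ _ (decay_ne_top _ _)).symm
  simp_rw [e1, e2]
  refine lintegral_lintegral_swap (Measurable.aemeasurable ?_)
  exact (hH.mul ((measurable_decay N).comp (by fun_prop))).mul
    ((measurable_decay N).comp (by fun_prop))

/-- The window comparison is used with decay N + σ: the σ powers pay for moving the weight inside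
the convolution, and the N powers remain in the kernel. -/
theorem exists_weighted_bound {g : 𝓢(V, ℂ)} (hg : g ≠ 0) (γ : 𝓢(V, ℂ)) (N : ℕ) {σ : ℕ}
    {c : ℝ≥0∞} (hc : c ≠ ⊤) {m : V → V → ℝ≥0∞} (hmt : ∀ x ξ, m x ξ ≠ ⊤)
    (hm : ∀ x ξ y η, m x ξ * (decay (σ : ℝ) (x - y) * decay (σ : ℝ) (ξ - η)) ≤ c * m y η) :
    ∃ C : ℝ≥0∞, C ≠ ⊤ ∧ ∀ (f : 𝓢'(V, ℂ)) (x ξ : V), m x ξ * ‖windowSTFT γ f x ξ‖ₑ ≤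
      C * smear volume N (fun y η => m y η * ‖windowSTFT g f y η‖ₑ) x ξ := by
  obtain ⟨C, hC, h⟩ := exists_window_bound hg γ (N + σ)
  refine ⟨C * c, ENNReal.mul_ne_top hC hc, fun f x ξ => ?_⟩
  have h1 := h f x ξ
  push_cast at h1
  calc _ ≤ m x ξ * (C * smear volume (N + σ) (fun y η => ‖windowSTFT g f y η‖ₑ) x ξ) := by gcongr
    _ = C * (m x ξ * smear volume (N + σ) (fun y η => ‖windowSTFT g f y η‖ₑ) x ξ) := by ring
    _ ≤ _ := by
      rw [mul_assoc]
      exact mul_le_mul_right (mul_smear_le volume N σ hc hmt hm _ x ξ) C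

theorem lintegral_decay_finrank_ne_top :
    ∫⁻ x : V, decay ((Module.finrank ℝ V + 1 : ℕ) : ℝ) x ≠ ⊤ :=
  lintegral_decay_ne_top volume (by push_cast; linarith)

theorem mixNorm_smear_swap_le {N : ℝ} (hN : ∫⁻ x : V, decay N x ≠ ⊤) {H : V → V → ℝ≥0∞}
    (hH : Measurable (Function.uncurry H)) {p q : ℝ≥0∞} (hp : 1 ≤ p) (hq : 1 ≤ q) :
    mixNorm volume p q (fun ξ x => smear volume N H x ξ) ≤
      (∫⁻ x : V, decay N x) ^ 2 * mixNorm volume p q (fun ξ x => H x ξ) := by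
  simp_rw [← smear_swap N hH]
  exact mixNorm_smear_le (H := fun ξ x => H x ξ) volume hN (hH.comp measurable_swap) hp hq

/-- The amalgam norm does not depend on the window, up to constants. -/
theorem exists_amalgamNorm_le {g : 𝓢(V, ℂ)} (hg : g ≠ 0) (γ : 𝓢(V, ℂ)) {p q : ℝ≥0∞}
    (hp : 1 ≤ p) (hq : 1 ≤ q) (s : ℝ) : ∃ C : ℝ≥0∞, C ≠ ⊤ ∧ ∀ f : 𝓢'(V, ℂ),
      amalgamNorm γ p q (vWeight s) f ≤ C * amalgamNorm g p q (vWeight s) f := by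
  set N : ℕ := Module.finrank ℝ V + 1
  obtain ⟨C, hC, h⟩ := exists_weighted_bound hg γ N (σ := ⌈|s|⌉₊)
    (m := fun x _ => ENNReal.ofReal (vWeight s x)) (c := ENNReal.ofReal (2 ^ (|s| / 2)))
    ENNReal.ofReal_ne_top (fun _ _ => ENNReal.ofReal_ne_top) fun x ξ y η => by
      refine le_trans (mul_le_mul_right ?_ _) (vWeight_mul_decay_le s (Nat.le_ceil |s|) x y)
      -- The weight depends on position alone, so the decay in frequency is simply bounded by 1.
      refine mul_le_of_le_one_right' ?_
      unfold decay
      refine ENNReal.ofReal_le_one.2 (Real.rpow_le_one_of_one_le_of_nonpos ?_ ?_)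
      · linarith [norm_nonneg (ξ - η)]
      · simp
  refine ⟨C * (∫⁻ x : V, decay (N : ℝ) x) ^ 2, ENNReal.mul_ne_top hC
    (ENNReal.pow_ne_top lintegral_decay_finrank_ne_top), fun f => ?_⟩
  set H : V → V → ℝ≥0∞ := fun y η => ENNReal.ofReal (vWeight s y) * ‖windowSTFT g f y η‖ₑ with hH
  have hHm : Measurable (Function.uncurry H) :=
    (ENNReal.measurable_ofReal.comp ((continuous_vWeight s).measurable.comp measurable_fst)).mul
      (measurable_windowSTFT hg f)
  have h1 := mixNorm_smear_swap_le lintegral_decay_finrank_ne_top hHm hp hq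
  have h2 : mixNorm volume p q (fun ξ x => ENNReal.ofReal (vWeight s x) * ‖windowSTFT γ f x ξ‖ₑ)
      ≤ mixNorm volume p q (fun ξ x => C * smear volume (N : ℝ) H x ξ) :=
    mixNorm_mono p q fun ξ x => h f x ξ
  rw [mixNorm_const_mul hC] at h2
  rw [amalgamNorm_eq_mixNorm, amalgamNorm_eq_mixNorm, mul_assoc]
  exact h2.trans (mul_le_mul_right h1 C)

/-- The weighted short-time Fourier transform has a slowly varying majorant of comparable norm. -/
theorem exists_slow_majorant {g : 𝓢(V, ℂ)} (hg : g ≠ 0) (γ : 𝓢(V, ℂ)) {p q : ℝ≥0∞}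
    (hp : 1 ≤ p) (hq : 1 ≤ q) (s : ℝ) : ∃ C : ℝ≥0∞, C ≠ ⊤ ∧ ∀ f : 𝓢'(V, ℂ),
      ∃ M : V × V → ℝ≥0∞, Measurable M ∧
        IsSlow (ENNReal.ofReal (2 ^ ((Module.finrank ℝ V + 1 : ℕ) : ℝ)) *
          ENNReal.ofReal (2 ^ ((Module.finrank ℝ V + 1 : ℕ) : ℝ))) M ∧
        (∀ z, ENNReal.ofReal (phaseWeight s z.1 z.2) * ‖windowSTFT γ f z.1 z.2‖ₑ ≤ M z) ∧
        mixNorm volume p q (fun x ξ => M (x, ξ)) ≤ C * modNorm g p q (phaseWeight s) f := by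
  set N : ℕ := Module.finrank ℝ V + 1
  obtain ⟨C, hC, h⟩ := exists_weighted_bound hg γ N (σ := ⌈|s|⌉₊)
    (m := fun x ξ => ENNReal.ofReal (phaseWeight s x ξ)) (c := ENNReal.ofReal (2 ^ (|s| / 2)))
    ENNReal.ofReal_ne_top (fun _ _ => ENNReal.ofReal_ne_top) fun x ξ y η =>
      phaseWeight_mul_decay_le s (Nat.le_ceil |s|) x ξ y η
  refine ⟨C * (∫⁻ x : V, decay (N : ℝ) x) ^ 2, ENNReal.mul_ne_top hC
    (ENNReal.pow_ne_top lintegral_decay_finrank_ne_top), fun f => ?_⟩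
  set H : V → V → ℝ≥0∞ := fun y η => ENNReal.ofReal (phaseWeight s y η) * ‖windowSTFT g f y η‖ₑ
    with hH
  have hHm : Measurable (Function.uncurry H) :=
    (ENNReal.measurable_ofReal.comp ((continuous_vWeight s).measurable.comp
      (measurePreserving_toLp (V := V)).measurable)).mul (measurable_windowSTFT hg f)
  -- The smearing of the weighted transform is itself the majorant: the convolution makes it slowly
  -- varying, and N exceeds the dimension by one so that its kernel is integrable.
  refine ⟨fun z => C * smear volume N H z.1 z.2, (measurable_smear volume N hHm).const_mul C,
    fun z z' hz => ?_, fun z => h f z.1 z.2, ?_⟩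
  · dsimp only
    rw [mul_left_comm]
    exact mul_le_mul_right (isSlow_smear volume (Nat.cast_nonneg N) z z' hz) C
  · have e : modNorm g p q (phaseWeight s) f = mixNorm volume p q H :=
      modNorm_eq_mixNorm g p q (phaseWeight_nonneg s) f
    rw [e, mul_assoc]
    refine (mixNorm_const_mul hC p q _).trans_le (mul_le_mul_right ?_ C)
    exact mixNorm_smear_le volume lintegral_decay_finrank_ne_top hHm hp hq

theorem exists_modNorm_le {g : 𝓢(V, ℂ)} (hg : g ≠ 0) (γ : 𝓢(V, ℂ)) {p q : ℝ≥0∞}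
    (hp : 1 ≤ p) (hq : 1 ≤ q) (s : ℝ) : ∃ C : ℝ≥0∞, C ≠ ⊤ ∧ ∀ f : 𝓢'(V, ℂ),
      modNorm γ p q (phaseWeight s) f ≤ C * modNorm g p q (phaseWeight s) f := by
  obtain ⟨C, hC, h⟩ := exists_slow_majorant hg γ hp hq s
  refine ⟨C, hC, fun f => ?_⟩
  obtain ⟨M, -, -, h1, h2⟩ := h f
  rw [modNorm_eq_mixNorm γ p q (phaseWeight_nonneg s) f]
  exact (mixNorm_mono p q fun x ξ => h1 (x, ξ)).trans h2

theorem IndexCondition.symm {p₁ q₁ p₂ q₂ p q : ℝ≥0∞} (h : IndexCondition p₁ q₁ p₂ q₂ p q) :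
    IndexCondition p₂ q₂ p₁ q₁ p q := by
  obtain ⟨⟨h1, h2, h3, h4⟩, h5, h6⟩ := h
  exact ⟨⟨h3, h4, h1, h2⟩, by rwa [add_comm p₂⁻¹], by rwa [add_comm q₂⁻¹]⟩

/-- Boundedness of bilinear time-frequency distributions from weighted modulation spaces to weighted
Wiener amalgam spaces. The weight on phase space is dominated by the product of the weights of the
factors at points whose difference is the given one. -/
theorem exists_phaseD_bound {τ : ℝ} {e : (V × V) ≃L[ℝ] (V × V)} (he : IsPhaseChange τ e)
    {p₁ q₁ p₂ q₂ p q : ℝ≥0∞} (hp₁ : 1 ≤ p₁) (hq₁ : 1 ≤ q₁) (hp₂ : 1 ≤ p₂) (hq₂ : 1 ≤ q₂)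
    (hp : 1 ≤ p) (hq : 1 ≤ q) (hI : IndexCondition p₁ q₁ p₂ q₂ p q) {g₁ g₂ : 𝓢(V, ℂ)}
    (hg₁ : g₁ ≠ 0) (hg₂ : g₂ ≠ 0) (G : 𝓢(Phase V, ℂ)) {s s₁ s₂ c : ℝ} (hc : 0 ≤ c)
    (hs : ∀ z w : Phase V, vWeight s z ≤ c * (vWeight s₁ (w - z) * vWeight s₂ w)) :
    ∃ C : ℝ≥0∞, C ≠ ⊤ ∧ ∀ f₁ f₂ : 𝓢'(V, ℂ),
      amalgamNorm G p q (vWeight s) (phaseD e f₂ f₁) ≤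
        C * (modNorm g₁ p₁ q₁ (phaseWeight s₁) f₁ * modNorm g₂ p₂ q₂ (phaseWeight s₂) f₂) := by
  -- The given window is exchanged for the one for which the transform factorises.
  obtain ⟨C₀, hC₀, h₀⟩ := exists_amalgamNorm_le (crossWindow_ne_zero e hg₂ hg₁) G hp hq s
  obtain ⟨C₁, hC₁, h₁⟩ := exists_slow_majorant hg₁ g₁ hp₁ hq₁ s₁
  obtain ⟨C₂, hC₂, h₂⟩ := exists_slow_majorant hg₂ g₂ hp₂ hq₂ s₂
  obtain ⟨K, hK, h₃⟩ := exists_conv_bound (volume : Measure V)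
    (c := ENNReal.ofReal (2 ^ ((Module.finrank ℝ V + 1 : ℕ) : ℝ)) *
          ENNReal.ofReal (2 ^ ((Module.finrank ℝ V + 1 : ℕ) : ℝ)))
    (ENNReal.mul_ne_top ENNReal.ofReal_ne_top ENNReal.ofReal_ne_top) hp₁ hq₁ hp₂ hq₂ hp hq hI
  refine ⟨C₀ * ENNReal.ofReal c * K * (C₁ * C₂), ENNReal.mul_ne_top (ENNReal.mul_ne_top
    (ENNReal.mul_ne_top hC₀ ENNReal.ofReal_ne_top) hK) (ENNReal.mul_ne_top hC₁ hC₂),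
    fun f₁ f₂ => ?_⟩
  obtain ⟨M₁, mM₁, sM₁, bM₁, nM₁⟩ := h₁ f₁
  obtain ⟨M₂, mM₂, sM₂, bM₂, nM₂⟩ := h₂ f₂
  -- The submultiplicative bound on the weight is absorbed into the two transforms, each then
  -- replaced by its slowly varying majorant.
  have hpt : ∀ z w : V × V, ‖windowSTFT g₁ f₁ (w - z).1 (w - z).2‖ₑ * ‖windowSTFT g₂ f₂ w.1 w.2‖ₑ *
      ENNReal.ofReal (vWeight s (WithLp.toLp 2 z : Phase V)) ≤
      ENNReal.ofReal c * (M₁ (w - z) * M₂ w) := fun z w => by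
    have h := ENNReal.ofReal_le_ofReal (hs (WithLp.toLp 2 z) (WithLp.toLp 2 w))
    rw [ENNReal.ofReal_mul hc, ENNReal.ofReal_mul (vWeight_pos _ _).le] at h
    refine (mul_le_mul_right h _).trans ?_
    refine le_trans (le_of_eq ?_) (mul_le_mul_right (mul_le_mul' (bM₁ (w - z)) (bM₂ w)) _)
    unfold phaseWeight
    have e1 : (WithLp.toLp 2 w : Phase V) - WithLp.toLp 2 z
      = WithLp.toLp 2 ((w - z).1, (w - z).2) := rfl
    rw [e1]
    ring
  calc amalgamNorm G p q (vWeight s) (phaseD e f₂ f₁)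
      ≤ C₀ * amalgamNorm (crossWindow e g₂ g₁) p q (vWeight s) (phaseD e f₂ f₁) := h₀ _
    _ ≤ C₀ * (ENNReal.ofReal c * eLpNorm (fun z => eLpNorm (fun w => M₁ (w - z) * M₂ w) p
          ((volume : Measure V).prod volume)) q ((volume : Measure V).prod volume)) := by
        rw [amalgamNorm_phaseD he hg₂ hg₁ p q (continuous_vWeight s).measurable f₂ f₁,
          ← eLpNorm_ennreal_const_mul ENNReal.ofReal_ne_top]
        refine mul_le_mul_right (eLpNorm_ennreal_mono q fun z => ?_) _
        rw [← eLpNorm_ennreal_mul_const ENNReal.ofReal_ne_top,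
          ← eLpNorm_ennreal_const_mul ENNReal.ofReal_ne_top]
        exact eLpNorm_ennreal_mono p fun w => hpt z w
    _ ≤ C₀ * (ENNReal.ofReal c * (K * ((C₁ * modNorm g₁ p₁ q₁ (phaseWeight s₁) f₁) *
          (C₂ * modNorm g₂ p₂ q₂ (phaseWeight s₂) f₂)))) := by
        refine mul_le_mul_right (mul_le_mul_right ((h₃ M₁ M₂ mM₁ mM₂ sM₁ sM₂).trans ?_) _) _
        exact mul_le_mul_right (mul_le_mul' nM₁ nM₂) _
    _ = _ := by ring

end Windows

/-! ### Sums of functions with disjoint supports -/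

section Separated

/-- The exponent `(p⁻¹).toReal` is 1/p for finite p and 0 for p = ∞, so both cases have one formula;
for p = ∞ positivity of the measure is what counts. -/
theorem le_eLpNorm_of_le_on {α : Type*} [MeasurableSpace α] {μ : Measure α} {f : α → ℝ≥0∞}
    {c : ℝ≥0∞} {S : Set α} (hS : MeasurableSet S) (hμ : μ S ≠ 0) {p : ℝ≥0∞} (hp : p ≠ 0)
    (h : ∀ x ∈ S, c ≤ f x) : c * μ S ^ (p⁻¹).toReal ≤ eLpNorm f p μ := by
  have h1 := eLpNorm_indicator_const' (c := c) hS hμ hp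
  rw [enorm_eq_self, one_div, ← ENNReal.toReal_inv] at h1
  rw [← h1]
  refine eLpNorm_ennreal_mono p fun x => ?_
  by_cases hx : x ∈ S
  · rw [Set.indicator_of_mem hx]; exact h x hx
  · rw [Set.indicator_of_notMem hx]; exact zero_le

variable {W : Type*} [NormedAddCommGroup W] [NormedSpace ℝ W]

/-- The translates of `a` by multiples of `u` have disjoint supports. -/
def IsSeparated (u : W) (a : W → ℝ≥0∞) : Prop :=
  ∀ (w : W) (k j : ℕ), a (w - (k : ℝ) • u) ≠ 0 → a (w - (j : ℝ) • u) ≠ 0 → k = j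

theorem IsSeparated.sum_eq {u : W} {a : W → ℝ≥0∞} (h : IsSeparated u a) (L : ℕ) (w : W)
    {k : ℕ} (hk : k ∈ Finset.range L) (hkw : a (w - (k : ℝ) • u) ≠ 0) :
    ∑ j ∈ Finset.range L, a (w - (j : ℝ) • u) = a (w - (k : ℝ) • u) := by
  refine Finset.sum_eq_single_of_mem k hk fun j _ hj => ?_
  by_contra hne
  exact hj (h w j k hne hkw)

variable [MeasurableSpace W] [BorelSpace W] (κ : Measure W) [κ.IsAddRightInvariant]

/-- At each point at most one summand is nonzero, so the r-th power of the sum is at most the sum of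
the r-th powers; for r = ∞ the sum is bounded by the supremum of one translate. -/
theorem eLpNorm_separated_sum_le {u : W} {a : W → ℝ≥0∞} (ha : Measurable a)
    (h : IsSeparated u a) {r : ℝ≥0∞} (hr : r ≠ 0) (L : ℕ) :
    eLpNorm (fun w => ∑ k ∈ Finset.range L, a (w - (k : ℝ) • u)) r κ
      ≤ (L : ℝ≥0∞) ^ (r⁻¹).toReal * eLpNorm a r κ := by
  have htr : ∀ k : ℕ, MeasurePreserving (fun w => w - (k : ℝ) • u) κ κ := fun k =>
    measurePreserving_sub_right κ _
  have hcases : ∀ w, (∑ k ∈ Finset.range L, a (w - (k : ℝ) • u) = 0) ∨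
      ∃ k ∈ Finset.range L, ∑ j ∈ Finset.range L, a (w - (j : ℝ) • u) = a (w - (k : ℝ) • u) := by
    intro w
    by_cases hw : ∃ k ∈ Finset.range L, a (w - (k : ℝ) • u) ≠ 0
    · obtain ⟨k, hk, hkw⟩ := hw
      exact Or.inr ⟨k, hk, h.sum_eq L w hk hkw⟩
    · push Not at hw
      exact Or.inl (Finset.sum_eq_zero hw)
  rcases eq_or_ne r ⊤ with rfl | ht
  · simp only [ENNReal.inv_top, ENNReal.toReal_zero, ENNReal.rpow_zero, one_mul]
    refine eLpNorm_top_le ?_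
    have h1 : ∀ k : ℕ, ∀ᵐ w ∂κ, a (w - (k : ℝ) • u) ≤ eLpNorm a ⊤ κ := fun k =>
      (htr k).quasiMeasurePreserving.ae (ae_le_eLpNorm_top a)
    filter_upwards [ae_all_iff.2 h1] with w hw
    rcases hcases w with h0 | ⟨k, -, hk⟩
    · rw [h0]; exact zero_le
    · rw [hk]; exact hw k
  have hr' := ENNReal.toReal_pos hr ht
  rw [eLpNorm_ennreal hr ht, eLpNorm_ennreal hr ht, ENNReal.toReal_inv, ← one_div,
    ← ENNReal.mul_rpow_of_nonneg _ _ (by positivity)]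
  refine ENNReal.rpow_le_rpow ?_ (by positivity)
  calc ∫⁻ w, (∑ k ∈ Finset.range L, a (w - (k : ℝ) • u)) ^ r.toReal ∂κ
      ≤ ∫⁻ w, ∑ k ∈ Finset.range L, a (w - (k : ℝ) • u) ^ r.toReal ∂κ := by
        refine lintegral_mono fun w => ?_
        rcases hcases w with h0 | ⟨k, hk, hkw⟩
        · simp only [h0]
          rw [ENNReal.zero_rpow_of_pos hr']; exact zero_le
        · simp only [hkw]
          exact Finset.single_le_sum (f := fun k : ℕ => a (w - (k : ℝ) • u) ^ r.toReal)
            (fun _ _ => zero_le) hk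
    _ = ∑ k ∈ Finset.range L, ∫⁻ w, a w ^ r.toReal ∂κ := by
        have hm : ∀ k ∈ Finset.range L, Measurable fun w => a (w - (k : ℝ) • u) ^ r.toReal :=
          fun k _ => (ha.comp (measurable_id.sub_const _)).pow_const _
        rw [lintegral_finsetSum _ hm]
        exact Finset.sum_congr rfl fun k _ => (htr k).lintegral_comp (ha.pow_const _)
    _ = _ := by simp

end Separated

/-! ### Lower bounds and the extraction of exponent inequalities -/

section Lower

variable {W : Type*} [NormedAddCommGroup W] [NormedSpace ℝ W] [MeasurableSpace W] [BorelSpace W]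
  (κ : Measure W) [κ.IsAddHaarMeasure] [κ.IsNegInvariant]

theorem measure_biUnion_ball {u : W} {δ : ℝ}
    (hd : ∀ k j : ℕ, k ≠ j → Disjoint (Metric.ball ((k : ℝ) • u) δ) (Metric.ball ((j : ℝ) • u) δ))
    (M : ℕ) : κ (⋃ k ∈ Finset.range M, Metric.ball ((k : ℝ) • u) δ) = M * κ (Metric.ball 0 δ) := by
  rw [measure_biUnion_finset (fun k _ j _ hkj => hd k j hkj) fun _ _ => measurableSet_ball]
  simp [Measure.addHaar_ball_center]

/-- For w near k u with k < M and -z near j u with j < J, the point w - z is near (k+j) u with k + j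
< J + M, so both factors are at least c. Such w and z fill sets of measure M and J times that of a
ball. -/
theorem le_eLpNorm_translates {u : W} {δ : ℝ} (hδ : 0 < δ) {F : ℕ → W → ℝ≥0∞} {c : ℝ≥0∞}
    (hF : ∀ (L k : ℕ) (w : W), k < L → ‖w - (k : ℝ) • u‖ < 2 * δ → c ≤ F L w)
    (hd : ∀ k j : ℕ, k ≠ j → Disjoint (Metric.ball ((k : ℝ) • u) δ) (Metric.ball ((j : ℝ) • u) δ))
    {p q : ℝ≥0∞} (hp : p ≠ 0) (hq : q ≠ 0) {J M : ℕ} (hJ : J ≠ 0) (hM : M ≠ 0) :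
    c * c * (M * κ (Metric.ball 0 δ)) ^ (p⁻¹).toReal * (J * κ (Metric.ball 0 δ)) ^ (q⁻¹).toReal
      ≤ eLpNorm (fun z => eLpNorm (fun w => F (J + M) (w - z) * F M w) p κ) q κ := by
  have hb : κ (Metric.ball 0 δ) ≠ 0 := (Metric.measure_ball_pos κ 0 hδ).ne'
  set S : ℕ → Set W := fun M => ⋃ k ∈ Finset.range M, Metric.ball ((k : ℝ) • u) δ with hS
  have hSm : ∀ M, MeasurableSet (S M) := fun M =>
    Finset.measurableSet_biUnion _ fun _ _ => measurableSet_ball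
  have hSκ : ∀ M, κ (S M) = M * κ (Metric.ball 0 δ) := measure_biUnion_ball κ hd
  have hS0 : ∀ M : ℕ, M ≠ 0 → κ (S M) ≠ 0 := fun M hM => by
    rw [hSκ]; exact mul_ne_zero (Nat.cast_ne_zero.2 hM) hb
  have hT : κ (Neg.neg ⁻¹' S J) = κ (S J) := Measure.measure_preimage_neg κ (S J)
  rw [← hSκ, ← hSκ, ← hT]
  refine le_eLpNorm_of_le_on (measurable_neg (hSm J)) (by rw [hT]; exact hS0 J hJ) hq
    fun z hz => ?_
  refine le_eLpNorm_of_le_on (hSm M) (hS0 M hM) hp fun w hw => ?_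
  simp only [hS, Set.mem_preimage, Set.mem_iUnion, Finset.mem_range, Metric.mem_ball,
    dist_eq_norm, exists_prop] at hz hw
  obtain ⟨j, hj, hjz⟩ := hz
  obtain ⟨k, hk, hkw⟩ := hw
  refine mul_le_mul' (hF _ (k + j) _ (by omega) ?_) (hF _ k _ hk (by linarith))
  have e : w - z - ((k + j : ℕ) : ℝ) • u = (w - (k : ℝ) • u) + (-z - (j : ℝ) • u) := by
    push_cast; module
  rw [e]
  -- Two errors below δ add up, which is why the lower bound on F is required at distance 2δ.
  exact (norm_add_le _ _).trans_lt (by linarith)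

/-- Exponents can be compared if powers of all positive integers can. -/
theorem exponent_le_of_rpow_le {a b : ℝ≥0∞} (ha : a ≠ 0) (hb : b ≠ ⊤) {s r : ℝ}
    (h : ∀ K : ℕ, K ≠ 0 → a * (K : ℝ≥0∞) ^ s ≤ b * (K : ℝ≥0∞) ^ r) : s ≤ r := by
  by_contra! hlt
  have hab : a ≤ b := by simpa using h 1 one_ne_zero
  have hat : a ≠ ⊤ := ne_top_of_le_ne_top hb hab
  have h1 : ∀ K : ℕ, K ≠ 0 → (K : ℝ) ^ (s - r) ≤ b.toReal / a.toReal := fun K hK => by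
    have hK' : (0 : ℝ) < K := by positivity
    have hne : (K : ℝ≥0∞) ≠ 0 := Nat.cast_ne_zero.2 hK
    have ht : b * (K : ℝ≥0∞) ^ r ≠ ⊤ := ENNReal.mul_ne_top hb
      (ENNReal.rpow_ne_top_of_ne_zero hne (ENNReal.natCast_ne_top K))
    have h2 := ENNReal.toReal_mono ht (h K hK)
    rw [ENNReal.toReal_mul, ENNReal.toReal_mul, ← ENNReal.toReal_rpow, ← ENNReal.toReal_rpow,
      ENNReal.toReal_natCast] at h2
    rw [le_div_iff₀ (ENNReal.toReal_pos ha hat), Real.rpow_sub hK', div_mul_eq_mul_div,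
      div_le_iff₀ (by positivity)]
    linarith
  have h2 := (tendsto_rpow_atTop (sub_pos.2 hlt)).comp (tendsto_natCast_atTop_atTop (R := ℝ))
  obtain ⟨K, hK1, hK2⟩ := ((h2.eventually_gt_atTop (b.toReal / a.toReal)).and
    (Filter.eventually_ne_atTop 0)).exists
  exact absurd (h1 K hK2) (not_le.2 hK1)

variable [ProperSpace W]

/-- With L = J + M the lower bound grows like M^{1/p} J^{1/q}. Keeping M = 1 and letting J grow
isolates r₁; taking J = M gives the sum. In both cases J + M ≤ 2J, hence the factor 2^{r₁}. -/
theorem exponents_of_conv_bound {u : W} {δ : ℝ} (hδ : 0 < δ) {F : ℕ → W → ℝ≥0∞} {c : ℝ≥0∞}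
    (hc : c ≠ 0) (hF : ∀ (L k : ℕ) (w : W), k < L → ‖w - (k : ℝ) • u‖ < 2 * δ → c ≤ F L w)
    (hd : ∀ k j : ℕ, k ≠ j → Disjoint (Metric.ball ((k : ℝ) • u) δ) (Metric.ball ((j : ℝ) • u) δ))
    {p q : ℝ≥0∞} (hp : p ≠ 0) (hq : q ≠ 0) {r₁ r₂ : ℝ} (hr₁ : 0 ≤ r₁) {D : ℝ≥0∞} (hD : D ≠ ⊤)
    (h : ∀ L M : ℕ, eLpNorm (fun z => eLpNorm (fun w => F L (w - z) * F M w) p κ) q κ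
      ≤ D * ((L : ℝ≥0∞) ^ r₁ * (M : ℝ≥0∞) ^ r₂)) :
    (q⁻¹).toReal ≤ r₁ ∧ (p⁻¹).toReal + (q⁻¹).toReal ≤ r₁ + r₂ := by
  set b := κ (Metric.ball 0 δ) with hb'
  have hb : b ≠ 0 := (Metric.measure_ball_pos κ 0 hδ).ne'
  have hbt : b ≠ ⊤ := measure_ball_lt_top.ne
  set a := c * c * b ^ (p⁻¹).toReal * b ^ (q⁻¹).toReal with ha'
  have ha : a ≠ 0 := by
    have h1 : ∀ r : ℝ, b ^ r ≠ 0 := fun r => (ENNReal.rpow_pos (pos_iff_ne_zero.2 hb) hbt).ne'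
    exact mul_ne_zero (mul_ne_zero (mul_ne_zero hc hc) (h1 _)) (h1 _)
  have h2 : D * 2 ^ r₁ ≠ ⊤ := ENNReal.mul_ne_top hD (ENNReal.rpow_ne_top_of_nonneg hr₁ (by simp))
  have key : ∀ J M : ℕ, J ≠ 0 → M ≠ 0 → a * ((M : ℝ≥0∞) ^ (p⁻¹).toReal * (J : ℝ≥0∞) ^ (q⁻¹).toReal)
      ≤ D * (((J + M : ℕ) : ℝ≥0∞) ^ r₁ * (M : ℝ≥0∞) ^ r₂) := fun J M hJ hM => by
    refine le_trans (le_of_eq ?_) ((le_eLpNorm_translates κ hδ hF hd hp hq hJ hM).trans (h _ _))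
    rw [ENNReal.mul_rpow_of_nonneg _ _ ENNReal.toReal_nonneg,
      ENNReal.mul_rpow_of_nonneg _ _ ENNReal.toReal_nonneg]
    ring
  have hle : ∀ J M : ℕ, M ≤ J → ((J + M : ℕ) : ℝ≥0∞) ^ r₁ ≤ 2 ^ r₁ * (J : ℝ≥0∞) ^ r₁ :=
    fun J M hMJ => by
      rw [← ENNReal.mul_rpow_of_nonneg _ _ hr₁]
      refine ENNReal.rpow_le_rpow ?_ hr₁
      exact_mod_cast (by omega : J + M ≤ 2 * J)
  constructor
  · refine exponent_le_of_rpow_le ha h2 fun K hK => ?_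
    have h3 := key K 1 hK one_ne_zero
    simp only [Nat.cast_one, ENNReal.one_rpow, one_mul, mul_one] at h3
    rw [mul_assoc D]
    exact h3.trans (mul_le_mul_right (hle K 1 (Nat.one_le_iff_ne_zero.2 hK)) D)
  · refine exponent_le_of_rpow_le ha h2 fun K hK => ?_
    have hK0 : (K : ℝ≥0∞) ≠ 0 := Nat.cast_ne_zero.2 hK
    rw [ENNReal.rpow_add _ _ hK0 (ENNReal.natCast_ne_top K),
      ENNReal.rpow_add _ _ hK0 (ENNReal.natCast_ne_top K)]
    refine (key K K hK hK).trans ?_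
    rw [mul_assoc, ← mul_assoc (2 ^ r₁)]
    exact mul_le_mul_right (mul_le_mul_left (hle K K le_rfl) _) D

end Lower

/-! ### Upper bounds for the mixed norms of separated sums -/

section Upper

variable {V : Type*} [NormedAddCommGroup V] [NormedSpace ℝ V] [MeasurableSpace V] [BorelSpace V]
  [SecondCountableTopology V] (κ : Measure V) [SFinite κ] [κ.IsAddRightInvariant]

theorem mixNorm_separated_fst_le {v : V} {φ : V × V → ℝ≥0∞} (hφ : Measurable φ)
    (h : ∀ ξ, IsSeparated v fun x => φ (x, ξ)) {p : ℝ≥0∞} (hp : p ≠ 0) (q : ℝ≥0∞) (L : ℕ) :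
    mixNorm κ p q (fun x ξ => ∑ k ∈ Finset.range L, φ ((x, ξ) - (k : ℝ) • (v, 0)))
      ≤ (L : ℝ≥0∞) ^ (p⁻¹).toReal * mixNorm κ p q (fun x ξ => φ (x, ξ)) := by
  unfold mixNorm
  rw [← eLpNorm_ennreal_const_mul
    (ENNReal.rpow_ne_top_of_nonneg ENNReal.toReal_nonneg (ENNReal.natCast_ne_top L))]
  refine eLpNorm_ennreal_mono q fun ξ => ?_
  have := eLpNorm_separated_sum_le κ (hφ.comp measurable_prodMk_right) (h ξ) hp L
  simpa [Function.comp_def] using this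

/-- Here the shift acts on the outer variable, so separation must be uniform in x: it is the inner
norms, as functions of ξ, whose supports must be disjoint. The triangle inequality in L^p takes the
sum out of the inner norm. -/
theorem mixNorm_separated_snd_le {v : V} {φ : V × V → ℝ≥0∞} (hφ : Measurable φ)
    (h : ∀ (ξ : V) (k j : ℕ), (∃ x, φ (x, ξ - (k : ℝ) • v) ≠ 0) →
      (∃ x, φ (x, ξ - (j : ℝ) • v) ≠ 0) → k = j)
    {p q : ℝ≥0∞} (hp : 1 ≤ p) (hq : q ≠ 0) (L : ℕ) :
    mixNorm κ p q (fun x ξ => ∑ k ∈ Finset.range L, φ ((x, ξ) - (k : ℝ) • (0, v)))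
      ≤ (L : ℝ≥0∞) ^ (q⁻¹).toReal * mixNorm κ p q (fun x ξ => φ (x, ξ)) := by
  unfold mixNorm
  set a : V → ℝ≥0∞ := fun ξ => eLpNorm (fun x => φ (x, ξ)) p κ with ha
  have ham : Measurable a := measurable_eLpNorm_left (f := fun x ξ => φ (x, ξ)) hφ p
  have hne : ∀ ξ, a ξ ≠ 0 → ∃ x, φ (x, ξ) ≠ 0 := fun ξ h0 => by
    by_contra! hc
    exact h0 (by simp [ha, hc])
  have hsep : IsSeparated v a := fun ξ k j hk hj => h ξ k j (hne _ hk) (hne _ hj)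
  refine le_trans (eLpNorm_ennreal_mono q fun ξ => ?_) (eLpNorm_separated_sum_le κ ham hsep hq L)
  have h1 := eLpNorm_sum_le (μ := κ) (p := p) (s := Finset.range L)
    (f := fun (k : ℕ) x => φ (x, ξ - (k : ℝ) • v))
    (fun k _ => (hφ.comp measurable_prodMk_right).aestronglyMeasurable) hp
  refine le_trans (le_of_eq ?_) h1
  congr 1
  ext x
  simp

end Upper

/-! ### Test functions and necessity of the index conditions -/

section TestFunctions

variable {V : Type} [NormedAddCommGroup V] [InnerProductSpace ℝ V] [FiniteDimensional ℝ V]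
  [MeasurableSpace V] [BorelSpace V]

/-- The modulus of the short-time Fourier transform of a Schwartz function. -/
noncomputable def absSTFT (γ f : 𝓢(V, ℂ)) (w : V × V) : ℝ≥0∞ :=
  ‖windowSTFT γ (ofSchwartz f) w.1 w.2‖ₑ

theorem measurable_absSTFT {γ : 𝓢(V, ℂ)} (hγ : γ ≠ 0) (f : 𝓢(V, ℂ)) : Measurable (absSTFT γ f) :=
  measurable_windowSTFT hγ _

theorem absSTFT_eq (γ f : 𝓢(V, ℂ)) (w : V × V) :
    absSTFT γ f w = ‖stftS γ f (WithLp.toLp 2 w)‖ₑ := by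
  rw [stftS_apply]; rfl

theorem absSTFT_tfShift (γ : 𝓢(V, ℂ)) (u w : V × V) :
    absSTFT γ (tfShift u.1 u.2 γ) w = absSTFT γ γ (w - u) := by
  rw [absSTFT_eq, absSTFT_eq, ← ofReal_norm, ← ofReal_norm, stftS_tfShift]
  rfl

theorem windowSTFT_ofSchwartz_sum (γ : 𝓢(V, ℂ)) {ι : Type*} (s : Finset ι) (f : ι → 𝓢(V, ℂ))
    (x ξ : V) : windowSTFT γ (ofSchwartz (∑ i ∈ s, f i)) x ξ
      = ∑ i ∈ s, windowSTFT γ (ofSchwartz (f i)) x ξ := by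
  have h : ∀ f : 𝓢(V, ℂ), windowSTFT γ (ofSchwartz f) x ξ
      = ofSchwartz (conjS (tfShift x ξ γ)) f := fun f => by
    rw [windowSTFT, ofSchwartz_apply, ofSchwartz_apply]
    simp_rw [mul_comm]
  simp_rw [h]
  exact map_sum _ _ _

/-- The sum of the time-frequency shifts of `γ` by `k u`, `0 ≤ k < L`. -/
noncomputable def shiftSum (γ : 𝓢(V, ℂ)) (u : V × V) (L : ℕ) : 𝓢(V, ℂ) :=
  ∑ k ∈ Finset.range L, tfShift ((k : ℝ) • u).1 ((k : ℝ) • u).2 γ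

theorem absSTFT_shiftSum_le (γ : 𝓢(V, ℂ)) (u : V × V) (L : ℕ) (w : V × V) :
    absSTFT γ (shiftSum γ u L) w ≤ ∑ k ∈ Finset.range L, absSTFT γ γ (w - (k : ℝ) • u) := by
  rw [absSTFT, shiftSum, windowSTFT_ofSchwartz_sum]
  refine (enorm_sum_le _ _).trans_eq (Finset.sum_congr rfl fun k _ => ?_)
  exact absSTFT_tfShift γ ((k : ℝ) • u) w

/-- Disjoint supports rule out cancellation between the shifts, so the modulus of the sum is that of
its one nonzero term. -/
theorem absSTFT_shiftSum_eq {γ : 𝓢(V, ℂ)} {u : V × V} (h : IsSeparated u (absSTFT γ γ))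
    {k L : ℕ} (hk : k < L) {w : V × V} (hw : absSTFT γ γ (w - (k : ℝ) • u) ≠ 0) :
    absSTFT γ (shiftSum γ u L) w = absSTFT γ γ (w - (k : ℝ) • u) := by
  rw [absSTFT, shiftSum, windowSTFT_ofSchwartz_sum, ← absSTFT_tfShift]
  rw [Finset.sum_eq_single_of_mem k (Finset.mem_range.2 hk)]
  · rfl
  intro j _ hj
  rw [← enorm_eq_zero]
  have := absSTFT_tfShift γ ((j : ℝ) • u) w
  rw [absSTFT] at this
  rw [this]
  by_contra hne
  exact hj (h w j k hne hw)

theorem exists_absSTFT_lower_bound {γ : 𝓢(V, ℂ)} (hγ : γ ≠ 0) :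
    ∃ (δ : ℝ) (c : ℝ≥0∞), 0 < δ ∧ c ≠ 0 ∧ ∀ w : V × V, ‖w‖ < 2 * δ → c ≤ absSTFT γ γ w := by
  have hc : Continuous (absSTFT γ γ) := ((continuous_windowSTFT hγ (ofSchwartz γ)).comp
    (WithLp.prodContinuousLinearEquiv 2 ℝ V V).symm.continuous).enorm
  have h0 : absSTFT γ γ 0 ≠ 0 := by
    rw [absSTFT_eq, enorm_ne_zero]
    have := stftS_self_ne_zero hγ 0 0
    rw [← norm_ne_zero_iff, stftS_tfShift, sub_self, norm_ne_zero_iff] at this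
    exact this
  obtain ⟨c, hc0, hc1⟩ := exists_between (pos_iff_ne_zero.2 h0)
  obtain ⟨ε, hε, hb⟩ := Metric.eventually_nhds_iff.1
    (hc.continuousAt.eventually (eventually_gt_nhds hc1))
  exact ⟨ε / 2, c, by positivity, hc0.ne', fun w hw => (hb (by rw [dist_zero_right]; linarith)).le⟩

theorem eLpNorm_decay_ne_top {N : ℝ} (hN0 : 0 ≤ N) (hN : ∫⁻ x : V, decay N x ≠ ⊤) {p : ℝ≥0∞}
    (hp : 1 ≤ p) : eLpNorm (decay N : V → ℝ≥0∞) p volume ≠ ⊤ := by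
  have h1 : ∀ x : V, decay N x ≤ 1 := fun x =>
    ENNReal.ofReal_le_one.2 (Real.rpow_le_one_of_one_le_of_nonpos
      (by linarith [norm_nonneg x]) (by linarith))
  rcases eq_or_ne p ⊤ with rfl | ht
  · exact ne_top_of_le_ne_top ENNReal.one_ne_top
      (eLpNorm_top_le (Filter.Eventually.of_forall h1))
  have h0 : p ≠ 0 := (zero_lt_one.trans_le hp).ne'
  rw [eLpNorm_ennreal h0 ht]
  refine ENNReal.rpow_ne_top_of_nonneg (by positivity) (ne_top_of_le_ne_top hN ?_)
  refine lintegral_mono fun x => ?_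
  have hp' : 1 ≤ p.toReal := by simpa using ENNReal.toReal_mono ht hp
  simpa using ENNReal.rpow_le_rpow_of_exponent_ge (h1 x) hp'

theorem mixNorm_absSTFT_ne_top (γ f : 𝓢(V, ℂ)) {p q : ℝ≥0∞} (hp : 1 ≤ p) (hq : 1 ≤ q) :
    mixNorm volume p q (fun x ξ => absSTFT γ f (x, ξ)) ≠ ⊤ := by
  set N : ℕ := Module.finrank ℝ V + 1
  obtain ⟨C, hC, h⟩ := exists_decay_bound (stftS γ f) N
  have hD : ∀ {r : ℝ≥0∞}, 1 ≤ r → eLpNorm (decay (N : ℝ) : V → ℝ≥0∞) r volume ≠ ⊤ :=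
    eLpNorm_decay_ne_top (Nat.cast_nonneg N) lintegral_decay_finrank_ne_top
  have h1 : mixNorm volume p q (fun x ξ : V => C * (decay (N : ℝ) x * decay (N : ℝ) ξ)) =
      C * (eLpNorm (decay (N : ℝ) : V → ℝ≥0∞) p volume *
        eLpNorm (decay (N : ℝ) : V → ℝ≥0∞) q volume) := by
    rw [mixNorm_const_mul hC, mixNorm]
    simp_rw [eLpNorm_ennreal_mul_const (decay_ne_top _ _)]
    rw [eLpNorm_ennreal_const_mul (hD hp)]
  refine ne_top_of_le_ne_top (ENNReal.mul_ne_top hC (ENNReal.mul_ne_top (hD hp) (hD hq)))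
    (le_trans (mixNorm_mono p q fun x ξ => ?_) h1.le)
  rw [absSTFT_eq]
  exact h _

/-- Translate w by z and replace z by -z. This exchanges the two factors, so a conclusion about the
first exponent also yields one about the second. -/
theorem convNorm_symm (p q : ℝ≥0∞) {A B : V × V → ℝ≥0∞} (hA : Measurable A) (hB : Measurable B) :
    convNorm p q (fun _ => 1) A B = convNorm p q (fun _ => 1) B A := by
  have : (volume : Measure (V × V)).IsAddHaarMeasure := by
    rw [Measure.volume_eq_prod]; infer_instance
  simp only [convNorm, mul_one]
  have h1 : ∀ z, eLpNorm (fun w => A (w - z) * B w) p volume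
      = eLpNorm (fun w => B (w - -z) * A w) p volume := fun z => by
    have hm : Measurable (fun w => B (w - -z) * A w) :=
      (hB.comp (measurable_id.sub_const _)).mul hA
    rw [← eLpNorm_sub_right hm p z]
    congr 1
    ext w
    rw [sub_sub, add_neg_cancel, sub_zero, mul_comm]
  simp_rw [h1]
  have hm : Measurable (Function.uncurry fun (z w : V × V) => B (w - z) * A w) := by
    have hsub : Measurable (fun z : (V × V) × (V × V) => z.2 - z.1) := by fun_prop
    exact (hB.comp hsub).mul (hA.comp measurable_snd)
  exact eLpNorm_comp_measurePreserving (measurable_eLpNorm_right hm p).aestronglyMeasurable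
    (Measure.measurePreserving_neg volume)

/-- The growth rates r₁ and r₂ are left abstract: they become 1/p₁, 1/p₂ for shifts in time and
1/q₁, 1/q₂ for shifts in frequency. -/
theorem exponent_add_le_of_convNorm_le {γ : 𝓢(V, ℂ)} (hγ : γ ≠ 0) {u : V × V}
    (hu : IsSeparated u (absSTFT γ γ)) {p₁ q₁ p₂ q₂ p q : ℝ≥0∞}
    (hp₁ : 1 ≤ p₁) (hq₁ : 1 ≤ q₁) (hp₂ : 1 ≤ p₂) (hq₂ : 1 ≤ q₂) (hp : 1 ≤ p) (hq : 1 ≤ q)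
    {C : ℝ≥0∞} (hC : C ≠ ⊤)
    (h : ∀ f₁ f₂ : 𝓢(V, ℂ), convNorm p q (fun _ => 1) (absSTFT γ f₁) (absSTFT γ f₂) ≤
      C * (mixNorm volume p₁ q₁ (fun x ξ => absSTFT γ f₁ (x, ξ)) *
        mixNorm volume p₂ q₂ (fun x ξ => absSTFT γ f₂ (x, ξ)))) {r₁ r₂ : ℝ} (hr₁ : 0 ≤ r₁)
    (h₁ : ∀ L : ℕ, mixNorm volume p₁ q₁ (fun x ξ => ∑ k ∈ Finset.range L,
      absSTFT γ γ ((x, ξ) - (k : ℝ) • u)) ≤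
        (L : ℝ≥0∞) ^ r₁ * mixNorm volume p₁ q₁ (fun x ξ => absSTFT γ γ (x, ξ)))
    (h₂ : ∀ L : ℕ, mixNorm volume p₂ q₂ (fun x ξ => ∑ k ∈ Finset.range L,
      absSTFT γ γ ((x, ξ) - (k : ℝ) • u)) ≤
        (L : ℝ≥0∞) ^ r₂ * mixNorm volume p₂ q₂ (fun x ξ => absSTFT γ γ (x, ξ))) :
    (q⁻¹).toReal ≤ r₁ ∧ (p⁻¹).toReal + (q⁻¹).toReal ≤ r₁ + r₂ := by
  have : (volume : Measure (V × V)).IsAddHaarMeasure := by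
    rw [Measure.volume_eq_prod]; infer_instance
  obtain ⟨δ, c, hδ, hc, hφ⟩ := exists_absSTFT_lower_bound hγ
  have hpos : ∀ w : V × V, ‖w‖ < 2 * δ → absSTFT γ γ w ≠ 0 := fun w hw h0 =>
    hc (le_zero_iff.1 (h0 ▸ hφ w hw))
  refine exponents_of_conv_bound (volume : Measure (V × V)) (u := u) hδ hc
    (F := fun L => absSTFT γ (shiftSum γ u L)) (fun L k w hk hw => ?_) (fun k j hkj => ?_)
    (zero_lt_one.trans_le hp).ne' (zero_lt_one.trans_le hq).ne' hr₁
    (D := C * (mixNorm volume p₁ q₁ (fun x ξ => absSTFT γ γ (x, ξ)) *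
      mixNorm volume p₂ q₂ (fun x ξ => absSTFT γ γ (x, ξ))))
    (ENNReal.mul_ne_top hC (ENNReal.mul_ne_top (mixNorm_absSTFT_ne_top γ γ hp₁ hq₁)
      (mixNorm_absSTFT_ne_top γ γ hp₂ hq₂))) fun L M => ?_
  · rw [absSTFT_shiftSum_eq hu hk (hpos _ hw)]
    exact hφ _ hw
  · refine Set.disjoint_left.2 fun w hw hw' => hkj (hu w k j ?_ ?_)
    · rw [Metric.mem_ball, dist_eq_norm] at hw
      exact hpos _ (by linarith)
    · rw [Metric.mem_ball, dist_eq_norm] at hw'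
      exact hpos _ (by linarith)
  · have h3 := h (shiftSum γ u L) (shiftSum γ u M)
    simp only [convNorm, mul_one] at h3
    refine h3.trans ?_
    have h4 := (mixNorm_mono (μ := volume) p₁ q₁
      fun x ξ => absSTFT_shiftSum_le γ u L (x, ξ)).trans (h₁ L)
    have h5 := (mixNorm_mono (μ := volume) p₂ q₂
      fun x ξ => absSTFT_shiftSum_le γ u M (x, ξ)).trans (h₂ M)
    refine (mul_le_mul_right (mul_le_mul' h4 h5) C).trans_eq ?_
    ring

theorem exponents_of_convNorm_le {γ : 𝓢(V, ℂ)} (hγ : γ ≠ 0) {u : V × V}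
    (hu : IsSeparated u (absSTFT γ γ)) {p₁ q₁ p₂ q₂ p q : ℝ≥0∞}
    (hp₁ : 1 ≤ p₁) (hq₁ : 1 ≤ q₁) (hp₂ : 1 ≤ p₂) (hq₂ : 1 ≤ q₂) (hp : 1 ≤ p) (hq : 1 ≤ q)
    {C : ℝ≥0∞} (hC : C ≠ ⊤)
    (h : ∀ f₁ f₂ : 𝓢(V, ℂ), convNorm p q (fun _ => 1) (absSTFT γ f₁) (absSTFT γ f₂) ≤
      C * (mixNorm volume p₁ q₁ (fun x ξ => absSTFT γ f₁ (x, ξ)) *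
        mixNorm volume p₂ q₂ (fun x ξ => absSTFT γ f₂ (x, ξ)))) {r₁ r₂ : ℝ≥0∞}
    (hr₁ : 1 ≤ r₁) (hr₂ : 1 ≤ r₂)
    (h₁ : ∀ L : ℕ, mixNorm volume p₁ q₁ (fun x ξ => ∑ k ∈ Finset.range L,
      absSTFT γ γ ((x, ξ) - (k : ℝ) • u)) ≤
        (L : ℝ≥0∞) ^ (r₁⁻¹).toReal * mixNorm volume p₁ q₁ (fun x ξ => absSTFT γ γ (x, ξ)))
    (h₂ : ∀ L : ℕ, mixNorm volume p₂ q₂ (fun x ξ => ∑ k ∈ Finset.range L,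
      absSTFT γ γ ((x, ξ) - (k : ℝ) • u)) ≤
        (L : ℝ≥0∞) ^ (r₂⁻¹).toReal * mixNorm volume p₂ q₂ (fun x ξ => absSTFT γ γ (x, ξ))) :
    r₁ ≤ q ∧ r₂ ≤ q ∧ p⁻¹ + q⁻¹ ≤ r₁⁻¹ + r₂⁻¹ := by
  obtain ⟨k1, k2⟩ := exponent_add_le_of_convNorm_le hγ hu hp₁ hq₁ hp₂ hq₂ hp hq hC h
    ENNReal.toReal_nonneg h₁ h₂
  obtain ⟨k3, -⟩ := exponent_add_le_of_convNorm_le hγ hu hp₂ hq₂ hp₁ hq₁ hp hq hC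
    (fun f₁ f₂ => by
      rw [convNorm_symm p q (measurable_absSTFT hγ f₁) (measurable_absSTFT hγ f₂),
        mul_comm (mixNorm _ p₂ q₂ _)]
      exact h f₂ f₁) ENNReal.toReal_nonneg h₂ h₁
  have ht : ∀ {r : ℝ≥0∞}, 1 ≤ r → r⁻¹ ≠ ⊤ := fun hr =>
    ENNReal.inv_ne_top.2 (zero_lt_one.trans_le hr).ne'
  refine ⟨ENNReal.inv_le_inv.1 ((ENNReal.toReal_le_toReal (ht hq) (ht hr₁)).1 k1),
    ENNReal.inv_le_inv.1 ((ENNReal.toReal_le_toReal (ht hq) (ht hr₂)).1 k3), ?_⟩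
  rw [← ENNReal.toReal_add (ht hp) (ht hq), ← ENNReal.toReal_add (ht hr₁) (ht hr₂)] at k2
  exact (ENNReal.toReal_le_toReal (ENNReal.add_ne_top.2 ⟨ht hp, ht hq⟩)
    (ENNReal.add_ne_top.2 ⟨ht hr₁, ht hr₂⟩)).1 k2

theorem exists_bump : ∃ β : 𝓢(V, ℂ), β ≠ 0 ∧ ∀ t, β t ≠ 0 → ‖t‖ < 2 := by
  let f : ContDiffBump (0 : V) := ⟨1, 2, one_pos, one_lt_two⟩
  have hc : HasCompactSupport (fun t : V => ((f t : ℝ) : ℂ)) :=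
    f.hasCompactSupport.comp_left (g := fun r : ℝ => (r : ℂ)) Complex.ofReal_zero
  refine ⟨hc.toSchwartzMap (Complex.ofRealCLM.contDiff.comp f.contDiff), fun h0 => ?_,
    fun t ht => ?_⟩
  · have h1 : ((f 0 : ℝ) : ℂ) = 0 := congrArg (fun φ : 𝓢(V, ℂ) => φ 0) h0
    rw [f.one_of_mem_closedBall (Metric.mem_closedBall_self f.rIn_pos.le)] at h1
    simp at h1
  · have h1 : ((f t : ℝ) : ℂ) ≠ 0 := ht
    have h2 : t ∈ Function.support f := by simpa using h1
    rw [f.support_eq] at h2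
    simpa using h2

/-- The integrand contains β(t) conj β(t - x), which vanishes for every t once x exceeds twice the
support radius 2. -/
theorem exists_window_compact_time : ∃ γ : 𝓢(V, ℂ), γ ≠ 0 ∧
    ∀ w : V × V, absSTFT γ γ w ≠ 0 → ‖w.1‖ < 4 := by
  obtain ⟨β, hβ, hs⟩ := exists_bump (V := V)
  refine ⟨β, hβ, fun w => ?_⟩
  contrapose!
  intro hw
  rw [absSTFT, enorm_eq_zero, windowSTFT_eq_chi]
  refine integral_eq_zero_of_ae (Filter.Eventually.of_forall fun t => ?_)
  by_contra hne
  simp only [Pi.zero_apply, mul_eq_zero, not_or, map_eq_zero] at hne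
  have h1 := hs _ hne.1.1
  have h2 := hs _ hne.1.2
  have h3 := norm_sub_norm_le w.1 t
  rw [norm_sub_rev] at h3
  linarith

theorem fourier_tfShift (x ξ η : V) (γ : 𝓢(V, ℂ)) :
    𝓕 (tfShift x ξ γ) η = chi ⟪ξ - η, x⟫_ℝ * 𝓕 γ (η - ξ) := by
  rw [SchwartzMap.fourier_coe, SchwartzMap.fourier_coe, Real.fourier_eq', Real.fourier_eq',
    ← integral_add_right_eq_self _ x, ← integral_const_mul]
  have e : ∀ (t η : V), Complex.exp ((((-2 * Real.pi * ⟪t, η⟫_ℝ : ℝ)) : ℂ) * Complex.I)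
      = chi (-⟪t, η⟫_ℝ) := fun t η => by
    rw [chi]; congr 1; push_cast; ring
  refine integral_congr_ae (Filter.Eventually.of_forall fun t => ?_)
  simp only [e, smul_eq_mul, tfShift_eq_chi, add_sub_cancel_right]
  rw [← mul_assoc, ← mul_assoc, ← chi_add, ← chi_add]
  congr 2
  simp only [inner_add_left, inner_add_right, inner_sub_left, inner_sub_right,
    real_inner_comm ξ t, real_inner_comm η x]
  ring

/-- By Parseval the overlap can be computed on the Fourier side, where the window is a bump function
and the modulation by w₂ is a translation. -/
theorem exists_window_compact_frequency : ∃ γ : 𝓢(V, ℂ), γ ≠ 0 ∧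
    ∀ w : V × V, absSTFT γ γ w ≠ 0 → ‖w.2‖ < 4 := by
  obtain ⟨β, hβ, hs⟩ := exists_bump (V := V)
  have hF : 𝓕 (𝓕⁻ β) = β := FourierTransform.fourier_fourierInv_eq _
  refine ⟨𝓕⁻ β, fun h0 => hβ ?_, fun w => ?_⟩
  · rw [← hF, h0]
    exact map_zero (FourierTransform.fourierCLM ℂ 𝓢(V, ℂ))
  contrapose!
  intro hw
  have h1 : windowSTFT (𝓕⁻ β) (ofSchwartz (𝓕⁻ β)) w.1 w.2
      = ∫ t, inner ℂ (tfShift w.1 w.2 (𝓕⁻ β) t) ((𝓕⁻ β) t) := by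
    rw [windowSTFT, ofSchwartz_apply]
    refine integral_congr_ae (Filter.Eventually.of_forall fun t => ?_)
    simp [mul_comm]
  rw [absSTFT, enorm_eq_zero, h1, ← SchwartzMap.integral_inner_fourier_fourier]
  refine integral_eq_zero_of_ae (Filter.Eventually.of_forall fun η => ?_)
  simp only [fourier_tfShift, hF]
  by_contra hne
  simp only [RCLike.inner_apply, Pi.zero_apply, mul_eq_zero, not_or, map_mul, map_eq_zero] at hne
  have h2 := hs _ hne.1
  have h3 := hs _ hne.2.2
  have h4 := norm_sub_norm_le w.2 η
  rw [norm_sub_rev] at h4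
  linarith

theorem eq_of_norm_sub_smul_lt {v : V} (hv : ‖v‖ = 8) {x : V} {k j : ℕ}
    (hk : ‖x - (k : ℝ) • v‖ < 4) (hj : ‖x - (j : ℝ) • v‖ < 4) : k = j := by
  have h1 : ‖((k : ℝ) - j) • v‖ < 8 := by
    have : ((k : ℝ) - j) • v = (x - (j : ℝ) • v) - (x - (k : ℝ) • v) := by module
    rw [this]
    exact (norm_sub_le _ _).trans_lt (by linarith)
  rw [norm_smul, hv, Real.norm_eq_abs] at h1
  have h2 : |((k : ℤ) - j : ℤ)| < 1 := by
    have : |(k : ℝ) - j| < 1 := by linarith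
    exact_mod_cast this
  have := Int.abs_lt_one_iff.1 h2
  omega

/-- Shifts by multiples of a vector of norm 8 separate supports of radius 4. Shifts in time give the
conditions on p₁, p₂ and shifts in frequency those on q₁, q₂; each needs its own window, since
supports are confined in one variable only. -/
theorem indexCondition_of_convNorm_le [Nontrivial V] {p₁ q₁ p₂ q₂ p q : ℝ≥0∞}
    (hp₁ : 1 ≤ p₁) (hq₁ : 1 ≤ q₁) (hp₂ : 1 ≤ p₂) (hq₂ : 1 ≤ q₂) (hp : 1 ≤ p) (hq : 1 ≤ q)
    (h : ∀ γ : 𝓢(V, ℂ), γ ≠ 0 → ∃ C : ℝ≥0∞, C ≠ ⊤ ∧ ∀ f₁ f₂ : 𝓢(V, ℂ),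
      convNorm p q (fun _ => 1) (absSTFT γ f₁) (absSTFT γ f₂) ≤
        C * (mixNorm volume p₁ q₁ (fun x ξ => absSTFT γ f₁ (x, ξ)) *
          mixNorm volume p₂ q₂ (fun x ξ => absSTFT γ f₂ (x, ξ)))) :
    IndexCondition p₁ q₁ p₂ q₂ p q := by
  obtain ⟨v, hv⟩ := exists_norm_eq V (c := 8) (by norm_num)
  have h0 : ∀ {r : ℝ≥0∞}, 1 ≤ r → r ≠ 0 := fun hr => (zero_lt_one.trans_le hr).ne'
  obtain ⟨γ, hγ, hs⟩ := exists_window_compact_time (V := V)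
  obtain ⟨C, hC, hb⟩ := h γ hγ
  have hm := measurable_absSTFT hγ γ
  have time := exponents_of_convNorm_le hγ (u := (v, 0))
    (fun w k j hk hj => eq_of_norm_sub_smul_lt hv (hs _ hk) (hs _ hj))
    hp₁ hq₁ hp₂ hq₂ hp hq hC hb hp₁ hp₂
    (mixNorm_separated_fst_le volume hm
      (fun ξ x k j hk hj => eq_of_norm_sub_smul_lt hv (hs _ hk) (hs _ hj)) (h0 hp₁) q₁)
    (mixNorm_separated_fst_le volume hm
      (fun ξ x k j hk hj => eq_of_norm_sub_smul_lt hv (hs _ hk) (hs _ hj)) (h0 hp₂) q₂)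
  obtain ⟨γ', hγ', hs'⟩ := exists_window_compact_frequency (V := V)
  obtain ⟨C', hC', hb'⟩ := h γ' hγ'
  have hm' := measurable_absSTFT hγ' γ'
  have frequency := exponents_of_convNorm_le hγ' (u := (0, v))
    (fun w k j hk hj => eq_of_norm_sub_smul_lt hv (hs' _ hk) (hs' _ hj))
    hp₁ hq₁ hp₂ hq₂ hp hq hC' hb' hq₁ hq₂
    (mixNorm_separated_snd_le volume hm'
      (fun ξ k j ⟨_, hk⟩ ⟨_, hj⟩ => eq_of_norm_sub_smul_lt hv (hs' _ hk) (hs' _ hj)) hp₁ (h0 hq₁))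
    (mixNorm_separated_snd_le volume hm'
      (fun ξ k j ⟨_, hk⟩ ⟨_, hj⟩ => eq_of_norm_sub_smul_lt hv (hs' _ hk) (hs' _ hj)) hp₂ (h0 hq₂))
  exact ⟨⟨time.1, frequency.1, time.2.1, frequency.2.1⟩, time.2.2, frequency.2.2⟩

theorem vWeight_zero_eq : (vWeight 0 : V → ℝ) = fun _ => 1 := funext vWeight_zero

theorem phaseWeight_zero_eq : (phaseWeight 0 : V → V → ℝ) = fun _ _ => 1 :=
  funext fun _ => funext fun _ => vWeight_zero _

/-- Changing all three windows costs constants only, so a bound for the given windows yields one for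
every γ, with `crossWindow e γ γ` on phase space. -/
theorem indexCondition_of_phaseD_bound [Nontrivial V] {τ : ℝ} {e : (V × V) ≃L[ℝ] (V × V)}
    (he : IsPhaseChange τ e) {p₁ q₁ p₂ q₂ p q : ℝ≥0∞}
    (hp₁ : 1 ≤ p₁) (hq₁ : 1 ≤ q₁) (hp₂ : 1 ≤ p₂) (hq₂ : 1 ≤ q₂) (hp : 1 ≤ p) (hq : 1 ≤ q)
    (g₁ g₂ : 𝓢(V, ℂ)) {G : 𝓢(Phase V, ℂ)} (hG : G ≠ 0) {C : ℝ≥0∞} (hC : C ≠ ⊤)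
    (h : ∀ f₁ f₂ : 𝓢(V, ℂ),
      amalgamNorm G p q (fun _ => 1) (phaseD e (ofSchwartz f₂) (ofSchwartz f₁)) ≤
        C * (modNorm g₁ p₁ q₁ (fun _ _ => 1) (ofSchwartz f₁) *
          modNorm g₂ p₂ q₂ (fun _ _ => 1) (ofSchwartz f₂))) :
    IndexCondition p₁ q₁ p₂ q₂ p q := by
  refine indexCondition_of_convNorm_le (V := V) hp₁ hq₁ hp₂ hq₂ hp hq fun γ hγ => ?_
  obtain ⟨C₀, hC₀, h₀⟩ := exists_amalgamNorm_le hG (crossWindow e γ γ) hp hq 0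
  obtain ⟨C₁, hC₁, h₁⟩ := exists_modNorm_le hγ g₁ hp₁ hq₁ 0
  obtain ⟨C₂, hC₂, h₂⟩ := exists_modNorm_le hγ g₂ hp₂ hq₂ 0
  rw [vWeight_zero_eq] at h₀
  rw [phaseWeight_zero_eq] at h₁ h₂
  have hmod : ∀ (r s : ℝ≥0∞) (f : 𝓢(V, ℂ)), modNorm γ r s (fun _ _ => 1) (ofSchwartz f)
      = mixNorm volume r s (fun x ξ => absSTFT γ f (x, ξ)) := fun r s f => by
    rw [modNorm_eq_mixNorm γ r s (fun _ _ => zero_le_one)]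
    simp only [ENNReal.ofReal_one, one_mul]
    rfl
  refine ⟨C₀ * C * (C₁ * C₂), ENNReal.mul_ne_top (ENNReal.mul_ne_top hC₀ hC)
    (ENNReal.mul_ne_top hC₁ hC₂), fun f₁ f₂ => ?_⟩
  have h3 := amalgamNorm_phaseD he hγ hγ p q (ρ := fun _ => 1) measurable_const
    (ofSchwartz f₂) (ofSchwartz f₁)
  simp only [ENNReal.ofReal_one] at h3
  calc convNorm p q (fun _ => 1) (absSTFT γ f₁) (absSTFT γ f₂)
      = amalgamNorm (crossWindow e γ γ) p q (fun _ => 1)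
          (phaseD e (ofSchwartz f₂) (ofSchwartz f₁)) := h3.symm
    _ ≤ C₀ * (C * (modNorm g₁ p₁ q₁ (fun _ _ => 1) (ofSchwartz f₁) *
          modNorm g₂ p₂ q₂ (fun _ _ => 1) (ofSchwartz f₂))) :=
        (h₀ _).trans (mul_le_mul_right (h f₁ f₂) C₀)
    _ ≤ C₀ * (C * ((C₁ * modNorm γ p₁ q₁ (fun _ _ => 1) (ofSchwartz f₁)) *
          (C₂ * modNorm γ p₂ q₂ (fun _ _ => 1) (ofSchwartz f₂)))) :=
        mul_le_mul_right (mul_le_mul_right (mul_le_mul' (h₁ _) (h₂ _)) C) C₀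
    _ = _ := by
        rw [hmod, hmod]
        ring

end TestFunctions

end TimeFreq

/-- Necessary and sufficient conditions on the indices for the short-time Fourier transform and the
cross-ambiguity function to map products of modulation spaces on `ℝ^d` into Wiener amalgam spaces on
`ℝ^{2d}`. The norms are computed with arbitrary fixed nonzero Schwartz windows `g₁`, `g₂` on `ℝ^d`
and `G` on `ℝ^{2d}`. -/
theorem corollary4p2 (d : ℕ) (hd : 1 ≤ d)
    (p₁ q₁ p₂ q₂ p q : ℝ≥0∞) (hp₁ : 1 ≤ p₁) (hq₁ : 1 ≤ q₁) (hp₂ : 1 ≤ p₂) (hq₂ : 1 ≤ q₂)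
    (hp : 1 ≤ p) (hq : 1 ≤ q)
    (g₁ g₂ : 𝓢(EuclideanSpace ℝ (Fin d), ℂ))
    (G : 𝓢(TimeFreq.Phase (EuclideanSpace ℝ (Fin d)), ℂ))
    (hg₁ : g₁ ≠ 0) (hg₂ : g₂ ≠ 0) (hG : G ≠ 0) :
    -- sufficiency, with weights
    (TimeFreq.IndexCondition p₁ q₁ p₂ q₂ p q → ∀ s : ℝ, ∃ C : ℝ, 0 < C ∧
      ∀ f₁ f₂ : 𝓢'(EuclideanSpace ℝ (Fin d), ℂ),
        TimeFreq.MemModulation g₁ p₁ q₁ (TimeFreq.phaseWeight |s|) f₁ →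
        TimeFreq.MemModulation g₂ p₂ q₂ (TimeFreq.phaseWeight s) f₂ →
          (TimeFreq.MemAmalgam G p q (TimeFreq.vWeight s) (TimeFreq.stft f₁ f₂) ∧
            TimeFreq.amalgamNorm G p q (TimeFreq.vWeight s) (TimeFreq.stft f₁ f₂) ≤
              ENNReal.ofReal C * TimeFreq.modNorm g₁ p₁ q₁ (TimeFreq.phaseWeight |s|) f₁ *
                TimeFreq.modNorm g₂ p₂ q₂ (TimeFreq.phaseWeight s) f₂) ∧
          (TimeFreq.MemAmalgam G p q (TimeFreq.vWeight s) (TimeFreq.ambiguity f₁ f₂) ∧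
            TimeFreq.amalgamNorm G p q (TimeFreq.vWeight s) (TimeFreq.ambiguity f₁ f₂) ≤
              ENNReal.ofReal C * TimeFreq.modNorm g₁ p₁ q₁ (TimeFreq.phaseWeight |s|) f₁ *
                TimeFreq.modNorm g₂ p₂ q₂ (TimeFreq.phaseWeight s) f₂)) ∧
    -- necessity, for the short-time Fourier transform
    ((∃ C : ℝ, 0 < C ∧ ∀ f₁ f₂ : 𝓢(EuclideanSpace ℝ (Fin d), ℂ),
        TimeFreq.amalgamNorm G p q (fun _ => 1)
            (TimeFreq.stft (TimeFreq.ofSchwartz f₁) (TimeFreq.ofSchwartz f₂)) ≤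
          ENNReal.ofReal C *
            TimeFreq.modNorm g₁ p₁ q₁ (fun _ _ => 1) (TimeFreq.ofSchwartz f₁) *
            TimeFreq.modNorm g₂ p₂ q₂ (fun _ _ => 1) (TimeFreq.ofSchwartz f₂)) →
      TimeFreq.IndexCondition p₁ q₁ p₂ q₂ p q) ∧
    -- necessity, for the cross-ambiguity function
    ((∃ C : ℝ, 0 < C ∧ ∀ f₁ f₂ : 𝓢(EuclideanSpace ℝ (Fin d), ℂ),
        TimeFreq.amalgamNorm G p q (fun _ => 1)
            (TimeFreq.ambiguity (TimeFreq.ofSchwartz f₁) (TimeFreq.ofSchwartz f₂)) ≤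
          ENNReal.ofReal C *
            TimeFreq.modNorm g₁ p₁ q₁ (fun _ _ => 1) (TimeFreq.ofSchwartz f₁) *
            TimeFreq.modNorm g₂ p₂ q₂ (fun _ _ => 1) (TimeFreq.ofSchwartz f₂)) →
      TimeFreq.IndexCondition p₁ q₁ p₂ q₂ p q) := by
  -- Adding 1 makes the real constant strictly positive.
  have le_ofReal : ∀ {C : ℝ≥0∞}, C ≠ ⊤ → C ≤ ENNReal.ofReal (C.toReal + 1) := fun {C} hC =>
    (ENNReal.ofReal_toReal hC).symm.trans_le (ENNReal.ofReal_le_ofReal (by linarith))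
  have hn : Nontrivial (EuclideanSpace ℝ (Fin d)) := by
    have : Nonempty (Fin d) := ⟨⟨0, hd⟩⟩
    infer_instance
  refine ⟨fun hI s => ?_, fun ⟨C, _, h⟩ => ?_, fun ⟨C, _, h⟩ => ?_⟩
  · obtain ⟨C, hC, h⟩ := TimeFreq.exists_phaseD_bound TimeFreq.isPhaseChange_stftChange
      hp₁ hq₁ hp₂ hq₂ hp hq hI hg₁ hg₂ G (s := s) (s₁ := |s|) (s₂ := s) (c := 2 ^ (|s| / 2))
      -- Peetre for z = w + (z - w): f₂ is evaluated at w with weight v_s, f₁ at w - z with weight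
      -- v_{|s|}.
      (by positivity) fun z w => by
        have := TimeFreq.vWeight_add_le s w (z - w)
        rwa [add_sub_cancel, ← TimeFreq.vWeight_neg |s| (z - w), neg_sub, mul_comm
          (TimeFreq.vWeight s w)] at this
    -- In the ambiguity function the conjugate falls on f₂, so the factors trade places: f₂ is
    -- evaluated at w - z and f₁ at w. Peetre is used for -z = (w - z) + (-w).
    obtain ⟨C', hC', h'⟩ := TimeFreq.exists_phaseD_bound TimeFreq.isPhaseChange_ambChange
      hp₂ hq₂ hp₁ hq₁ hp hq hI.symm hg₂ hg₁ G (s := s) (s₁ := s) (s₂ := |s|) (c := 2 ^ (|s| / 2))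
      (by positivity) fun z w => by
        have := TimeFreq.vWeight_add_le s (w - z) (-w)
        rwa [show w - z + -w = -z by abel, TimeFreq.vWeight_neg, TimeFreq.vWeight_neg] at this
    have hK : max C C' ≠ ⊤ := max_ne_top hC hC'
    refine ⟨(max C C').toReal + 1, by positivity, fun f₁ f₂ h₁ h₂ => ?_⟩
    set A := TimeFreq.modNorm g₁ p₁ q₁ (TimeFreq.phaseWeight |s|) f₁
    set B := TimeFreq.modNorm g₂ p₂ q₂ (TimeFreq.phaseWeight s) f₂
    have fin : ENNReal.ofReal ((max C C').toReal + 1) * A * B < ⊤ :=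
      ENNReal.mul_lt_top (ENNReal.mul_lt_top ENNReal.ofReal_lt_top h₁) h₂
    have k₁ : TimeFreq.amalgamNorm G p q (TimeFreq.vWeight s) (TimeFreq.stft f₁ f₂) ≤
        ENNReal.ofReal ((max C C').toReal + 1) * A * B := by
      rw [mul_assoc]
      exact (h f₁ f₂).trans (mul_le_mul_left ((le_max_left C C').trans (le_ofReal hK)) _)
    have k₂ : TimeFreq.amalgamNorm G p q (TimeFreq.vWeight s) (TimeFreq.ambiguity f₁ f₂) ≤
        ENNReal.ofReal ((max C C').toReal + 1) * A * B := by
      rw [mul_assoc, mul_comm A]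
      exact (h' f₂ f₁).trans (mul_le_mul_left ((le_max_right C C').trans (le_ofReal hK)) _)
    exact ⟨⟨k₁.trans_lt fin, k₁⟩, k₂.trans_lt fin, k₂⟩
  · refine TimeFreq.indexCondition_of_phaseD_bound TimeFreq.isPhaseChange_stftChange
      hp₁ hq₁ hp₂ hq₂ hp hq g₁ g₂ hG (ENNReal.ofReal_ne_top (r := C)) fun f₁ f₂ => ?_
    rw [← mul_assoc]
    exact h f₁ f₂
  -- The order of the factors is again exchanged, and the index condition is symmetric under that
  -- exchange.
  · refine (TimeFreq.indexCondition_of_phaseD_bound TimeFreq.isPhaseChange_ambChange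
      hp₂ hq₂ hp₁ hq₁ hp hq g₂ g₁ hG (ENNReal.ofReal_ne_top (r := C)) fun f₂ f₁ => ?_).symm
    rw [mul_comm (TimeFreq.modNorm g₂ p₂ q₂ _ _), ← mul_assoc]
    exact h f₁ f₂
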